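/- **Setting.** Noisy quantum while-programs act on a finite set of qubits. The statement $\overline q:\cong_{p,\Phi}U[\overline q]$ has the denotation $\rho\mapsto(1-p)U\rho U^\dagger+p\,\Phi(\rho)$, all other constructs have their usual denotation (a loop is the least upper bound of its finite unrollings), and the ideal program of $\widetilde P$ is obtained by replacing every noisy unitary by $\overline q:=U[\overline q]$. For superoperators $\mathcal E,\mathcal E'$ on $\mathcal H$, a quantum predicate $Q$ and $\lambda\in[0,1]$, let $$\|\mathcal E-\mathcal E'\|_{Q,\lambda}=\sup_\rho\ \tfrac12\big\|(\mathcal E\otimes I)(\rho)-(\mathcal E'\otimes I)(\rho)\big\|_1,$$ over all finite-dimensional auxiliary spaces $\mathcal A$ and all density operators $\rho$ on $\mathcal H\otimes\mathcal A$ with $\mathrm{tr}((Q\otimes I)\rho)\ge\lambda$; put $\|\cdot\|_\diamond=\|\cdot\|_{I,0}$. The program $\widetilde P$ with ideal program $P$ is $\epsilon$-robust under $(Q,\lambda)$ if $\|[\![\widetilde P]\!]-[\![P]\!]\|_{Q,\lambda}\le\epsilon$. Let $c\in[0,1]$, $V=\begin{pmatrix}\sqrt c&-\sqrt{1-c}\\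 \sqrt{1-c}&\sqrt c\end{pmatrix}$ and $U=|01\rangle\langle\phi^+|+|00\rangle\langle\phi^-|+|10\rangle\langle\psi^+|+|11\rangle\langle\psi^-|$, where $|\phi^\pm\rangle=(|00\rangle\pm|11\rangle)/\sqrt2$ and $|\psi^\pm\rangle=(|01\rangle\pm|10\rangle)/\sqrt2$. Let $p_V,p_U\in[0,1]$, $\Phi_V(\rho)=(1-p_V)\rho+p_VX\rho X$ and $\Phi_U(\rho)=(1-p_U)\rho+p_UX\rho X$. The quantum Bernoulli factory $\widetilde{QBF}$ is $$q_1:=|1\rangle;\ q_2:=|1\rangle;\ \textbf{while }M[q_2]=1\textbf{ do }\ q_1:=|0\rangle;\ q_2:=|0\rangle;\ \widetilde V[q_1];\ \widetilde V[q_2];\ \widetilde U[q_1,q_2]\ \textbf{ od},$$ where $M$ is the standard basis measurement, $\widetilde V$ is the noisy application of $V$ with probability $1$ and error model $\rho\mapsto\Phi_V(V\rho V^\dagger)$, and $\widetilde U$ that of $U$ with probability $1$ and error model $\rho\mapsto\Phi_U^{\otimes2}(U\rho U^\dagger)$. For the fault-tolerant version, $q_i$ becomes the first of three codeword qubits $\overline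 q_i$ of the repetition code $\alpha|0\rangle+\beta|1\rangle\mapsto\alpha|000\rangle+\beta|111\rangle$, accompanied by two syndrome qubits. $ENCODE$ initializes the four additional qubits to $|0\rangle$ and applies two CNOT gates controlled by $q_i$; $CORRECT$ computes the two parities (codeword qubits 1,2 and codeword qubits 2,3) in the syndrome qubits, flips the codeword qubit that they indicate, and resets the syndrome qubits to $|0\rangle$; $DECODE$ resets the syndrome qubits and undoes the two CNOT gates. These three are noise-free. Let $\overline V$, $\overline U$ be any unitaries on $3$ and $6$ qubits that act on codewords as the encoded $V$, $U$. The loop body of $\widetilde{\overline{QBF}}$ is: $q_1:=|0\rangle$; $q_2:=|0\rangle$; $ENCODE$ on both; noisy $\overline V$ (probability $1$, error model $\rho\mapsto\Phi_V^{\otimes3}(\overline V\rho\overline V^\dagger)$) followed by $CORRECT$, first on $\overline q_1$, then on $\overline q_2$; noisy $\overline U$ (probability $1$, error model $\rho\mapsto\Phi_U^{\otimes6}(\overline U\rho\overline U^\dagger)$) on $\overline q_1,\overline q_2$; $CORRECT$ on both; $DECODE$ on both. Initialization and loop guard are those of $\widetilde{QBF}$. Put $q_V=3p_V^2(1-p_V)+p_V^3$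 and $q_U=3p_U^2(1-p_U)+p_U^3$. **Claim.** 1. Noisy $\overline V$ on $\overline q_i$ followed by $CORRECT[\overline q_i]$ maps every operator $\rho$ supported on the states whose $i$-th block is a codeword with clean ($|00\rangle$) syndrome qubits to $(1-q_V)\overline V\rho\overline V^\dagger+q_VX^{\otimes3}\overline V\rho\overline V^\dagger X^{\otimes3}$. The diamond distance between the three-qubit superoperator given by this formula and $\overline V\circ\overline V^\dagger$ is $\epsilon_{\overline V}=q_V$. The $(Q,1)$-diamond distance between this noisy program fragment and its ideal version is also $q_V$, where $Q$ is the projection onto the states just described. 2. Noisy $\overline U$ followed by $CORRECT$ on both blocks maps every operator $\rho$ supported on the states where both blocks are codewords with clean syndrome qubits to $\big((1-q_U)I\circ I+q_UX^{\otimes3}\circ X^{\otimes3}\big)^{\otimes2}(\overline U\rho\overline U^\dagger)$. The diamond distance between the six-qubit superoperator given by this formula and $\overline U\circ\overline U^\dagger$, and the $(Q,1)$-diamond distance between this fragment and its ideal version ($Q$ the projection onto the states just described), are both $\epsilon_{\overline U}=2q_U-q_U^2$. 3. $\widetilde{\overline{QBF}}$ is $(4\epsilon_{\overline V}+2\epsilon_{\overline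 U})$-robust under $(I,0)$. 4. Without error correction, $\widetilde{QBF}$ is $(4\epsilon_V+2\epsilon_U)$-robust under $(I,0)$, where $\epsilon_V=\|\Phi_V-I\circ I\|_\diamond=p_V$ and $\epsilon_U=\|\Phi_U^{\otimes2}-I\circ I\|_\diamond=2p_U-p_U^2$. 5. With constant error rate $p_V=p_U=p$, there is an absolute constant $C$ such that $\widetilde{\overline{QBF}}$ is $Cp^2$-robust and $\widetilde{QBF}$ is $Cp$-robust under $(I,0)$, for all $p\in[0,1]$. -/

import Mathlib

open scoped ComplexOrder Kronecker ENNReal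

namespace QWhile

noncomputable section

/-! ### Qubit registers and operators -/

/-- Operators on the Hilbert space of a family of qubits indexed by `ι`; the computational basis
is indexed by the bit assignments `ι → Fin 2`. -/
abbrev Op (ι : Type) : Type := Matrix (ι → Fin 2) (ι → Fin 2) ℂ

/-- The superoperator `A ∘ A†`, that is `ρ ↦ A ρ A†`. -/
def sandwich {n : Type} [Fintype n] (A ρ : Matrix n n ℂ) : Matrix n n ℂ := A * ρ * A.conjTranspose

/-- The operator `A` on the qubits listed by the register `r`, tensored with the identity on all
the other qubits. -/
def embed {ι Var : Type} [Fintype ι] [Fintype Var] [DecidableEq Var] (r : ι ↪ Var) (A : Op ι) :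
    Op Var :=
  Matrix.of fun s t => if ∀ v, (∀ i, r i ≠ v) → s v = t v then A (s ∘ r) (t ∘ r) else 0

/-- The tensor product of one-qubit operators, one for each index. -/
def tens {ι : Type} [Fintype ι] (A : ι → Matrix (Fin 2) (Fin 2) ℂ) : Op ι :=
  Matrix.of fun s t => ∏ j, A j (s j) (t j)

/-- The outer product `|v⟩⟨w|`. -/
def outer {n : Type} (v w : n → ℂ) : Matrix n n ℂ := Matrix.vecMulVec v (star w)

/-- The computational basis vector `|s⟩`. -/
def ket {n : Type} [DecidableEq n] (s : n) : n → ℂ := Pi.single s 1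

theorem tens_mul {ι : Type} [Fintype ι] [DecidableEq ι] (A B : ι → Matrix (Fin 2) (Fin 2) ℂ) :
    tens A * tens B = tens fun j => A j * B j := by
  ext s t
  simp only [tens, Matrix.mul_apply, Matrix.of_apply]
  rw [Finset.prod_univ_sum, Fintype.piFinset_univ]
  exact Finset.sum_congr rfl fun x _ => Finset.prod_mul_distrib.symm

theorem tens_conjTranspose {ι : Type} [Fintype ι] (A : ι → Matrix (Fin 2) (Fin 2) ℂ) :
    (tens A).conjTranspose = tens fun j => (A j).conjTranspose := by
  ext s t
  simp [tens, Matrix.conjTranspose_apply, star_prod]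

theorem tens_one {ι : Type} [Fintype ι] [DecidableEq ι] :
    tens (fun _ : ι => (1 : Matrix (Fin 2) (Fin 2) ℂ)) = 1 := by
  ext s t
  simp only [tens, Matrix.of_apply, Matrix.one_apply, Finset.prod_ite_zero, funext_iff]
  simp

/-! ### Superoperators and measurements -/

/-- A completely positive map on `n × n` matrices, given by a finite Kraus family. -/
structure Superop (n : Type) where
  Idx : Type
  fintypeIdx : Fintype Idx
  kraus : Idx → Matrix n n ℂ

attribute [instance] Superop.fintypeIdx

namespace Superop

variable {n : Type} [Fintype n]

/-- `Φ(ρ) = ∑ₖ Eₖ ρ Eₖ†`. -/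
def apply (Φ : Superop n) (ρ : Matrix n n ℂ) : Matrix n n ℂ := ∑ i, sandwich (Φ.kraus i) ρ

/-- Trace-non-increasing: `∑ₖ Eₖ† Eₖ ⊑ I`. -/
def Admissible [DecidableEq n] (Φ : Superop n) : Prop :=
  (1 - ∑ i, (Φ.kraus i).conjTranspose * Φ.kraus i).PosSemidef

/-- Trace-preserving: `∑ₖ Eₖ† Eₖ = I`. -/
def TracePreserving [DecidableEq n] (Φ : Superop n) : Prop :=
  ∑ i, (Φ.kraus i).conjTranspose * Φ.kraus i = 1

theorem TracePreserving.admissible [DecidableEq n] {Φ : Superop n} (h : Φ.TracePreserving) :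
    Φ.Admissible := by
  unfold TracePreserving at h
  unfold Admissible
  rw [h, sub_self]
  exact Matrix.PosSemidef.zero

/-- The map `ρ ↦ Φ(U ρ U†)`. -/
def afterUnitary (Φ : Superop n) (U : Matrix n n ℂ) : Superop n :=
  ⟨Φ.Idx, Φ.fintypeIdx, fun i => Φ.kraus i * U⟩

theorem TracePreserving.afterUnitary [DecidableEq n] {Φ : Superop n} (h : Φ.TracePreserving)
    (U : Matrix.unitaryGroup n ℂ) : (Φ.afterUnitary U.1).TracePreserving := by
  unfold TracePreserving at h ⊢
  have hU : U.1.conjTranspose * U.1 = 1 := Matrix.mem_unitaryGroup_iff'.1 U.2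
  calc ∑ i, (Φ.kraus i * U.1).conjTranspose * (Φ.kraus i * U.1)
      = ∑ i, U.1.conjTranspose * ((Φ.kraus i).conjTranspose * Φ.kraus i) * U.1 := by
        refine Finset.sum_congr rfl fun i _ => ?_
        rw [Matrix.conjTranspose_mul]
        simp only [Matrix.mul_assoc]
    _ = 1 := by rw [← Finset.sum_mul, ← Finset.mul_sum, h, Matrix.mul_one, hU]

/-- The tensor power `Φ^{⊗ι}` of a one-qubit superoperator: `Φ` acts on each of the qubits. -/
def tensorPow (ι : Type) [Fintype ι] [DecidableEq ι] (Φ : Superop (Fin 2)) :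
    Superop (ι → Fin 2) :=
  ⟨ι → Φ.Idx, inferInstance, fun e => tens fun j => Φ.kraus (e j)⟩

theorem TracePreserving.tensorPow (ι : Type) [Fintype ι] [DecidableEq ι] {Φ : Superop (Fin 2)}
    (h : Φ.TracePreserving) : (Φ.tensorPow ι).TracePreserving := by
  unfold TracePreserving at h ⊢
  change ∑ e : ι → Φ.Idx, (tens fun j => Φ.kraus (e j)).conjTranspose *
    (tens fun j => Φ.kraus (e j)) = 1
  simp only [tens_conjTranspose, tens_mul]
  ext s t
  rw [← tens_one, ← h, Matrix.sum_apply]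
  simp only [tens, Matrix.of_apply, Matrix.sum_apply]
  rw [Finset.prod_univ_sum, Fintype.piFinset_univ]

end Superop

/-- A quantum measurement with outcomes in `μ`. -/
structure Measurement (n μ : Type) [Fintype n] [DecidableEq n] [Fintype μ] where
  op : μ → Matrix n n ℂ
  complete : ∑ m, (op m).conjTranspose * op m = 1

/-! ### Noisy quantum while-programs -/

/-- Noisy quantum while-programs over the qubit variables `Var`. A register is an injective list
of variables. `noisy p Φ _ r U` is `r :≅_{p,Φ} U[r]`; `unitary r U` is the noiseless `r := U[r]`. -/
inductive Prog (Var : Type) : Type 1 where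
  | skip : Prog Var
  | init (q : Var) : Prog Var
  | unitary {ι : Type} [Fintype ι] [DecidableEq ι] (r : ι ↪ Var)
      (U : Matrix.unitaryGroup (ι → Fin 2) ℂ) : Prog Var
  | noisy {ι : Type} [Fintype ι] [DecidableEq ι] (p : unitInterval) (Φ : Superop (ι → Fin 2))
      (hΦ : Φ.Admissible) (r : ι ↪ Var) (U : Matrix.unitaryGroup (ι → Fin 2) ℂ) : Prog Var
  | seq (P₁ P₂ : Prog Var) : Prog Var
  | case {ι μ : Type} [Fintype ι] [DecidableEq ι] [Fintype μ] (r : ι ↪ Var)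
      (M : Measurement (ι → Fin 2) μ) (P : μ → Prog Var) : Prog Var
  | loop {ι : Type} [Fintype ι] [DecidableEq ι] (r : ι ↪ Var)
      (M : Measurement (ι → Fin 2) (Fin 2)) (P : Prog Var) : Prog Var

infixr:60 " ;; " => Prog.seq

/-- The ideal program: every noisy unitary is replaced by its noiseless version. -/
def Prog.ideal {Var : Type} : Prog Var → Prog Var
  | .skip => .skip
  | .init q => .init q
  | @Prog.unitary _ _ _ _ r U => .unitary r U
  | @Prog.noisy _ _ _ _ _ _ _ r U => .unitary r U
  | .seq P₁ P₂ => .seq P₁.ideal P₂.ideal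
  | @Prog.case _ _ _ _ _ _ r M P => .case r M fun m => (P m).ideal
  | @Prog.loop _ _ _ _ r M P => .loop r M P.ideal

/-- The denotation of the `k`-th syntactic approximation of the loop with measurement operators
`M₀`, `M₁` and loop body `body`: `while⁽⁰⁾` aborts, and `while⁽ᵏ⁺¹⁾` measures, stops on outcome `0`
and on outcome `1` runs the body and then `while⁽ᵏ⁾`. -/
def whileApprox {n : Type} [Fintype n] (M₀ M₁ : Matrix n n ℂ)
    (body : Matrix n n ℂ → Matrix n n ℂ) : ℕ → Matrix n n ℂ → Matrix n n ℂ
  | 0, _ => 0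
  | k + 1, ρ => sandwich M₀ ρ + whileApprox M₀ M₁ body k (body (sandwich M₁ ρ))

/-- The one-qubit register consisting of `q`. -/
def single {Var : Type} (q : Var) : Fin 1 ↪ Var :=
  ⟨fun _ => q, fun _ _ _ => Subsingleton.elim _ _⟩

/-- The denotational semantics. On a positive semidefinite input the approximations of a loop
increase in the Löwner order and have bounded trace, so their least upper bound is their limit. -/
def Prog.denote {Var : Type} [Fintype Var] [DecidableEq Var] : Prog Var → Op Var → Op Var
  | .skip, ρ => ρ
  | .init q, ρ => ∑ b : Fin 2,
      sandwich (embed (single q) (tens fun _ => outer (ket 0) (ket b))) ρ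
  | @Prog.unitary _ _ _ _ r U, ρ => sandwich (embed r U.1) ρ
  | @Prog.noisy _ _ _ _ p Φ _ r U, ρ => (1 - (p : ℝ) : ℂ) • sandwich (embed r U.1) ρ +
      ((p : ℝ) : ℂ) • ∑ i, sandwich (embed r (Φ.kraus i)) ρ
  | .seq P₁ P₂, ρ => P₂.denote (P₁.denote ρ)
  | @Prog.case _ _ _ _ _ _ r M P, ρ => ∑ m, (P m).denote (sandwich (embed r (M.op m)) ρ)
  | @Prog.loop _ _ _ _ r M P, ρ => Filter.limUnder Filter.atTop fun k =>
      whileApprox (embed r (M.op 0)) (embed r (M.op 1)) P.denote k ρ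

/-! ### Distances and robustness -/

/-- The sum of the absolute values of all eigenvalues, with multiplicity. For Hermitian matrices
this is the trace norm. -/
def traceNorm {n : Type} [Fintype n] [DecidableEq n] (A : Matrix n n ℂ) : ℝ :=
  (A.charpoly.roots.map fun z => ‖z‖).sum

def traceDist {n : Type} [Fintype n] [DecidableEq n] (ρ σ : Matrix n n ℂ) : ℝ :=
  traceNorm (ρ - σ) / 2

/-- `E ⊗ I` for a linear map `E` on matrices: `E` is applied to every block. -/
def tensorId {n a : Type} (E : Matrix n n ℂ → Matrix n n ℂ) (ρ : Matrix (n × a) (n × a) ℂ) :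
    Matrix (n × a) (n × a) ℂ :=
  Matrix.of fun x y => E (Matrix.of fun i j => ρ (i, x.2) (j, y.2)) x.1 y.1

/-- The `(Q, lam)`-diamond norm of `E - E'`: the supremum of the trace distance of `E ⊗ I (ρ)` and
`E' ⊗ I (ρ)` over all auxiliary spaces `ℂᵏ` and all density operators `ρ` with
`tr ((Q ⊗ I) ρ) ≥ lam`. -/
def qDiamond {n : Type} [Fintype n] [DecidableEq n] (Q : Matrix n n ℂ) (lam : ℝ)
    (E E' : Matrix n n ℂ → Matrix n n ℂ) : ℝ≥0∞ :=
  ⨆ (k : ℕ) (ρ : Matrix (n × Fin k) (n × Fin k) ℂ)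
    (_ : ρ.PosSemidef ∧ ρ.trace = 1 ∧
      lam ≤ ((Q ⊗ₖ (1 : Matrix (Fin k) (Fin k) ℂ)) * ρ).trace.re),
    ENNReal.ofReal (traceDist (tensorId E ρ) (tensorId E' ρ))

/-- The diamond norm of `E - E'` (trivial precondition). -/
def diamond {n : Type} [Fintype n] [DecidableEq n] (E E' : Matrix n n ℂ → Matrix n n ℂ) : ℝ≥0∞ :=
  qDiamond 1 0 E E'

/-- The noisy program `P` is `ε`-robust under `(Q, lam)`. -/
def Robust {Var : Type} [Fintype Var] [DecidableEq Var] (Q : Op Var) (lam : ℝ) (P : Prog Var)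
    (ε : ℝ) : Prop :=
  qDiamond Q lam P.denote P.ideal.denote ≤ ENNReal.ofReal ε

/-! ### Gates -/

def pauliX : Matrix (Fin 2) (Fin 2) ℂ := !![0, 1; 1, 0]

theorem pauliX_mul_self : pauliX * pauliX = 1 := by
  ext i j; fin_cases i <;> fin_cases j <;> simp [pauliX]

theorem pauliX_conjTranspose : pauliX.conjTranspose = pauliX := by
  ext i j; fin_cases i <;> fin_cases j <;> simp [pauliX]

theorem tens_mem_unitaryGroup {ι : Type} [Fintype ι] [DecidableEq ι]
    {A : ι → Matrix (Fin 2) (Fin 2) ℂ} (h : ∀ j, A j * (A j).conjTranspose = 1) :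
    tens A ∈ Matrix.unitaryGroup (ι → Fin 2) ℂ := by
  rw [Matrix.mem_unitaryGroup_iff, Matrix.star_eq_conjTranspose, tens_conjTranspose, tens_mul]
  simp only [h, tens_one]

/-- A one-qubit unitary, as a gate on a register of length one. -/
def gate1 (A : Matrix.unitaryGroup (Fin 2) ℂ) : Matrix.unitaryGroup (Fin 1 → Fin 2) ℂ :=
  ⟨tens fun _ => A.1, tens_mem_unitaryGroup fun _ => Matrix.mem_unitaryGroup_iff.1 A.2⟩

def gateX : Matrix.unitaryGroup (Fin 2) ℂ :=
  ⟨pauliX, Matrix.mem_unitaryGroup_iff.2 (by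
    rw [Matrix.star_eq_conjTranspose, pauliX_conjTranspose, pauliX_mul_self])⟩

/-- The unitary `|s⟩ ↦ |f s⟩` of a reversible classical gate `f`. -/
def permGate {n : Type} [Fintype n] [DecidableEq n] (f : n → n) (hf : Function.Involutive f) :
    Matrix.unitaryGroup n ℂ :=
  ⟨Matrix.of fun s t => if s = f t then 1 else 0, by
    rw [Matrix.mem_unitaryGroup_iff]
    ext s t
    simp only [Matrix.mul_apply, Matrix.star_apply, Matrix.of_apply, Matrix.one_apply]
    rw [Finset.sum_eq_single (f s)]
    · simp [hf s, eq_comm]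
    · intro b _ hb
      rw [if_neg, zero_mul]
      rintro rfl
      exact hb (hf b).symm
    · simp⟩

/-- `|a, b⟩ ↦ |a, b ⊕ a⟩`. -/
def cnot : Matrix.unitaryGroup (Fin 2 → Fin 2) ℂ :=
  permGate (fun s => ![s 0, s 1 + s 0]) (by unfold Function.Involutive; decide)

/-- The `ab`-Toffoli gate: it flips the last qubit if the first two qubits read `a`, `b`. -/
def toffoli (a b : Fin 2) : Matrix.unitaryGroup (Fin 3 → Fin 2) ℂ :=
  permGate (fun s => ![s 0, s 1, if s 0 = a ∧ s 1 = b then s 2 + 1 else s 2])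
    (by unfold Function.Involutive; revert a b; decide)

/-- The standard basis measurement `{|0⟩⟨0|, |1⟩⟨1|}` of one qubit. -/
def stdMeas : Measurement (Fin 1 → Fin 2) (Fin 2) where
  op m := tens fun _ => outer (ket m) (ket m)
  complete := by
    simp only [tens_conjTranspose, tens_mul]
    ext s t
    obtain ⟨a, rfl⟩ : ∃ a, s = fun _ => a := ⟨s 0, funext fun i => by rw [Subsingleton.elim i 0]⟩
    obtain ⟨b, rfl⟩ : ∃ b, t = fun _ => b := ⟨t 0, funext fun i => by rw [Subsingleton.elim i 0]⟩
    have hab : ((fun _ : Fin 1 => a) = fun _ => b) ↔ a = b :=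
      ⟨fun h => congrFun h 0, fun h => by rw [h]⟩
    simp only [tens, outer, ket, Matrix.of_apply, Matrix.sum_apply, Fintype.prod_unique,
      Matrix.one_apply, hab]
    fin_cases a <;> fin_cases b <;>
      simp [Matrix.mul_apply, Matrix.vecMulVec_apply, Fin.sum_univ_two]

/-! ### The quantum Bernoulli factory -/

/-- The gate `V`, which prepares the quantum coin `√c |0⟩ + √(1-c) |1⟩` from `|0⟩`. -/
def coinV (c : unitInterval) : Matrix.unitaryGroup (Fin 2) ℂ :=
  ⟨!![(√(c : ℝ) : ℂ), -(√(1 - (c : ℝ)) : ℂ); (√(1 - (c : ℝ)) : ℂ), (√(c : ℝ) : ℂ)], by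
    have h1 : ((√(c : ℝ) : ℝ) : ℂ) * ((√(c : ℝ) : ℝ) : ℂ) = ((c : ℝ) : ℂ) := by
      rw [← Complex.ofReal_mul, Real.mul_self_sqrt c.2.1]
    have h2 : ((√(1 - (c : ℝ)) : ℝ) : ℂ) * ((√(1 - (c : ℝ)) : ℝ) : ℂ) = 1 - ((c : ℝ) : ℂ) := by
      rw [← Complex.ofReal_mul, Real.mul_self_sqrt (sub_nonneg.2 c.2.2)]
      push_cast; ring
    rw [Matrix.mem_unitaryGroup_iff]
    ext i j
    fin_cases i <;> fin_cases j <;>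
      simp [Matrix.mul_apply, Fin.sum_univ_two, Matrix.star_apply, h1, h2, mul_comm]⟩

/-- `|φ^±⟩ = (|00⟩ ± |11⟩)/√2`, with the sign given by `e`. -/
def bellPhi (e : ℂ) : (Fin 2 → Fin 2) → ℂ := (1 / (√2 : ℝ) : ℂ) • (ket ![0, 0] + e • ket ![1, 1])

/-- `|ψ^±⟩ = (|01⟩ ± |10⟩)/√2`, with the sign given by `e`. -/
def bellPsi (e : ℂ) : (Fin 2 → Fin 2) → ℂ := (1 / (√2 : ℝ) : ℂ) • (ket ![0, 1] + e • ket ![1, 0])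

/-- `|01⟩⟨φ⁺| + |00⟩⟨φ⁻| + |10⟩⟨ψ⁺| + |11⟩⟨ψ⁻|`. -/
def bellMatrix : Op (Fin 2) :=
  outer (ket ![0, 1]) (bellPhi 1) + outer (ket ![0, 0]) (bellPhi (-1)) +
    outer (ket ![1, 0]) (bellPsi 1) + outer (ket ![1, 1]) (bellPsi (-1))

theorem bellMatrix_mem_unitaryGroup :
    bellMatrix ∈ Matrix.unitaryGroup (Fin 2 → Fin 2) ℂ := by
  have h : ((√2 : ℝ) : ℂ)⁻¹ * ((√2 : ℝ) : ℂ)⁻¹ = 1/2 := by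
    rw [← mul_inv, ← Complex.ofReal_mul, Real.mul_self_sqrt (by norm_num)]; norm_num
  have key : ∀ f : (Fin 2 → Fin 2) → ℂ, ∑ s, f s = f ![0,0] + f ![0,1] + f ![1,0] + f ![1,1] := by
    intro f
    rw [← (finTwoArrowEquiv (Fin 2)).symm.sum_comp, Fintype.sum_prod_type]
    simp [Fin.sum_univ_two, finTwoArrowEquiv]
    ring
  have hk : ∀ a b c d : Fin 2, ket ![a,b] ![c,d] = if c = a ∧ d = b then (1:ℂ) else 0 := by
    intro a b c d
    simp [ket, Pi.single_apply, funext_iff, Fin.forall_fin_two]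
  rw [Matrix.mem_unitaryGroup_iff]
  ext s t
  obtain ⟨a, b, rfl⟩ : ∃ a b, s = ![a,b] := ⟨s 0, s 1, by ext i; fin_cases i <;> rfl⟩
  obtain ⟨c, d, rfl⟩ : ∃ c d, t = ![c,d] := ⟨t 0, t 1, by ext i; fin_cases i <;> rfl⟩
  rw [Matrix.mul_apply, key]
  simp only [bellMatrix, bellPhi, bellPsi, outer, Matrix.add_apply, Matrix.vecMulVec_apply,
    Matrix.star_apply, hk, Pi.star_apply, Pi.smul_apply, Pi.add_apply, Matrix.one_apply]
  fin_cases a <;> fin_cases b <;> fin_cases c <;> fin_cases d <;>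
    simp <;> try (linear_combination 2 * h)

def bellU : Matrix.unitaryGroup (Fin 2 → Fin 2) ℂ := ⟨bellMatrix, bellMatrix_mem_unitaryGroup⟩

/-- The bit-flip channel `ρ ↦ (1-p) ρ + p X ρ X`. -/
def bitFlip (p : unitInterval) : Superop (Fin 2) :=
  ⟨Fin 2, inferInstance,
    ![(√(1 - (p : ℝ)) : ℂ) • (1 : Matrix (Fin 2) (Fin 2) ℂ), (√(p : ℝ) : ℂ) • pauliX]⟩

theorem bitFlip_tracePreserving (p : unitInterval) : (bitFlip p).TracePreserving := by
  have h1 : ((√(p : ℝ) : ℝ) : ℂ) * ((√(p : ℝ) : ℝ) : ℂ) = ((p : ℝ) : ℂ) := by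
    rw [← Complex.ofReal_mul, Real.mul_self_sqrt p.2.1]
  have h2 : ((√(1 - (p : ℝ)) : ℝ) : ℂ) * ((√(1 - (p : ℝ)) : ℝ) : ℂ) = 1 - ((p : ℝ) : ℂ) := by
    rw [← Complex.ofReal_mul, Real.mul_self_sqrt (sub_nonneg.2 p.2.2)]
    push_cast; ring
  unfold Superop.TracePreserving
  change ∑ i : Fin 2, ((![(√(1 - (p : ℝ)) : ℂ) • (1 : Matrix (Fin 2) (Fin 2) ℂ),
    (√(p : ℝ) : ℂ) • pauliX] : Fin 2 → _) i).conjTranspose * (![(√(1 - (p : ℝ)) : ℂ) •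
    (1 : Matrix (Fin 2) (Fin 2) ℂ), (√(p : ℝ) : ℂ) • pauliX] : Fin 2 → _) i = 1
  have e : ∀ (z : ℂ) (A : Matrix (Fin 2) (Fin 2) ℂ), star z = z →
      (z • A).conjTranspose * (z • A) = (z * z) • (A.conjTranspose * A) := by
    intro z A hz
    rw [Matrix.conjTranspose_smul, hz, Matrix.smul_mul, Matrix.mul_smul, smul_smul]
  rw [Fin.sum_univ_two, Matrix.cons_val_zero, Matrix.cons_val_one,
    Matrix.cons_val_zero, e _ _ (Complex.conj_ofReal _), e _ _ (Complex.conj_ofReal _), h1, h2, pauliX_conjTranspose, pauliX_mul_self,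
    Matrix.conjTranspose_one, Matrix.mul_one, ← add_smul, sub_add_cancel, one_smul]

/-- `r :≅_{1,Φ} U[r]`, where `Φ` applies `U` and then independent bit flips, with probability `p`
each, to the qubits of `r`. -/
def flipNoisy {ι Var : Type} [Fintype ι] [DecidableEq ι] (p : unitInterval) (r : ι ↪ Var)
    (U : Matrix.unitaryGroup (ι → Fin 2) ℂ) : Prog Var :=
  .noisy 1 (((bitFlip p).tensorPow ι).afterUnitary U.1)
    (((bitFlip_tracePreserving p).tensorPow ι).afterUnitary U).admissible r U

/-- The register `a, b`. -/
def pair {Var : Type} (a b : Var) (h : a ≠ b) : Fin 2 ↪ Var :=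
  ⟨![a, b], by
    intro i j hij
    fin_cases i <;> fin_cases j <;> simp_all⟩

/-- `q := |1⟩`, that is `q := |0⟩; q := X[q]`. -/
def initOne {Var : Type} (q : Var) : Prog Var := .init q ;; .unitary (single q) (gate1 gateX)

/-- The noisy quantum Bernoulli factory without error correction. -/
def qbf (c pV pU : unitInterval) : Prog (Fin 2) :=
  initOne 0 ;; initOne 1 ;;
  .loop (single 1) stdMeas
    (.init 0 ;; .init 1 ;;
      flipNoisy pV (single 0) (gate1 (coinV c)) ;;
      flipNoisy pV (single 1) (gate1 (coinV c)) ;;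
      flipNoisy pU (pair 0 1 (by decide)) bellU)

/-! ### The fault-tolerant quantum Bernoulli factory -/

/-- The qubits of the fault-tolerant factory: two blocks of five qubits. In each block, qubits
`0, 1, 2` hold the codeword (and qubit `0` is the logical qubit outside of the encoded part),
qubits `3, 4` are the syndrome qubits. -/
abbrev FTVar : Type := Fin 2 × Fin 5

/-- The codeword register of block `i`. -/
def block (i : Fin 2) : Fin 3 ↪ FTVar :=
  ⟨fun j => (i, Fin.castLE (by decide : 3 ≤ 5) j),
    fun _ _ h => Fin.castLE_injective (by decide : 3 ≤ 5) (Prod.ext_iff.1 h).2⟩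

/-- The register of the six codeword qubits. -/
def blocks : Fin 2 × Fin 3 ↪ FTVar :=
  ⟨fun ij => block ij.1 ij.2, by
    rintro ⟨i, j⟩ ⟨i', j'⟩ h
    obtain ⟨h1, h2⟩ := Prod.ext_iff.1 h
    exact Prod.ext h1 (Fin.castLE_injective (by decide : 3 ≤ 5) h2)⟩

/-- A controlled-not inside block `i`. -/
def cnotAt (i : Fin 2) (a b : Fin 5) (h : a ≠ b) : Prog FTVar :=
  .unitary (pair (i, a) (i, b) fun e => h (Prod.ext_iff.1 e).2) cnot

/-- The `ab`-Toffoli gate of block `i`, controlled by the syndrome qubits, on codeword qubit `j`. -/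
def toffoliAt (i : Fin 2) (a b : Fin 2) (j : Fin 3) : Prog FTVar :=
  .unitary ⟨![(i, 3), (i, 4), block i j], by
    have h : ∀ j : Fin 3, Function.Injective
        ![(3 : Fin 5), 4, Fin.castLE (by decide : 3 ≤ 5) j] := by
      unfold Function.Injective; decide
    intro x y hxy
    refine h j ?_
    fin_cases x <;> fin_cases y <;> first | rfl | exact (Prod.ext_iff.1 hxy).2⟩ (toffoli a b)

/-- `ENCODE`: initialization of the four additional qubits, `α|0⟩ + β|1⟩ ↦ α|000⟩ + β|111⟩`. -/
def encode (i : Fin 2) : Prog FTVar :=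
  .init (i, 1) ;; .init (i, 2) ;; .init (i, 3) ;; .init (i, 4) ;;
  cnotAt i 0 1 (by decide) ;; cnotAt i 0 2 (by decide)

/-- `CORRECT`: syndrome detection, error correction, and reset of the syndrome qubits. -/
def correct (i : Fin 2) : Prog FTVar :=
  cnotAt i 0 3 (by decide) ;; cnotAt i 1 3 (by decide) ;;
  cnotAt i 1 4 (by decide) ;; cnotAt i 2 4 (by decide) ;;
  toffoliAt i 1 1 1 ;; toffoliAt i 0 1 2 ;; toffoliAt i 1 0 0 ;;
  .init (i, 3) ;; .init (i, 4)

/-- `DECODE`: syndrome clean-up and decoding. -/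
def decode (i : Fin 2) : Prog FTVar :=
  .init (i, 3) ;; .init (i, 4) ;; cnotAt i 0 2 (by decide) ;; cnotAt i 0 1 (by decide)

/-- The noisy encoded `V̄` on block `i`, followed by correction. -/
def correctedV (pV : unitInterval) (V' : Matrix.unitaryGroup (Fin 3 → Fin 2) ℂ) (i : Fin 2) :
    Prog FTVar :=
  flipNoisy pV (block i) V' ;; correct i

/-- The noisy encoded `Ū`, followed by correction of both blocks. -/
def correctedU (pU : unitInterval) (U' : Matrix.unitaryGroup (Fin 2 × Fin 3 → Fin 2) ℂ) :
    Prog FTVar :=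
  flipNoisy pU blocks U' ;; correct 0 ;; correct 1

/-- The noisy fault-tolerant quantum Bernoulli factory, with encoded gates `V'` and `U'`. -/
def ftQbf (pV pU : unitInterval) (V' : Matrix.unitaryGroup (Fin 3 → Fin 2) ℂ)
    (U' : Matrix.unitaryGroup (Fin 2 × Fin 3 → Fin 2) ℂ) : Prog FTVar :=
  initOne (0, 0) ;; initOne (1, 0) ;;
  .loop (single (1, 0)) stdMeas
    (.init (0, 0) ;; .init (1, 0) ;; encode 0 ;; encode 1 ;;
      correctedV pV V' 0 ;; correctedV pV V' 1 ;; correctedU pU U' ;;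
      decode 0 ;; decode 1)

/-- The encoding isometry `|x⟩ ↦ |xxx⟩` of the three-qubit repetition code. -/
def encIso : Matrix (Fin 3 → Fin 2) (Fin 2) ℂ :=
  Matrix.of fun s x => if ∀ j, s j = x then 1 else 0

/-- The encoding isometry of two blocks. -/
def encIso₂ : Matrix (Fin 2 × Fin 3 → Fin 2) (Fin 2 → Fin 2) ℂ :=
  Matrix.of fun s x => if ∀ i j, s (i, j) = x i then 1 else 0

/-- `V'` is an encoded version of `V`: it acts as `V` on codewords. -/
def Encodes (V' : Matrix.unitaryGroup (Fin 3 → Fin 2) ℂ) (V : Matrix.unitaryGroup (Fin 2) ℂ) :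
    Prop :=
  V'.1 * encIso = encIso * V.1

/-- `U'` is an encoded version of the two-qubit gate `U`. -/
def Encodes₂ (U' : Matrix.unitaryGroup (Fin 2 × Fin 3 → Fin 2) ℂ)
    (U : Matrix.unitaryGroup (Fin 2 → Fin 2) ℂ) : Prop :=
  U'.1 * encIso₂ = encIso₂ * U.1

/-- The predicate that block `i` holds a codeword and its syndrome qubits are `|00⟩`: the diagonal
projection onto the basis states with these properties. -/
def codeProj (i : Fin 2) : Op FTVar :=
  Matrix.diagonal fun s =>
    if s (i, 0) = s (i, 1) ∧ s (i, 1) = s (i, 2) ∧ s (i, 3) = 0 ∧ s (i, 4) = 0 then 1 else 0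

/-- `X^{⊗3}`. -/
def xxx : Op (Fin 3) := tens fun _ => pauliX

/-- `X^{⊗3}` on each block `i` with `b i = 1`, and the identity on the other blocks. -/
def blockX (b : Fin 2 → Fin 2) : Op (Fin 2 × Fin 3) := tens fun ij => if b ij.1 = 1 then pauliX else 1

/-- The probability that precisely the blocks `i` with `b i = 1` are flipped, if every block is
flipped independently with probability `q`. -/
def flipProb (q : ℝ) (b : Fin 2 → Fin 2) : ℝ := ∏ i, if b i = 1 then q else 1 - q

/-- The logical error probability `3p²(1-p) + p³`. -/
def logicalErr (p : ℝ) : ℝ := 3 * p ^ 2 * (1 - p) + p ^ 3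

end

end QWhile

open QWhile

/-!
Both factories are analysed exactly. The body of the loop starts with a reset of all qubits, so that
it maps every input `ρ` to `tr ρ • σ` for one state `σ`. Hence the approximations of the loop are
partial sums of a geometric series, and the whole program maps `ρ` to `tr ρ` times the state `σ`
conditioned on the outcome `0` of the guard (`denote_initOne_loop_of_reset`). In the ideal program
this outcome has probability `1 / 2` (`trace_sandwich_coinState_zero`).

With `w` the probability that no logical error happens in one run of the body, the noisy state
dominates `w` times the ideal one, `σ ≥ w σ'` (`posSemidef_coinState_sub`). Conditioning on an event
of probability `1 / 2` at most doubles the error, so that the programs differ by at most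
`2 (1 - w)` (`qDiamond_conditioned_le`), and `w = (1 - q)² (1 - u)²` for error rates `q` of `V` and
`u` of `U`. Trace norms enter only through the triangle inequality for a difference of two positive
operators (`traceNorm_sub_le`). The ideal programs need no separate treatment: they have the
denotation of the noisy ones with error rates `0`.

For the gates, correction turns a flip pattern on a codeword into the majority of the three flips of
each block (`denote_correct_flip`). This is proved on the operators `|s⟩⟨t|` with basis states `s`,
`t`, where every gate involved acts by a map of bits and every reset by a comparison of bits. The
majority of three independent flips with probability `p` is a flip with probability `logicalErr p`
(`sum_flipWeight_maj_eq`); this gives `denote_correctedV` and `denote_correctedU`. The encoding of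
both logical qubits then intertwines the fault-tolerant body with the body of the plain factory with
logical error rates (`denote_correctedV_transport`, `denote_correctedU_transport`).

All exact distances are instances of `qDiamond_mixture`: a mixture of isometries with weights `w b`
is at distance `1 - w b₀` from its component `b₀`. The upper bound is the triangle inequality, and
it is attained at a state that the components send to different basis states.
-/

namespace QWhile

noncomputable section

/-! ### Sandwiches and rank-one operators -/

theorem outer_apply {n : Type} (v w : n → ℂ) (i j : n) : outer v w i j = v i * star (w j) := by
  simp [outer, Matrix.vecMulVec_apply]

theorem outer_ket_ket {n : Type} [DecidableEq n] (s t : n) :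
    outer (ket s) (ket t) = Matrix.single s t 1 := by
  ext i j
  simp only [outer_apply, ket, Matrix.single_apply, Pi.single_apply, eq_comm (a := s),
    eq_comm (a := t)]
  by_cases h1 : i = s <;> by_cases h2 : j = t <;> simp [h1, h2]

section Sandwich

variable {n : Type} [Fintype n]

theorem sandwich_mul (A B ρ : Matrix n n ℂ) :
    sandwich (A * B) ρ = sandwich A (sandwich B ρ) := by
  simp only [sandwich, Matrix.conjTranspose_mul, Matrix.mul_assoc]

theorem sandwich_add (A ρ σ : Matrix n n ℂ) :
    sandwich A (ρ + σ) = sandwich A ρ + sandwich A σ := by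
  simp only [sandwich, Matrix.mul_add, Matrix.add_mul]

theorem sandwich_smul (A : Matrix n n ℂ) (z : ℂ) (ρ : Matrix n n ℂ) :
    sandwich A (z • ρ) = z • sandwich A ρ := by
  simp only [sandwich, Matrix.mul_smul, Matrix.smul_mul]

theorem smul_sandwich (A : Matrix n n ℂ) (z : ℂ) (ρ : Matrix n n ℂ) :
    sandwich (z • A) ρ = (z * star z) • sandwich A ρ := by
  simp only [sandwich, Matrix.conjTranspose_smul, Matrix.mul_smul, Matrix.smul_mul, smul_smul,
    mul_comm]

theorem sandwich_sum {β : Type} (A : Matrix n n ℂ) (s : Finset β) (f : β → Matrix n n ℂ) :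
    sandwich A (∑ b ∈ s, f b) = ∑ b ∈ s, sandwich A (f b) := by
  simp only [sandwich, Matrix.mul_sum, Matrix.sum_mul]

theorem sandwich_one [DecidableEq n] (ρ : Matrix n n ℂ) : sandwich 1 ρ = ρ := by
  simp [sandwich]

theorem sandwich_zero (ρ : Matrix n n ℂ) : sandwich 0 ρ = 0 := by simp [sandwich]

theorem posSemidef_sandwich (A : Matrix n n ℂ) {ρ : Matrix n n ℂ} (h : ρ.PosSemidef) :
    (sandwich A ρ).PosSemidef := h.mul_mul_conjTranspose_same A

theorem trace_sandwich (A ρ : Matrix n n ℂ) :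
    (sandwich A ρ).trace = (A.conjTranspose * A * ρ).trace := by
  rw [sandwich, Matrix.trace_mul_comm, Matrix.mul_assoc]

theorem trace_sandwich_of_isometry [DecidableEq n] {A : Matrix n n ℂ}
    (h : A.conjTranspose * A = 1) (ρ : Matrix n n ℂ) : (sandwich A ρ).trace = ρ.trace := by
  rw [trace_sandwich, h, Matrix.one_mul]

theorem sandwich_outer (A : Matrix n n ℂ) (v w : n → ℂ) :
    sandwich A (outer v w) = outer (A.mulVec v) (A.mulVec w) := by
  rw [sandwich, outer, outer, Matrix.mul_vecMulVec, Matrix.vecMulVec_mul, Matrix.star_mulVec]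

theorem trace_outer (v w : n → ℂ) : (outer v w).trace = dotProduct v (star w) := by
  simp [Matrix.trace, outer_apply, dotProduct]

theorem posSemidef_outer (v : n → ℂ) : (outer v v).PosSemidef :=
  Matrix.posSemidef_vecMulVec_self_star v

theorem eq_sum_outer_ket [DecidableEq n] (ρ : Matrix n n ℂ) :
    ρ = ∑ s, ∑ t, ρ s t • outer (ket s) (ket t) := by
  conv_lhs => rw [Matrix.matrix_eq_sum_single ρ]
  simp [outer_ket_ket, Matrix.smul_single]

end Sandwich

/-! ### The trace norm -/

section TraceNorm

variable {n : Type} [Fintype n] [DecidableEq n]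

/-- The triangle inequality for the trace norm, for a difference of positive operators. -/
theorem traceNorm_sub_le {A B : Matrix n n ℂ} (hA : A.PosSemidef) (hB : B.PosSemidef) :
    traceNorm (A - B) ≤ A.trace.re + B.trace.re := by
  have h : (A - B).IsHermitian := hA.1.sub hB.1
  have e : traceNorm (A - B) = ∑ i, |h.eigenvalues i| := by
    rw [traceNorm, h.roots_charpoly_eq_eigenvalues, Multiset.map_map]
    change ∑ i, _ = _
    simp
  -- in an eigenbasis of `A - B` every eigenvalue is a difference of two nonnegative numbers
  set U : Matrix n n ℂ := (h.eigenvectorUnitary : Matrix n n ℂ) with hU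
  have hUU : U * U.conjTranspose = 1 := Matrix.mem_unitaryGroup_iff.1 h.eigenvectorUnitary.2
  have tr : ∀ C : Matrix n n ℂ, (U.conjTranspose * C * U).trace = C.trace := fun C => by
    rw [Matrix.mul_assoc, Matrix.trace_mul_comm, Matrix.mul_assoc, hUU, Matrix.mul_one]
  have d : U.conjTranspose * A * U - U.conjTranspose * B * U =
      Matrix.diagonal (RCLike.ofReal ∘ h.eigenvalues) := by
    rw [← h.conjStarAlgAut_star_eigenvectorUnitary, Unitary.conjStarAlgAut_star_apply,
      ← Matrix.sub_mul, ← Matrix.mul_sub]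
    rfl
  have pA := hA.conjTranspose_mul_mul_same U
  have pB := hB.conjTranspose_mul_mul_same U
  rw [e, ← tr A, ← tr B, Matrix.trace, Matrix.trace, Complex.re_sum, Complex.re_sum,
    ← Finset.sum_add_distrib]
  refine Finset.sum_le_sum fun i _ => ?_
  have di := congrArg Complex.re (congrFun (congrFun d i) i)
  simp only [Matrix.sub_apply, Matrix.diagonal_apply_eq, Complex.sub_re, Function.comp_apply] at di
  have a0 := (Complex.le_def.1 (pA.diag_nonneg (i := i))).1
  have b0 := (Complex.le_def.1 (pB.diag_nonneg (i := i))).1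
  simp only [Complex.zero_re, Matrix.diag_apply] at a0 b0 ⊢
  have di' : h.eigenvalues i = ((U.conjTranspose * A * U) i i).re -
      ((U.conjTranspose * B * U) i i).re := di.symm
  rw [di', abs_le]
  constructor <;> linarith

theorem traceNorm_diagonal (d : n → ℂ) : traceNorm (Matrix.diagonal d) = ∑ i, ‖d i‖ := by
  rw [traceNorm, Matrix.charpoly_diagonal, Polynomial.roots_prod]
  · simp
  · simp [Finset.prod_ne_zero_iff, Polynomial.X_sub_C_ne_zero]

end TraceNorm

/-! ### Superoperators with an ancilla -/

theorem tensorId_sandwich {n a : Type} [Fintype n] [Fintype a] [DecidableEq a]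
    (A : Matrix n n ℂ) (ρ : Matrix (n × a) (n × a) ℂ) :
    tensorId (sandwich A) ρ = sandwich (A ⊗ₖ (1 : Matrix a a ℂ)) ρ := by
  ext ⟨x, u⟩ ⟨y, v⟩
  simp only [tensorId, sandwich, Matrix.of_apply, Matrix.mul_apply, Matrix.conjTranspose_apply,
    Matrix.kroneckerMap_apply, Fintype.sum_prod_type, Matrix.one_apply, mul_ite, mul_one, mul_zero,
    ite_mul, zero_mul, Finset.sum_ite_eq, Finset.mem_univ, if_true, apply_ite star, star_zero]

theorem tensorId_kronecker {n a : Type} {E : Matrix n n ℂ → Matrix n n ℂ}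
    (hE : ∀ (z : ℂ) ρ, E (z • ρ) = z • E ρ) (σ : Matrix n n ℂ) (τ : Matrix a a ℂ) :
    tensorId E (σ ⊗ₖ τ) = E σ ⊗ₖ τ := by
  ext ⟨x, u⟩ ⟨y, v⟩
  have : (Matrix.of fun i j => (σ ⊗ₖ τ) (i, u) (j, v)) = τ u v • σ := by
    ext i j; simp [Matrix.kroneckerMap_apply, mul_comm]
  change E (Matrix.of fun i j => (σ ⊗ₖ τ) (i, u) (j, v)) x y = _
  rw [this, hE, Matrix.smul_apply, Matrix.kroneckerMap_apply, smul_eq_mul, mul_comm]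

section Ancilla

variable {n a : Type} [Fintype n] [DecidableEq n] [Fintype a] [DecidableEq a]

theorem isometry_kronecker_one {A : Matrix n n ℂ} (h : A.conjTranspose * A = 1) :
    (A ⊗ₖ (1 : Matrix a a ℂ)).conjTranspose * (A ⊗ₖ (1 : Matrix a a ℂ)) = 1 := by
  rw [Matrix.conjTranspose_kronecker, ← Matrix.mul_kronecker_mul, h, Matrix.conjTranspose_one,
    Matrix.one_mul, Matrix.one_kronecker_one]

/-- The support of `ρ` lies in the span of the basis vectors with the property `S`. -/
def SupportedOn (S : n → Prop) (ρ : Matrix n n ℂ) : Prop :=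
  ∀ s t, ρ s t ≠ 0 → S s ∧ S t

/-- A zero diagonal entry of a positive operator forces the whole column to vanish. -/
theorem apply_eq_zero_of_diag_eq_zero {ρ : Matrix n n ℂ} (h : ρ.PosSemidef) {i : n}
    (hi : ρ i i = 0) (j : n) : ρ j i = 0 := by
  have := (h.dotProduct_mulVec_zero_iff (Pi.single i 1)).1 (by
    rw [Matrix.mulVec_single_one, ← Pi.single_star, single_dotProduct]; simp [hi])
  rw [Matrix.mulVec_single_one] at this
  exact congrFun this j

/-- A state that satisfies a diagonal projective predicate with certainty is supported on it. -/
theorem supportedOn_of_trace_ge_one (S : n → Prop) [DecidablePred S]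
    {ρ : Matrix (n × a) (n × a) ℂ} (h : ρ.PosSemidef) (h1 : ρ.trace = 1)
    (hS : 1 ≤ ((Matrix.diagonal (fun s => if S s then (1 : ℂ) else 0) ⊗ₖ
      (1 : Matrix a a ℂ)) * ρ).trace.re) :
    SupportedOn (fun x : n × a => S x.1) ρ := by
  have hnn : ∀ x, 0 ≤ (ρ x x).re := fun x => (Complex.le_def.1 (h.diag_nonneg (i := x))).1
  have him : ∀ x, (ρ x x).im = 0 := fun x => (Complex.le_def.1 (h.diag_nonneg (i := x))).2.symm
  have t1 : ∑ x, (ρ x x).re = 1 := by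
    have := congrArg Complex.re h1
    rwa [Matrix.trace, Complex.re_sum] at this
  have t2 : 1 ≤ ∑ x, if S x.1 then (ρ x x).re else 0 := by
    refine hS.trans_eq ?_
    rw [← Matrix.diagonal_one, Matrix.diagonal_kronecker_diagonal, Matrix.trace, Complex.re_sum]
    refine Finset.sum_congr rfl fun x _ => ?_
    rw [Matrix.diag_apply, Matrix.diagonal_mul]
    split_ifs <;> simp
  have t3 : ∑ x, ((ρ x x).re - if S x.1 then (ρ x x).re else 0) = 0 := by
    refine le_antisymm ?_ (Finset.sum_nonneg fun x _ => ?_)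
    · rw [Finset.sum_sub_distrib]; linarith
    · split_ifs
      · simp
      · simpa using hnn x
  have t4 : ∀ x : n × a, ¬ S x.1 → ρ x x = 0 := by
    intro x hx
    have := (Finset.sum_eq_zero_iff_of_nonneg (fun x _ => by
      split_ifs
      · simp
      · simpa using hnn x)).1 t3 x (Finset.mem_univ _)
    rw [if_neg hx, sub_zero] at this
    exact Complex.ext this (him x)
  intro x y hxy
  refine ⟨by_contra fun hx => hxy ?_,
    by_contra fun hy => hxy (apply_eq_zero_of_diag_eq_zero h (t4 y hy) x)⟩
  rw [← h.1.apply, apply_eq_zero_of_diag_eq_zero h (t4 x hx) y, star_zero]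

/-- The distance between a mixture of isometries and one of its components is the weight of the
other components, if some admissible pure state is sent to different basis states by all
components. -/
theorem qDiamond_mixture {β : Type} [Fintype β] [DecidableEq β] (S : n → Prop) [DecidablePred S]
    {w : β → ℝ} (hw : ∀ b, 0 ≤ w b) (hw1 : ∑ b, w b = 1) {A : β → Matrix n n ℂ}
    (hA : ∀ b, (A b).conjTranspose * A b = 1) (b₀ : β) {E E' : Matrix n n ℂ → Matrix n n ℂ}
    (hE : ∀ ρ, SupportedOn S ρ → E ρ = ∑ b, (w b : ℂ) • sandwich (A b) ρ)
    (hE' : ∀ ρ, SupportedOn S ρ → E' ρ = sandwich (A b₀) ρ)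
    {ψ : n → ℂ} (hψ : ∀ s, ψ s ≠ 0 → S s) {f : β → n} (hf : Function.Injective f)
    (hAψ : ∀ b, (A b).mulVec ψ = ket (f b)) :
    qDiamond (Matrix.diagonal fun s => if S s then 1 else 0) 1 E E' =
      ENNReal.ofReal (1 - w b₀) := by
  have hrest : ∑ b ∈ Finset.univ.erase b₀, w b = 1 - w b₀ := by
    rw [← hw1, ← Finset.add_sum_erase _ _ (Finset.mem_univ b₀)]; ring
  have h0 : 0 ≤ 1 - w b₀ := hrest ▸ Finset.sum_nonneg fun b _ => hw b
  have nn : ∀ b, (0 : ℂ) ≤ (w b : ℂ) := fun b => by exact_mod_cast hw b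
  -- the common part, of weight `w b₀`, cancels: a difference of two positive operators remains
  have key : ∀ k (ρ : Matrix (n × Fin k) (n × Fin k) ℂ),
      SupportedOn (fun x : n × Fin k => S x.1) ρ → tensorId E ρ - tensorId E' ρ =
        ∑ b ∈ Finset.univ.erase b₀,
            (w b : ℂ) • sandwich (A b ⊗ₖ (1 : Matrix (Fin k) (Fin k) ℂ)) ρ -
          ((1 - w b₀ : ℝ) : ℂ) • sandwich (A b₀ ⊗ₖ (1 : Matrix (Fin k) (Fin k) ℂ)) ρ := by
    intro k ρ hρ
    have e1 : tensorId E ρ =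
        ∑ b, (w b : ℂ) • sandwich (A b ⊗ₖ (1 : Matrix (Fin k) (Fin k) ℂ)) ρ := by
      ext x y
      have h := congrFun (congrFun (hE (Matrix.of fun i j => ρ (i, x.2) (j, y.2))
        fun s t h => hρ (s, x.2) (t, y.2) h) x.1) y.1
      simp only [Matrix.sum_apply, Matrix.smul_apply] at h
      simp only [← tensorId_sandwich, Matrix.sum_apply, Matrix.smul_apply]
      exact h
    have e2 : tensorId E' ρ = sandwich (A b₀ ⊗ₖ (1 : Matrix (Fin k) (Fin k) ℂ)) ρ := by
      ext x y
      rw [← tensorId_sandwich]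
      exact congrFun (congrFun (hE' (Matrix.of fun i j => ρ (i, x.2) (j, y.2))
        fun s t h => hρ (s, x.2) (t, y.2) h) x.1) y.1
    rw [e1, e2, ← Finset.add_sum_erase _ _ (Finset.mem_univ b₀)]
    push_cast
    module
  refine le_antisymm ?_ ?_
  · refine iSup_le fun k => iSup_le fun ρ => iSup_le fun ⟨hp, ht, hQ⟩ => ?_
    refine ENNReal.ofReal_le_ofReal ?_
    rw [traceDist, key k ρ (supportedOn_of_trace_ge_one S hp ht hQ)]
    have h1 : (∑ b ∈ Finset.univ.erase b₀,
        (w b : ℂ) • sandwich (A b ⊗ₖ (1 : Matrix (Fin k) (Fin k) ℂ)) ρ).PosSemidef :=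
      Matrix.posSemidef_sum _ fun b _ => (posSemidef_sandwich _ hp).smul (nn b)
    have h2 : (((1 - w b₀ : ℝ) : ℂ) •
        sandwich (A b₀ ⊗ₖ (1 : Matrix (Fin k) (Fin k) ℂ)) ρ).PosSemidef :=
      (posSemidef_sandwich _ hp).smul (by exact_mod_cast h0)
    have := traceNorm_sub_le h1 h2
    simp only [Matrix.trace_sum, Matrix.trace_smul,
      trace_sandwich_of_isometry (isometry_kronecker_one (hA _)), ht, smul_eq_mul, mul_one,
      Complex.re_sum, Complex.ofReal_re, hrest] at this
    linarith
  -- the value is attained at `|ψ⟩⟨ψ|` with a trivial ancilla, where the difference is diagonal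
  · set ρ : Matrix (n × Fin 1) (n × Fin 1) ℂ := outer ψ ψ ⊗ₖ 1 with hρ
    have hsup : SupportedOn (fun x : n × Fin 1 => S x.1) ρ := by
      rintro ⟨x, u⟩ ⟨y, v⟩ hxy
      rw [hρ, Matrix.kroneckerMap_apply, outer_apply] at hxy
      exact ⟨hψ _ fun h => hxy (by simp [h]), hψ _ fun h => hxy (by simp [h])⟩
    have htr : ρ.trace = 1 := by
      have h1 := trace_sandwich_of_isometry (hA b₀) (outer ψ ψ)
      rw [sandwich_outer, hAψ, outer_ket_ket, Matrix.trace_single_eq_same] at h1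
      rw [hρ, Matrix.trace_kronecker, ← h1, Matrix.trace_one]
      simp
    have hQ : ((Matrix.diagonal (fun s => if S s then (1 : ℂ) else 0) ⊗ₖ
        (1 : Matrix (Fin 1) (Fin 1) ℂ)) * ρ).trace = 1 := by
      refine Eq.trans ?_ htr
      rw [← Matrix.diagonal_one, Matrix.diagonal_kronecker_diagonal, Matrix.trace,
        Matrix.trace]
      refine Finset.sum_congr rfl fun x _ => ?_
      rw [Matrix.diag_apply, Matrix.diagonal_mul, Matrix.diag_apply]
      by_cases hx : S x.1
      · simp [hx]
      · rw [by_contra fun h => hx (hsup x x h).1, mul_zero]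
    refine le_trans ?_ (le_iSup_of_le 1 (le_iSup_of_le ρ (le_iSup_of_le
      ⟨(posSemidef_outer ψ).kronecker Matrix.PosSemidef.one, htr, by rw [hQ]; simp⟩ le_rfl)))
    refine ENNReal.ofReal_le_ofReal ?_
    have hs : ∀ b, sandwich (A b ⊗ₖ (1 : Matrix (Fin 1) (Fin 1) ℂ)) ρ =
        Matrix.diagonal fun x => if x.1 = f b then 1 else 0 := by
      intro b
      rw [← tensorId_sandwich, hρ, tensorId_kronecker (sandwich_smul _), sandwich_outer, hAψ,
        outer_ket_ket]
      ext ⟨x, u⟩ ⟨y, v⟩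
      simp only [Matrix.kroneckerMap_apply, Matrix.single_apply, Matrix.diagonal_apply,
        Subsingleton.elim u v, Prod.mk.injEq, Matrix.one_apply_eq, and_true, mul_one]
      by_cases h1 : x = f b <;> by_cases h2 : y = f b <;> simp [h1, h2, eq_comm]
    rw [traceDist, key 1 ρ hsup]
    simp only [hs]
    have hd : ∑ b ∈ Finset.univ.erase b₀, (w b : ℂ) •
          Matrix.diagonal (fun x : n × Fin 1 => if x.1 = f b then (1 : ℂ) else 0) -
        ((1 - w b₀ : ℝ) : ℂ) • Matrix.diagonal (fun x => if x.1 = f b₀ then (1 : ℂ) else 0) =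
        Matrix.diagonal (fun x => ∑ b ∈ Finset.univ.erase b₀,
            (w b : ℂ) * (if x.1 = f b then (1 : ℂ) else 0) -
          ((1 - w b₀ : ℝ) : ℂ) * (if x.1 = f b₀ then (1 : ℂ) else 0)) := by
      ext x y
      by_cases h : x = y
      · subst h; simp [Matrix.sum_apply]
      · simp [Matrix.sum_apply, h]
    rw [hd, traceNorm_diagonal]
    set d : n → ℂ := fun y => ∑ b ∈ Finset.univ.erase b₀,
        (w b : ℂ) * (if y = f b then (1 : ℂ) else 0) -
      ((1 - w b₀ : ℝ) : ℂ) * (if y = f b₀ then (1 : ℂ) else 0) with hd'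
    have hsum : ∑ b, ‖d (f b)‖ ≤ ∑ x : n × Fin 1, ‖d x.1‖ := by
      have h := Finset.sum_le_univ_sum_of_nonneg (s := Finset.univ.map
        ⟨fun b => (f b, (0 : Fin 1)), fun b b' h => hf (Prod.ext_iff.1 h).1⟩)
        (f := fun x : n × Fin 1 => ‖d x.1‖) fun x => norm_nonneg _
      rwa [Finset.sum_map] at h
    rw [← Finset.add_sum_erase _ _ (Finset.mem_univ b₀)] at hsum
    have hb0 : ‖d (f b₀)‖ = 1 - w b₀ := by
      simp only [hd', hf.eq_iff]
      rw [Finset.sum_eq_zero fun b hb => by rw [if_neg (Finset.ne_of_mem_erase hb).symm, mul_zero],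
        if_pos trivial, mul_one, zero_sub, norm_neg, Complex.norm_of_nonneg h0]
    have hb1 : ∀ b' ∈ Finset.univ.erase b₀, ‖d (f b')‖ = w b' := by
      intro b' hb'
      simp only [hd', hf.eq_iff, mul_ite, mul_one, mul_zero, Finset.sum_ite_eq, hb', if_true,
        if_neg (Finset.ne_of_mem_erase hb'), sub_zero, Complex.norm_of_nonneg (hw b')]
    rw [hb0, Finset.sum_congr rfl hb1, hrest] at hsum
    simp only [hd'] at hsum
    linarith

/-- The trivial precondition holds with certainty. -/
theorem diamond_eq_qDiamond (E E' : Matrix n n ℂ → Matrix n n ℂ) :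
    diamond E E' =
      qDiamond (Matrix.diagonal fun s => if (fun _ : n => True) s then 1 else 0) 1 E E' := by
  simp only [diamond, qDiamond, if_true]
  refine iSup_congr fun k => iSup_congr fun ρ => iSup_congr_Prop ?_ fun _ => rfl
  have : (Matrix.diagonal fun _ : n => (1 : ℂ)) = 1 := Matrix.diagonal_one
  simp only [this, Matrix.one_kronecker_one, Matrix.one_mul]
  constructor
  · rintro ⟨h1, h2, -⟩; exact ⟨h1, h2, by simp [h2]⟩
  · rintro ⟨h1, h2, -⟩; exact ⟨h1, h2, by simp [h2]⟩

end Ancilla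

/-! ### Operators on registers -/

theorem mulVec_ket {m n : Type} [Fintype n] [DecidableEq n] (A : Matrix m n ℂ) (t : n) :
    A.mulVec (ket t) = fun s => A s t := by
  rw [ket, Matrix.mulVec_single_one]; rfl

/-- A matrix is determined by its action on the basis vectors. -/
theorem ext_mulVec_ket {m n : Type} [Fintype n] [DecidableEq n] {A B : Matrix m n ℂ}
    (h : ∀ t, A.mulVec (ket t) = B.mulVec (ket t)) : A = B := by
  ext s t
  have := congrFun (h t) s
  rwa [mulVec_ket, mulVec_ket] at this

theorem extend_of_ne {ι Var : Type} (r : ι ↪ Var) {x : ι → Fin 2} {t : Var → Fin 2} {v : Var}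
    (h : ∀ i, r i ≠ v) :
    Function.extend r x t v = t v :=
  Function.extend_apply' _ _ _ fun ⟨i, hi⟩ => h i hi

theorem extend_comp_self {ι Var : Type} (r : ι ↪ Var) (x : ι → Fin 2) (t : Var → Fin 2) :
    Function.extend r x t ∘ r = x :=
  Function.extend_comp r.injective x t

theorem eq_extend_of_agree {ι Var : Type} (r : ι ↪ Var) {s t : Var → Fin 2}
    (h : ∀ v, (∀ i, r i ≠ v) → s v = t v) :
    s = Function.extend r (s ∘ r) t := by
  funext v
  by_cases hv : ∃ i, r i = v
  · obtain ⟨i, rfl⟩ := hv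
    rw [r.injective.extend_apply]; rfl
  · rw [Function.extend_apply' _ _ _ hv]
    exact h v fun i hi => hv ⟨i, hi⟩

section Embed

variable {ι Var : Type} [Fintype ι] [Fintype Var] [DecidableEq Var] (r : ι ↪ Var)

theorem embed_apply_of_agree (A : Op ι) {s t : Var → Fin 2}
    (h : ∀ v, (∀ i, r i ≠ v) → s v = t v) : embed r A s t = A (s ∘ r) (t ∘ r) := if_pos h

theorem embed_one [DecidableEq ι] : embed r (1 : Op ι) = 1 := by
  ext s t
  by_cases h : ∀ v, (∀ i, r i ≠ v) → s v = t v
  · rw [embed_apply_of_agree r _ h, Matrix.one_apply, Matrix.one_apply]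
    refine if_congr ⟨fun e => ?_, fun e => by rw [e]⟩ rfl rfl
    rw [eq_extend_of_agree r h, e]
    exact (eq_extend_of_agree r fun _ _ => rfl).symm
  · rw [Matrix.one_apply_ne fun e => h fun v _ => by rw [e]]
    exact if_neg h

theorem embed_conjTranspose (A : Op ι) :
    (embed r A).conjTranspose = embed r A.conjTranspose := by
  ext s t
  simp only [embed, Matrix.conjTranspose_apply, Matrix.of_apply, apply_ite star, star_zero]
  exact if_congr (forall_congr' fun v => imp_congr_right fun _ => eq_comm) rfl rfl

theorem embed_smul (z : ℂ) (A : Op ι) : embed r (z • A) = z • embed r A := by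
  ext s t
  simp only [embed, Matrix.smul_apply, Matrix.of_apply, smul_ite, smul_zero]

theorem embed_sum {β : Type} (s : Finset β) (A : β → Op ι) :
    embed r (∑ b ∈ s, A b) = ∑ b ∈ s, embed r (A b) := by
  ext x y
  simp only [embed, Matrix.sum_apply, Matrix.of_apply]
  split_ifs
  · rfl
  · simp

variable [DecidableEq ι]

theorem embed_mul (A B : Op ι) : embed r (A * B) = embed r A * embed r B := by
  ext s t
  have key : ∑ u, embed r A s u * embed r B u t =
      ∑ x, A (s ∘ r) x * embed r B (Function.extend r x s) t := by
    refine (Fintype.sum_of_injective (fun x => Function.extend r x s)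
      (Function.extend_injective r.injective s) _ _ (fun u hu => ?_) fun x => ?_).symm
    · rw [show embed r A s u = 0 from if_neg fun h => hu ⟨u ∘ r, ?_⟩, zero_mul]
      exact (eq_extend_of_agree r fun v hv => (h v hv).symm).symm
    · rw [embed_apply_of_agree r A fun v hv => (extend_of_ne r hv).symm, extend_comp_self]
  rw [Matrix.mul_apply, key]
  by_cases h : ∀ v, (∀ i, r i ≠ v) → s v = t v
  · rw [embed_apply_of_agree r _ h, Matrix.mul_apply]
    refine Finset.sum_congr rfl fun x _ => ?_
    rw [embed_apply_of_agree r B fun v hv => (extend_of_ne r hv).trans (h v hv), extend_comp_self]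
  · rw [show embed r (A * B) s t = 0 from if_neg h]
    refine (Finset.sum_eq_zero fun x _ => ?_).symm
    rw [show embed r B (Function.extend r x s) t = 0 from if_neg fun h' => h fun v hv =>
      (extend_of_ne r hv).symm.trans (h' v hv), mul_zero]

theorem embed_mulVec_ket (A : Op ι) (t : Var → Fin 2) :
    (embed r A).mulVec (ket t) = ∑ x, A x (t ∘ r) • ket (Function.extend r x t) := by
  rw [mulVec_ket]
  funext s
  simp only [Finset.sum_apply, Pi.smul_apply, ket, Pi.single_apply, smul_eq_mul, mul_ite, mul_one,
    mul_zero]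
  by_cases h : ∀ v, (∀ i, r i ≠ v) → s v = t v
  · rw [embed_apply_of_agree r A h, Finset.sum_eq_single (s ∘ r),
      if_pos (eq_extend_of_agree r h)]
    · intro x _ hx
      rw [if_neg]
      rintro rfl
      exact hx (extend_comp_self r x t).symm
    · simp
  · rw [Finset.sum_eq_zero fun x _ => if_neg fun e => h fun v hv => ?_]
    · exact if_neg h
    · rw [e, extend_of_ne r hv]

theorem embed_isometry {A : Op ι} (h : A.conjTranspose * A = 1) :
    (embed r A).conjTranspose * embed r A = 1 := by
  rw [embed_conjTranspose, ← embed_mul, h, embed_one]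

end Embed

theorem unitary_isometry {n : Type} [Fintype n] [DecidableEq n] (U : Matrix.unitaryGroup n ℂ) :
    U.1.conjTranspose * U.1 = 1 := Matrix.mem_unitaryGroup_iff'.1 U.2

theorem extend_single {Var : Type} [DecidableEq Var] (q : Var) (z : Fin 1 → Fin 2)
    (t : Var → Fin 2) :
    Function.extend (single q) z t = Function.update t q (z 0) := by
  funext v
  by_cases hv : v = q
  · subst hv
    rw [Function.update_self]
    exact (single v).injective.extend_apply z t 0
  · rw [Function.update_of_ne hv]
    exact extend_of_ne (single q) fun _ h => hv h.symm

section Single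

variable {Var : Type} [Fintype Var] [DecidableEq Var]

theorem embed_single_mulVec_ket (q : Var) (A : Matrix (Fin 2) (Fin 2) ℂ) (t : Var → Fin 2) :
    (embed (single q) (tens fun _ => A)).mulVec (ket t) =
      ∑ a, A a (t q) • ket (Function.update t q a) := by
  rw [embed_mulVec_ket, ← (Equiv.funUnique (Fin 1) (Fin 2)).symm.sum_comp]
  refine Finset.sum_congr rfl fun a _ => ?_
  rw [extend_single]
  simp only [tens, Matrix.of_apply, Fintype.prod_unique]
  rfl

theorem embed_single_outer_mulVec_ket (q : Var) (a b : Fin 2) (t : Var → Fin 2) :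
    (embed (single q) (tens fun _ => outer (ket a) (ket b))).mulVec (ket t) =
      if t q = b then ket (Function.update t q a) else 0 := by
  rw [embed_single_mulVec_ket]
  simp only [outer_ket_ket, Matrix.single_apply, Fin.sum_univ_two]
  by_cases h : t q = b
  · fin_cases a <;> simp [h]
  · simp [h, Ne.symm h]

end Single

/-! ### Bit flips -/

section Flip

variable {ι : Type} [Fintype ι]

/-- The flip pattern `e`: a Pauli `X` on every qubit `j` with `e j = 1`. -/
def flipOp (e : ι → Fin 2) : Matrix (ι → Fin 2) (ι → Fin 2) ℂ :=
  tens fun j => if e j = 1 then pauliX else 1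

/-- The probability of the flip pattern `e` under independent flips with probability `q`. -/
def flipWeight (q : ℝ) (e : ι → Fin 2) : ℝ := ∏ j, if e j = 1 then q else 1 - q

theorem flipWeight_nonneg {q : ℝ} (h0 : 0 ≤ q) (h1 : q ≤ 1) (e : ι → Fin 2) :
    0 ≤ flipWeight q e :=
  Finset.prod_nonneg fun j _ => by split_ifs <;> linarith

theorem flipWeight_zero (q : ℝ) : flipWeight q (0 : ι → Fin 2) = (1 - q) ^ Fintype.card ι := by
  simp [flipWeight]

theorem flipWeight_zero_left (e : ι → Fin 2) : flipWeight 0 e = if e = 0 then 1 else 0 := by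
  split_ifs with h
  · subst h; simp [flipWeight]
  · obtain ⟨j, hj⟩ := Function.ne_iff.1 h
    exact Finset.prod_eq_zero (Finset.mem_univ j) (if_pos (Fin.eq_one_of_ne_zero _ hj))

theorem flipOp_apply (e s t : ι → Fin 2) : flipOp e s t = if s = t + e then 1 else 0 := by
  have : ∀ a b c : Fin 2, (if c = 1 then pauliX else 1) a b = if a = b + c then (1 : ℂ) else 0 := by
    intro a b c
    fin_cases a <;> fin_cases b <;> fin_cases c <;> simp [pauliX]
  simp only [flipOp, tens, Matrix.of_apply, this, Finset.prod_ite_zero, funext_iff, Pi.add_apply]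
  simp

variable [DecidableEq ι]

theorem sum_flipWeight (q : ℝ) : ∑ e : ι → Fin 2, flipWeight q e = 1 := by
  simp only [flipWeight]
  rw [← Fintype.piFinset_univ, ← Finset.prod_univ_sum (fun _ => Finset.univ)
    (fun (_ : ι) (b : Fin 2) => if b = 1 then q else 1 - q)]
  simp

theorem flipOp_mulVec_ket (e t : ι → Fin 2) : (flipOp e).mulVec (ket t) = ket (t + e) := by
  rw [mulVec_ket]
  funext s
  rw [flipOp_apply, ket, Pi.single_apply]

theorem flipOp_zero : flipOp (0 : ι → Fin 2) = 1 := by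
  simp [flipOp, tens_one]

theorem flipOp_isometry (e : ι → Fin 2) : (flipOp e).conjTranspose * flipOp e = 1 :=
  Matrix.mem_unitaryGroup_iff'.1 (tens_mem_unitaryGroup fun j => by
    split_ifs <;> simp [pauliX_conjTranspose, pauliX_mul_self])

theorem embed_flipOp {Var : Type} [Fintype Var] [DecidableEq Var] (r : ι ↪ Var) (e : ι → Fin 2) :
    embed r (flipOp e) = flipOp (Function.extend r e 0) :=
  ext_mulVec_ket fun t => by
    rw [embed_mulVec_ket, flipOp_mulVec_ket, Finset.sum_eq_single (t ∘ r + e)]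
    · rw [flipOp_apply, if_pos rfl, one_smul]
      congr 1
      funext v
      by_cases hv : ∃ i, r i = v
      · obtain ⟨i, rfl⟩ := hv
        rw [Pi.add_apply, r.injective.extend_apply, r.injective.extend_apply]
        rfl
      · rw [Pi.add_apply, Function.extend_apply' _ _ _ hv, Function.extend_apply' _ _ _ hv]
        simp
    · intro x _ hx
      rw [flipOp_apply, if_neg hx, zero_smul]
    · simp

theorem bitFlip_kraus (p : unitInterval) (i : Fin 2) :
    (bitFlip p).kraus i = (if i = 1 then (√(p : ℝ) : ℂ) else (√(1 - (p : ℝ)) : ℂ)) •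
      (if i = 1 then pauliX else 1) := by
  fin_cases i <;> simp [bitFlip]

theorem tensorPow_bitFlip_kraus (p : unitInterval) (e : ι → Fin 2) :
    ∃ z : ℂ, z * star z = (flipWeight p e : ℂ) ∧
      ((bitFlip p).tensorPow ι).kraus e = z • flipOp e := by
  refine ⟨∏ j, if e j = 1 then (√(p : ℝ) : ℂ) else (√(1 - (p : ℝ)) : ℂ), ?_, ?_⟩
  · rw [star_prod, ← Finset.prod_mul_distrib, flipWeight, Complex.ofReal_prod]
    refine Finset.prod_congr rfl fun j _ => ?_
    split_ifs
    · rw [Complex.star_def, Complex.conj_ofReal, ← Complex.ofReal_mul, Real.mul_self_sqrt p.2.1]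
    · rw [Complex.star_def, Complex.conj_ofReal, ← Complex.ofReal_mul,
        Real.mul_self_sqrt (sub_nonneg.2 p.2.2)]
  · ext s t
    simp only [Superop.tensorPow, tens, flipOp, Matrix.smul_apply, Matrix.of_apply, smul_eq_mul,
      ← Finset.prod_mul_distrib]
    exact Finset.prod_congr rfl fun j _ => by rw [bitFlip_kraus]; rfl

theorem tensorPow_bitFlip_apply (p : unitInterval) (ρ : Op ι) :
    ((bitFlip p).tensorPow ι).apply ρ =
      ∑ e : ι → Fin 2, (flipWeight p e : ℂ) • sandwich (flipOp e) ρ := by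
  refine Finset.sum_congr rfl fun e _ => ?_
  obtain ⟨z, hz, h⟩ := tensorPow_bitFlip_kraus p e
  rw [h, smul_sandwich, hz]

end Flip

/-! ### Channels -/

/-- A completely positive and trace-preserving map, in Kraus form. -/
def IsChannel {n : Type} [Fintype n] [DecidableEq n] (E : Matrix n n ℂ → Matrix n n ℂ) : Prop :=
  ∃ (κ : Type) (_ : Fintype κ) (K : κ → Matrix n n ℂ),
    ∑ k, (K k).conjTranspose * K k = 1 ∧ ∀ ρ, E ρ = ∑ k, sandwich (K k) ρ

namespace IsChannel

variable {n : Type} [Fintype n] [DecidableEq n] {E F : Matrix n n ℂ → Matrix n n ℂ}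

theorem comp (hF : IsChannel F) (hE : IsChannel E) : IsChannel fun ρ => F (E ρ) := by
  obtain ⟨κ, _, K, hK, hE⟩ := hE
  obtain ⟨μ, _, L, hL, hF⟩ := hF
  refine ⟨κ × μ, inferInstance, fun x => L x.2 * K x.1, ?_, fun ρ => ?_⟩
  · rw [Fintype.sum_prod_type, ← hK]
    refine Finset.sum_congr rfl fun k _ => ?_
    rw [← Matrix.mul_one (K k).conjTranspose, ← hL, Matrix.mul_sum, Matrix.sum_mul]
    refine Finset.sum_congr rfl fun m _ => ?_
    rw [Matrix.conjTranspose_mul]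
    simp only [Matrix.mul_assoc]
  · change F (E ρ) = _
    rw [hF, hE, Fintype.sum_prod_type_right]
    refine Finset.sum_congr rfl fun m _ => ?_
    simp only [sandwich_mul, sandwich_sum]

theorem sandwich {A : Matrix n n ℂ} (h : A.conjTranspose * A = 1) :
    IsChannel (QWhile.sandwich A) :=
  ⟨Unit, inferInstance, fun _ => A, by simpa using h, fun ρ => by simp⟩

theorem map_smul (hE : IsChannel E) (z : ℂ) (ρ : Matrix n n ℂ) : E (z • ρ) = z • E ρ := by
  obtain ⟨κ, _, K, -, hE⟩ := hE
  simp only [hE, sandwich_smul, Finset.smul_sum]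

theorem map_sum (hE : IsChannel E) {β : Type} (s : Finset β) (f : β → Matrix n n ℂ) :
    E (∑ b ∈ s, f b) = ∑ b ∈ s, E (f b) := by
  obtain ⟨κ, _, K, -, hE⟩ := hE
  simp only [hE, sandwich_sum]
  exact Finset.sum_comm

theorem trace_apply (hE : IsChannel E) (ρ : Matrix n n ℂ) : (E ρ).trace = ρ.trace := by
  obtain ⟨κ, _, K, hK, hE⟩ := hE
  simp only [hE, Matrix.trace_sum, trace_sandwich]
  rw [← Matrix.trace_sum, ← Finset.sum_mul, hK, Matrix.one_mul]

theorem posSemidef (hE : IsChannel E) {ρ : Matrix n n ℂ} (h : ρ.PosSemidef) :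
    (E ρ).PosSemidef := by
  obtain ⟨κ, _, K, -, hE⟩ := hE
  rw [hE]
  exact Matrix.posSemidef_sum _ fun k _ => posSemidef_sandwich _ h

theorem map_eq_sum_ket (hE : IsChannel E) (ρ : Matrix n n ℂ) :
    E ρ = ∑ s, ∑ t, ρ s t • E (outer (ket s) (ket t)) := by
  conv_lhs => rw [eq_sum_outer_ket ρ]
  simp only [hE.map_sum, hE.map_smul]

/-- A channel is determined on a supported operator by its action on the basis there. -/
theorem eq_of_ket (hE : IsChannel E) (hF : IsChannel F) {S : n → Prop} {ρ : Matrix n n ℂ}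
    (hρ : SupportedOn S ρ)
    (h : ∀ s t, S s → S t → E (outer (ket s) (ket t)) = F (outer (ket s) (ket t))) :
    E ρ = F ρ := by
  rw [hE.map_eq_sum_ket, hF.map_eq_sum_ket]
  refine Finset.sum_congr rfl fun s _ => Finset.sum_congr rfl fun t _ => ?_
  by_cases h0 : ρ s t = 0
  · simp [h0]
  · rw [h s t (hρ s t h0).1 (hρ s t h0).2]

/-- Isometries applied with given probabilities. -/
theorem mixture {β : Type} [Fintype β] {w : β → ℝ} (hw : ∀ b, 0 ≤ w b) (hw1 : ∑ b, w b = 1)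
    {A : β → Matrix n n ℂ} (hA : ∀ b, (A b).conjTranspose * A b = 1) :
    IsChannel fun ρ => ∑ b, (w b : ℂ) • QWhile.sandwich (A b) ρ := by
  have h2 : ∀ b, (√(w b) : ℂ) * star (√(w b) : ℂ) = (w b : ℂ) := fun b => by
    rw [Complex.star_def, Complex.conj_ofReal, ← Complex.ofReal_mul, Real.mul_self_sqrt (hw b)]
  refine ⟨β, inferInstance, fun b => (√(w b) : ℂ) • A b, ?_, fun ρ => ?_⟩
  · simp only [Matrix.conjTranspose_smul, Matrix.smul_mul, Matrix.mul_smul, smul_smul, hA]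
    simp only [h2, ← Finset.sum_smul]
    rw [← Complex.ofReal_sum, hw1, Complex.ofReal_one, one_smul]
  · simp only [smul_sandwich, h2]

end IsChannel

section Programs

variable {Var : Type} [Fintype Var] [DecidableEq Var]

theorem isChannel_init (q : Var) : IsChannel (Prog.init q).denote := by
  refine ⟨Fin 2, inferInstance, fun b => embed (single q) (tens fun _ => outer (ket 0) (ket b)),
    ?_, fun ρ => rfl⟩
  have h : ∀ b : Fin 2, (outer (ket (0 : Fin 2)) (ket b)).conjTranspose * outer (ket 0) (ket b) =
      (outer (ket b) (ket b)).conjTranspose * outer (ket b) (ket b) := by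
    intro b
    simp [outer_ket_ket, Matrix.conjTranspose_single]
  rw [← embed_one (single q), ← stdMeas.complete, embed_sum]
  refine Finset.sum_congr rfl fun b _ => ?_
  rw [embed_conjTranspose, ← embed_mul]
  congr 1
  simp only [stdMeas, tens_conjTranspose, tens_mul, h]

theorem isChannel_unitary {ι : Type} [Fintype ι] [DecidableEq ι] (r : ι ↪ Var)
    (U : Matrix.unitaryGroup (ι → Fin 2) ℂ) : IsChannel (Prog.unitary r U).denote :=
  IsChannel.sandwich (embed_isometry r (unitary_isometry U))

theorem IsChannel.seq {P₁ P₂ : Prog Var} (h₁ : IsChannel P₁.denote) (h₂ : IsChannel P₂.denote) :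
    IsChannel (P₁ ;; P₂).denote := h₂.comp h₁

theorem denote_init_outer_ket (q : Var) (s t : Var → Fin 2) :
    (Prog.init q).denote (outer (ket s) (ket t)) =
      if s q = t q then outer (ket (Function.update s q 0)) (ket (Function.update t q 0))
      else 0 := by
  have h0 : ∀ v : (Var → Fin 2) → ℂ, outer (0 : (Var → Fin 2) → ℂ) v = 0 ∧ outer v 0 = 0 := fun v =>
    ⟨by ext; simp [outer_apply], by ext; simp [outer_apply]⟩
  change ∑ b : Fin 2, _ = _
  simp only [sandwich_outer, embed_single_outer_mulVec_ket, Fin.sum_univ_two]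
  generalize s q = a
  generalize t q = b
  fin_cases a <;> fin_cases b <;> simp [h0]

theorem denote_unitary_outer_ket {ι : Type} [Fintype ι] [DecidableEq ι] (r : ι ↪ Var)
    (f : (ι → Fin 2) → (ι → Fin 2)) (hf : Function.Involutive f) (s t : Var → Fin 2) :
    (Prog.unitary r (permGate f hf)).denote (outer (ket s) (ket t)) =
      outer (ket (Function.extend r (f (s ∘ r)) s)) (ket (Function.extend r (f (t ∘ r)) t)) := by
  have h : ∀ s : Var → Fin 2, (embed r (permGate f hf).1).mulVec (ket s) =
      ket (Function.extend r (f (s ∘ r)) s) := by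
    intro s
    rw [embed_mulVec_ket, Finset.sum_eq_single (f (s ∘ r))]
    · simp [permGate]
    · intro x _ hx
      simp [permGate, hx]
    · simp
  change sandwich _ _ = _
  rw [sandwich_outer, h, h]

theorem denote_flipNoisy {ι : Type} [Fintype ι] [DecidableEq ι] (p : unitInterval) (r : ι ↪ Var)
    (U : Matrix.unitaryGroup (ι → Fin 2) ℂ) (ρ : Op Var) :
    (flipNoisy p r U).denote ρ =
      ∑ e : ι → Fin 2, (flipWeight p e : ℂ) • sandwich (embed r (flipOp e * U.1)) ρ := by
  change (1 - ((1 : ℝ) : ℂ)) • _ + ((1 : ℝ) : ℂ) • ∑ e : ι → Fin 2,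
    sandwich (embed r (((bitFlip p).tensorPow ι).kraus e * U.1)) ρ = _
  rw [Complex.ofReal_one, sub_self, zero_smul, zero_add, one_smul]
  refine Finset.sum_congr rfl fun e _ => ?_
  obtain ⟨z, hz, h⟩ := tensorPow_bitFlip_kraus p e
  rw [h, Matrix.smul_mul, embed_smul, smul_sandwich, hz]

theorem isChannel_flipNoisy {ι : Type} [Fintype ι] [DecidableEq ι] (p : unitInterval)
    (r : ι ↪ Var) (U : Matrix.unitaryGroup (ι → Fin 2) ℂ) :
    IsChannel (flipNoisy p r U).denote := by
  have := IsChannel.mixture (w := flipWeight (p : ℝ)) (flipWeight_nonneg p.2.1 p.2.2)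
    (sum_flipWeight (ι := ι) p) (A := fun e => embed r (flipOp e * U.1)) fun e =>
      embed_isometry r (by rw [Matrix.conjTranspose_mul, Matrix.mul_assoc,
        ← Matrix.mul_assoc (flipOp e).conjTranspose, flipOp_isometry, Matrix.one_mul,
        unitary_isometry])
  convert this using 1
  funext ρ
  exact denote_flipNoisy p r U ρ

/-- Without flips, the noisy gate is the noiseless one. -/
theorem denote_flipNoisy_zero {ι : Type} [Fintype ι] [DecidableEq ι] (r : ι ↪ Var)
    (U : Matrix.unitaryGroup (ι → Fin 2) ℂ) :
    (flipNoisy 0 r U).denote = (Prog.unitary r U).denote := by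
  funext ρ
  rw [denote_flipNoisy, Finset.sum_eq_single 0]
  · change ((flipWeight (0 : ℝ) _ : ℝ) : ℂ) • _ = sandwich _ _
    rw [flipWeight_zero_left, if_pos rfl, flipOp_zero, Matrix.one_mul, Complex.ofReal_one, one_smul]
  · intro e _ he
    change ((flipWeight (0 : ℝ) _ : ℝ) : ℂ) • _ = _
    rw [flipWeight_zero_left, if_neg he, Complex.ofReal_zero, zero_smul]
  · simp

/-- The noisy gate runs without any flip with probability `(1 - p) ^ n`. -/
theorem posSemidef_flipNoisy_sub {ι : Type} [Fintype ι] [DecidableEq ι] (p : unitInterval)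
    (r : ι ↪ Var) (U : Matrix.unitaryGroup (ι → Fin 2) ℂ) {w : ℝ} {ρ ρ' : Op Var}
    (hρ : ρ.PosSemidef) (h : (ρ - (w : ℂ) • ρ').PosSemidef) :
    ((flipNoisy p r U).denote ρ - ((w * (1 - p) ^ Fintype.card ι : ℝ) : ℂ) •
      (flipNoisy 0 r U).denote ρ').PosSemidef := by
  have e : (flipNoisy p r U).denote ρ - ((w * (1 - p) ^ Fintype.card ι : ℝ) : ℂ) •
      (flipNoisy 0 r U).denote ρ' =
      (((1 - p) ^ Fintype.card ι : ℝ) : ℂ) • sandwich (embed r U.1) (ρ - (w : ℂ) • ρ') +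
      ∑ e ∈ Finset.univ.erase 0, (flipWeight p e : ℂ) • sandwich (embed r (flipOp e * U.1)) ρ := by
    have hsub : sandwich (embed r U.1) (ρ - (w : ℂ) • ρ') =
        sandwich (embed r U.1) ρ - (w : ℂ) • sandwich (embed r U.1) ρ' := by
      rw [sub_eq_add_neg, ← neg_one_smul ℂ, sandwich_add, sandwich_smul, sandwich_smul]
      module
    rw [denote_flipNoisy_zero, denote_flipNoisy, ← Finset.add_sum_erase _ _ (Finset.mem_univ 0),
      flipWeight_zero, flipOp_zero, Matrix.one_mul, hsub]
    change _ - _ • sandwich _ _ = _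
    push_cast
    module
  rw [e]
  have hp : (0 : ℝ) ≤ (1 - p) ^ Fintype.card ι := pow_nonneg (sub_nonneg.2 p.2.2) _
  refine ((posSemidef_sandwich _ h).smul (by exact_mod_cast hp)).add
    (Matrix.posSemidef_sum _ fun e _ => (posSemidef_sandwich _ hρ).smul ?_)
  exact_mod_cast flipWeight_nonneg p.2.1 p.2.2 e

end Programs

/-! ### Loops with a resetting body -/

theorem PosSemidef.trace_eq_ofReal {n : Type} [Fintype n] {A : Matrix n n ℂ}
    (h : A.PosSemidef) : A.trace = (A.trace.re : ℂ) ∧ 0 ≤ A.trace.re := by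
  have := Complex.le_def.1 h.trace_nonneg
  exact ⟨Complex.ext rfl (by simpa using this.2.symm), this.1⟩

section Distance

variable {n : Type} [Fintype n] [DecidableEq n]

/-- The distance of two channels that replace every state by a fixed one. -/
theorem qDiamond_replace_le {E E' : Matrix n n ℂ → Matrix n n ℂ} {τ τ' P N : Matrix n n ℂ}
    (hE : ∀ ρ, E ρ = ρ.trace • τ) (hE' : ∀ ρ, E' ρ = ρ.trace • τ') (hP : P.PosSemidef)
    (hN : N.PosSemidef) (h : τ - τ' = P - N) {ε : ℝ}
    (hε : P.trace.re + N.trace.re ≤ 2 * ε) : qDiamond 1 0 E E' ≤ ENNReal.ofReal ε := by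
  refine iSup_le fun k => iSup_le fun ρ => iSup_le fun ⟨hp, ht, _⟩ =>
    ENNReal.ofReal_le_ofReal ?_
  -- the reduced state of the ancilla
  set A : Matrix (Fin k) (Fin k) ℂ := ∑ s, ρ.submatrix (fun u => (s, u)) (fun u => (s, u)) with hA
  have hAp : A.PosSemidef := Matrix.posSemidef_sum _ fun s _ => hp.submatrix _
  have hAt : A.trace = 1 := by
    rw [← ht, hA, Matrix.trace_sum, Matrix.trace, Fintype.sum_prod_type]
    rfl
  have e : ∀ {F : Matrix n n ℂ → Matrix n n ℂ} {σ : Matrix n n ℂ}, (∀ ρ, F ρ = ρ.trace • σ) →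
      tensorId F ρ = σ ⊗ₖ A := by
    intro F σ hF
    ext ⟨x, u⟩ ⟨y, v⟩
    change F _ x y = _
    rw [hF, Matrix.smul_apply, Matrix.kroneckerMap_apply, smul_eq_mul, mul_comm, hA,
      Matrix.sum_apply]
    rfl
  have d : tensorId E ρ - tensorId E' ρ = P ⊗ₖ A - N ⊗ₖ A := by
    have hs : ∀ B C : Matrix n n ℂ, B ⊗ₖ A - C ⊗ₖ A = (B - C) ⊗ₖ A := fun B C => by
      ext x y
      simp [Matrix.kroneckerMap_apply, sub_mul]
    rw [e hE, e hE', hs, hs, h]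
  have := traceNorm_sub_le (hP.kronecker hAp) (hN.kronecker hAp)
  rw [Matrix.trace_kronecker, Matrix.trace_kronecker, hAt, mul_one, mul_one] at this
  rw [traceDist, d]
  linarith

/-- The distance of two states after conditioning on an event of probability `1 / 2` in the second
one, if the first one contains the second one with weight `w`. -/
theorem qDiamond_conditioned_le {E E' : Matrix n n ℂ → Matrix n n ℂ} {M₀ M₁ σ σ' : Matrix n n ℂ}
    (hM : M₀.conjTranspose * M₀ + M₁.conjTranspose * M₁ = 1)
    (hE : ∀ ρ, E ρ = ρ.trace • (sandwich M₀ σ).trace⁻¹ • sandwich M₀ σ)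
    (hE' : ∀ ρ, E' ρ = ρ.trace • (sandwich M₀ σ').trace⁻¹ • sandwich M₀ σ')
    (hσ1 : σ.trace = 1) (hσ' : σ'.PosSemidef) (hσ'1 : σ'.trace = 1)
    (hhalf : (sandwich M₀ σ').trace = 1 / 2) {w : ℝ} (hw : 0 ≤ w)
    (h : (σ - (w : ℂ) • σ').PosSemidef) :
    qDiamond 1 0 E E' ≤ ENNReal.ofReal (2 * (1 - w)) := by
  set κ := σ - (w : ℂ) • σ' with hκ
  have hK := posSemidef_sandwich M₀ h
  have hK1 := posSemidef_sandwich M₁ h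
  have hsplit : sandwich M₀ σ = (w : ℂ) • sandwich M₀ σ' + sandwich M₀ κ := by
    rw [← sandwich_smul, ← sandwich_add, hκ, add_sub_cancel]
  obtain ⟨ka, k0⟩ := PosSemidef.trace_eq_ofReal hK
  obtain ⟨kb, k1⟩ := PosSemidef.trace_eq_ofReal hK1
  set k := (sandwich M₀ κ).trace.re
  have hk : k ≤ 1 - w := by
    have : (sandwich M₀ κ).trace + (sandwich M₁ κ).trace = 1 - w := by
      rw [trace_sandwich, trace_sandwich, ← Matrix.trace_add, ← Matrix.add_mul, hM, Matrix.one_mul,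
        hκ, Matrix.trace_sub, Matrix.trace_smul, hσ1, hσ'1, smul_eq_mul, mul_one]
    have := congrArg Complex.re this
    simp only [Complex.add_re, Complex.sub_re, Complex.one_re, Complex.ofReal_re] at this
    linarith
  have htr : (sandwich M₀ σ).trace = ((w / 2 + k : ℝ) : ℂ) := by
    rw [hsplit, Matrix.trace_add, Matrix.trace_smul, hhalf, ka, smul_eq_mul]
    push_cast; ring
  have hA' := posSemidef_sandwich M₀ hσ'
  have hnn : 0 ≤ w / 2 + k := by linarith
  -- if the first state has no weight on the event, then `E = 0` and `w = 0`
  rcases hnn.eq_or_lt with h0 | h0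
  · have hw0 : w = 0 := by linarith
    refine qDiamond_replace_le hE hE' Matrix.PosSemidef.zero
      (hA'.smul (a := (2 : ℂ)) (by norm_num)) ?_ ?_
    · rw [htr, ← h0, hhalf]
      simp
    · rw [Matrix.trace_smul, hhalf, hw0]
      norm_num
  -- otherwise `a⁻¹ (w A' + K) - 2 A' = a⁻¹ K - (2 - w / a) A'`, where `A'` and `K` are the images of
  -- the second state and of the rest of the first one
  · set a := w / 2 + k with ha
    have hc : (a : ℂ) ≠ 0 := by exact_mod_cast h0.ne'
    have hwa : 0 ≤ 2 - w / a := by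
      rw [sub_nonneg, div_le_iff₀ h0]; linarith
    refine qDiamond_replace_le hE hE' (hK.smul (a := ((a⁻¹ : ℝ) : ℂ))
      (by exact_mod_cast inv_nonneg.2 h0.le))
      (hA'.smul (a := ((2 - w / a : ℝ) : ℂ)) (by exact_mod_cast hwa)) ?_ ?_
    · rw [htr, hsplit, hhalf]
      push_cast
      rw [smul_add, smul_smul, div_eq_inv_mul]
      module
    · rw [Matrix.trace_smul, Matrix.trace_smul, hhalf, ka, smul_eq_mul, smul_eq_mul,
        ← Complex.ofReal_mul, Complex.ofReal_re, mul_one_div, ← Complex.ofReal_ofNat,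
        ← Complex.ofReal_div, Complex.ofReal_re]
      -- with `a = w / 2 + k` the sum of the traces is `2 - w / a`, and `a ≤ 1 - w / 2`
      have hk' : k = a - w / 2 := by rw [ha]; ring
      have hle : a ≤ 1 - w / 2 := by linarith
      have e : a⁻¹ * k + (2 - w / a) / 2 = 2 - w / a := by
        rw [hk']; field_simp; ring
      rw [e, sub_le_comm, le_div_iff₀ h0]
      nlinarith

end Distance

variable {Var : Type} [Fintype Var] [DecidableEq Var]

theorem embed_measurement_complete {ι : Type} [Fintype ι] [DecidableEq ι] (r : ι ↪ Var)
    (M : Measurement (ι → Fin 2) (Fin 2)) :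
    (embed r (M.op 0)).conjTranspose * embed r (M.op 0) +
      (embed r (M.op 1)).conjTranspose * embed r (M.op 1) = 1 := by
  rw [← Fin.sum_univ_two fun m => (embed r (M.op m)).conjTranspose * embed r (M.op m)]
  simp only [embed_conjTranspose, ← embed_mul]
  rw [← embed_sum, M.complete, embed_one]

/-- A loop whose body resets everything to the state `σ`, entered with certainty: its output is
`σ`, conditioned on the outcome `0` of the guard. If that outcome has probability `0`, the loop
diverges; its output is then `0`, in accordance with `0⁻¹ = 0`. -/
theorem denote_loop_of_reset {ι : Type} [Fintype ι] [DecidableEq ι] (r : ι ↪ Var)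
    (M : Measurement (ι → Fin 2) (Fin 2)) {body : Prog Var} {σ : Op Var} (hσ : σ.PosSemidef)
    (hσ1 : σ.trace = 1) (hbody : ∀ ρ, body.denote ρ = ρ.trace • σ) {ρ : Op Var}
    (hρ : sandwich (embed r (M.op 0)) ρ = 0) :
    (Prog.loop r M body).denote ρ = ρ.trace •
      (sandwich (embed r (M.op 0)) σ).trace⁻¹ • sandwich (embed r (M.op 0)) σ := by
  have hM := embed_measurement_complete r M
  set M₀ := embed r (M.op 0)
  set M₁ := embed r (M.op 1)
  set A := sandwich M₀ σ with hA
  have hsum : ∀ τ, (sandwich M₀ τ).trace + (sandwich M₁ τ).trace = τ.trace := by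
    intro τ
    rw [trace_sandwich, trace_sandwich, ← Matrix.trace_add, ← Matrix.add_mul, hM, Matrix.one_mul]
  obtain ⟨ha, ha0⟩ := PosSemidef.trace_eq_ofReal (posSemidef_sandwich M₀ hσ)
  obtain ⟨hb, hb0⟩ := PosSemidef.trace_eq_ofReal (posSemidef_sandwich M₁ hσ)
  set a := (sandwich M₀ σ).trace.re
  set b := (sandwich M₁ σ).trace.re
  have hab : a + b = 1 := by
    have := hsum σ
    rw [ha, hb, hσ1] at this
    exact_mod_cast this
  -- the unrollings are partial sums of a geometric series
  have step : ∀ k (z : ℂ), whileApprox M₀ M₁ body.denote k (z • σ) =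
      z • (∑ j ∈ Finset.range k, (b : ℂ) ^ j) • A := by
    intro k
    induction k with
    | zero => intro z; simp [whileApprox]
    | succ k ih =>
      intro z
      rw [whileApprox, hbody, ih, sandwich_smul, sandwich_smul, Matrix.trace_smul, hb,
        geom_sum_succ,
        smul_eq_mul]
      module
  have step' : ∀ k, whileApprox M₀ M₁ body.denote (k + 1) ρ =
      ρ.trace • (∑ j ∈ Finset.range k, (b : ℂ) ^ j) • A := by
    intro k
    have := hsum ρ
    rw [hρ, Matrix.trace_zero, zero_add] at this
    rw [whileApprox, hρ, hbody, step, zero_add, this]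
  change Filter.limUnder Filter.atTop (fun k => whileApprox M₀ M₁ body.denote k ρ) = _
  refine Filter.Tendsto.limUnder_eq ?_
  rw [← Filter.tendsto_add_atTop_iff_nat 1]
  simp only [step']
  refine Filter.Tendsto.const_smul ?_ _
  rcases ha0.eq_or_lt with h0 | h0
  -- for `b = 1` the series diverges, but `A` vanishes
  · have : A = 0 := (posSemidef_sandwich M₀ hσ).trace_eq_zero_iff.1 (by rw [ha, ← h0]; simp)
    simp [this]
  · refine Filter.Tendsto.smul_const ?_ _
    have hlt : ‖(b : ℂ)‖ < 1 := by
      rw [Complex.norm_of_nonneg hb0]; linarith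
    have hinv : (1 - (b : ℂ))⁻¹ = (sandwich M₀ σ).trace⁻¹ := by
      rw [ha, ← Complex.ofReal_one, ← Complex.ofReal_sub, ← hab, add_sub_cancel_right]
    rw [← hinv]
    exact (hasSum_geometric_of_norm_lt_one hlt).tendsto_sum_nat

theorem isChannel_initOne (q : Var) : IsChannel (initOne q).denote :=
  (isChannel_init q).seq (isChannel_unitary _ _)

theorem embed_stdMeas_mulVec_ket (q : Var) (m : Fin 2) (t : Var → Fin 2) :
    (embed (single q) (stdMeas.op m)).mulVec (ket t) = if t q = m then ket t else 0 := by
  change (embed (single q) (tens fun _ => outer (ket m) (ket m))).mulVec (ket t) = _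
  rw [embed_single_outer_mulVec_ket]
  by_cases h : t q = m
  · rw [if_pos h, if_pos h, ← h, Function.update_eq_self]
  · rw [if_neg h, if_neg h]

theorem sandwich_stdMeas_zero_initOne (q : Var) (ρ : Op Var) :
    sandwich (embed (single q) (stdMeas.op 0)) ((initOne q).denote ρ) = 0 := by
  have h : ∀ b : Fin 2, embed (single q) (stdMeas.op 0) * (embed (single q) (gate1 gateX).1 *
      embed (single q) (tens fun _ => outer (ket 0) (ket b))) = 0 := by
    intro b
    have h1 : outer (ket 0) (ket 0) * (pauliX * outer (ket 0) (ket b)) = 0 := by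
      rw [← Matrix.mul_assoc]
      ext i j
      fin_cases i <;> simp [outer_ket_ket, Matrix.mul_apply, pauliX, Matrix.single_apply]
    rw [← embed_mul, ← embed_mul]
    change embed (single q)
      (tens (fun _ => outer (ket 0) (ket 0)) * (tens (fun _ => pauliX) * _)) = 0
    rw [tens_mul, tens_mul, h1]
    ext s t
    simp [embed, tens]
  change sandwich _ (sandwich _ (∑ b : Fin 2, sandwich _ ρ)) = 0
  rw [sandwich_sum, sandwich_sum]
  exact Finset.sum_eq_zero fun b _ => by
    rw [← sandwich_mul, ← sandwich_mul, Matrix.mul_assoc, h, sandwich_zero]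

/-- The output of a loop with a resetting body whose guard qubit is initialized to `|1⟩`. -/
theorem denote_initOne_loop_of_reset {p q : Var} {body : Prog Var} {σ : Op Var} (hσ : σ.PosSemidef)
    (hσ1 : σ.trace = 1) (hbody : ∀ ρ, body.denote ρ = ρ.trace • σ) (ρ : Op Var) :
    (initOne p ;; initOne q ;; .loop (single q) stdMeas body).denote ρ = ρ.trace •
      (sandwich (embed (single q) (stdMeas.op 0)) σ).trace⁻¹ •
        sandwich (embed (single q) (stdMeas.op 0)) σ := by
  change (Prog.loop (single q) stdMeas body).denote
    ((initOne q).denote ((initOne p).denote ρ)) = _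
  rw [denote_loop_of_reset (single q) stdMeas hσ hσ1 hbody (sandwich_stdMeas_zero_initOne q _),
    (isChannel_initOne q).trace_apply, (isChannel_initOne p).trace_apply]

/-! ### The state of the quantum coins -/

/-- The gates of the loop body of the Bernoulli factory. -/
def coinGates (c pV pU : unitInterval) : Prog (Fin 2) :=
  flipNoisy pV (single 0) (gate1 (coinV c)) ;; flipNoisy pV (single 1) (gate1 (coinV c)) ;;
    flipNoisy pU (pair 0 1 (by decide)) bellU

/-- The state after one run of the loop body of the Bernoulli factory. -/
def coinState (c pV pU : unitInterval) : Op (Fin 2) :=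
  (coinGates c pV pU).denote (outer (ket 0) (ket 0))

theorem isChannel_coinGates (c pV pU : unitInterval) : IsChannel (coinGates c pV pU).denote :=
  (isChannel_flipNoisy _ _ _).seq ((isChannel_flipNoisy _ _ _).seq (isChannel_flipNoisy _ _ _))

theorem posSemidef_coinState (c pV pU : unitInterval) : (coinState c pV pU).PosSemidef :=
  (isChannel_coinGates c pV pU).posSemidef (posSemidef_outer _)

theorem trace_coinState (c pV pU : unitInterval) : (coinState c pV pU).trace = 1 := by
  rw [coinState, (isChannel_coinGates c pV pU).trace_apply, outer_ket_ket,
    Matrix.trace_single_eq_same]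

/-- No flip occurs in the loop body with probability `(1 - pV) ^ 2 * (1 - pU) ^ 2`. -/
theorem posSemidef_coinState_sub (c pV pU : unitInterval) :
    (coinState c pV pU -
      (((1 - pV) ^ 2 * (1 - pU) ^ 2 : ℝ) : ℂ) • coinState c 0 0).PosSemidef := by
  have h0 : (outer (ket (0 : Fin 2 → Fin 2)) (ket 0) -
      ((1 : ℝ) : ℂ) • outer (ket (0 : Fin 2 → Fin 2)) (ket 0)).PosSemidef := by
    rw [Complex.ofReal_one, one_smul, sub_self]
    exact Matrix.PosSemidef.zero
  have p0 := posSemidef_outer (ket (0 : Fin 2 → Fin 2))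
  have h1 := posSemidef_flipNoisy_sub pV (single 0) (gate1 (coinV c)) p0 h0
  have p1 := (isChannel_flipNoisy pV (single 0) (gate1 (coinV c))).posSemidef p0
  have h2 := posSemidef_flipNoisy_sub pV (single 1) (gate1 (coinV c)) p1 h1
  have p2 := (isChannel_flipNoisy pV (single 1) (gate1 (coinV c))).posSemidef p1
  have h3 := posSemidef_flipNoisy_sub pU (pair 0 1 (by decide)) bellU p2 h2
  have e : (1 - pV : ℝ) ^ 2 * (1 - pU) ^ 2 = 1 * (1 - pV) ^ Fintype.card (Fin 1) *
      (1 - pV) ^ Fintype.card (Fin 1) * (1 - pU) ^ Fintype.card (Fin 2) := by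
    simp only [Fintype.card_fin]; ring
  rw [e]
  exact h3

theorem embed_pair_zero_one (h : (0 : Fin 2) ≠ 1) (A : Op (Fin 2)) :
    embed (pair 0 1 h) A = A := by
  have e : ∀ s : Fin 2 → Fin 2, s ∘ pair 0 1 h = s := fun s => by
    funext i; fin_cases i <;> rfl
  ext s t
  rw [embed_apply_of_agree, e, e]
  intro v hv
  fin_cases v
  · exact absurd rfl (hv 0)
  · exact absurd rfl (hv 1)

/-- The output qubit of the noiseless loop body reads `0` with probability
`(2c - 1)² / 2 + 2c(1 - c) = 1 / 2`. -/
theorem trace_sandwich_coinState_zero (c : unitInterval) :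
    (sandwich (embed (single 1) (stdMeas.op 0)) (coinState c 0 0)).trace = 1 / 2 := by
  have e : coinState c 0 0 = sandwich bellMatrix (sandwich (embed (single 1) (gate1 (coinV c)).1)
      (sandwich (embed (single 0) (gate1 (coinV c)).1) (outer (ket 0) (ket 0)))) := by
    change (flipNoisy 0 _ _).denote ((flipNoisy 0 _ _).denote ((flipNoisy 0 _ _).denote _)) = _
    simp only [denote_flipNoisy_zero]
    change sandwich (embed (pair 0 1 _) bellMatrix) _ = _
    rw [embed_pair_zero_one]
    rfl
  have hk : ∀ a b c d : Fin 2, ket ![a,b] ![c,d] = if c = a ∧ d = b then (1:ℂ) else 0 := by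
    intro a b c d
    simp [ket, Pi.single_apply, funext_iff, Fin.forall_fin_two]
  have hsum : ∀ f : (Fin 2 → Fin 2) → ℂ, ∑ s, f s = f ![0,0] + f ![0,1] + f ![1,0] + f ![1,1] := by
    intro f
    rw [← (finTwoArrowEquiv (Fin 2)).symm.sum_comp, Fintype.sum_prod_type]
    simp [Fin.sum_univ_two, finTwoArrowEquiv]
    ring
  have hup : ∀ a b : Fin 2, Function.update (Function.update (0 : Fin 2 → Fin 2) 0 a) 1 b =
      ![a, b] := by
    intro a b; funext i; fin_cases i <;> simp
  have hv : (embed (single 1) (gate1 (coinV c)).1).mulVec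
      ((embed (single 0) (gate1 (coinV c)).1).mulVec (ket 0)) =
      ∑ a : Fin 2, ∑ b : Fin 2, ((coinV c).1 a 0 * (coinV c).1 b 0) • ket ![a, b] := by
    change (embed (single 1) (tens fun _ => (coinV c).1)).mulVec
      ((embed (single 0) (tens fun _ => (coinV c).1)).mulVec (ket 0)) = _
    rw [embed_single_mulVec_ket]
    simp only [Fin.sum_univ_two, Matrix.mulVec_add, Matrix.mulVec_smul, embed_single_mulVec_ket,
      hup,
      smul_add, smul_smul]
    simp
  have hM : ∀ v : (Fin 2 → Fin 2) → ℂ, (embed (single 1) (stdMeas.op 0)).mulVec v =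
      fun s => if s 1 = 0 then v s else 0 := by
    intro v
    have : embed (single 1) (stdMeas.op 0) =
        Matrix.diagonal fun s : Fin 2 → Fin 2 => if s 1 = 0 then (1 : ℂ) else 0 := by
      refine ext_mulVec_ket fun t => ?_
      rw [embed_stdMeas_mulVec_ket, ket, Matrix.diagonal_mulVec_single]
      split_ifs <;> simp
    rw [this]
    funext s
    rw [Matrix.mulVec_diagonal]
    simp
  -- the amplitudes of `|00⟩` and `|10⟩`, with `x = √c` and `y = √(1 - c)`
  set x : ℝ := √(c : ℝ)
  set y : ℝ := √(1 - (c : ℝ))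
  have hxy : x ^ 2 + y ^ 2 = 1 := by
    rw [Real.sq_sqrt c.2.1, Real.sq_sqrt (sub_nonneg.2 c.2.2)]; ring
  set φ : (Fin 2 → Fin 2) → ℂ := bellMatrix.mulVec
    (∑ a : Fin 2, ∑ b : Fin 2, ((coinV c).1 a 0 * (coinV c).1 b 0) • ket ![a, b]) with hφ
  have hV : (coinV c).1 0 0 = (x : ℂ) ∧ (coinV c).1 1 0 = (y : ℂ) := ⟨rfl, rfl⟩
  have h00 : φ ![0, 0] = (((x ^ 2 - y ^ 2) / √2 : ℝ) : ℂ) := by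
    simp only [hφ, Fin.sum_univ_two, Matrix.mulVec_add, Matrix.mulVec_smul, mulVec_ket, bellMatrix,
      outer, bellPhi, bellPsi, Matrix.add_apply, Matrix.vecMulVec_apply, hk, Pi.add_apply,
      Pi.smul_apply, Pi.star_apply, hV.1, hV.2]
    simp
    ring
  have h10 : φ ![1, 0] = ((2 * x * y / √2 : ℝ) : ℂ) := by
    simp only [hφ, Fin.sum_univ_two, Matrix.mulVec_add, Matrix.mulVec_smul, mulVec_ket, bellMatrix,
      outer, bellPhi, bellPsi, Matrix.add_apply, Matrix.vecMulVec_apply, hk, Pi.add_apply,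
      Pi.smul_apply, Pi.star_apply, hV.1, hV.2]
    simp
    ring
  rw [e]
  simp only [sandwich_outer, hv, ← hφ, hM, trace_outer, dotProduct, hsum, Pi.star_apply]
  simp only [Matrix.cons_val_one, Matrix.cons_val_zero, one_ne_zero, if_true, if_false, h00, h10,
    Complex.star_def, Complex.conj_ofReal, ← Complex.ofReal_mul, zero_mul, add_zero,
    ← Complex.ofReal_add]
  rw [← mul_div_mul_comm, ← mul_div_mul_comm, Real.mul_self_sqrt (by norm_num), ← add_div,
    show (x ^ 2 - y ^ 2) * (x ^ 2 - y ^ 2) + 2 * x * y * (2 * x * y) = (x ^ 2 + y ^ 2) ^ 2 by ring,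
    hxy]
  norm_num

/-! ### The factory without error correction -/

theorem denote_seq {Var : Type} [Fintype Var] [DecidableEq Var] (P₁ P₂ : Prog Var) (ρ : Op Var) :
    (P₁ ;; P₂).denote ρ = P₂.denote (P₁.denote ρ) := rfl

theorem denote_loop_congr {ι Var : Type} [Fintype ι] [DecidableEq ι] [Fintype Var]
    [DecidableEq Var] (r : ι ↪ Var) (M : Measurement (ι → Fin 2) (Fin 2)) {P Q : Prog Var}
    (h : P.denote = Q.denote) : (Prog.loop r M P).denote = (Prog.loop r M Q).denote := by
  funext ρ
  change Filter.limUnder _ _ = Filter.limUnder _ _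
  rw [h]

theorem denote_seq_congr {Var : Type} [Fintype Var] [DecidableEq Var] {P₁ P₂ Q₁ Q₂ : Prog Var}
    (h₁ : P₁.denote = Q₁.denote) (h₂ : P₂.denote = Q₂.denote) :
    (P₁ ;; P₂).denote = (Q₁ ;; Q₂).denote := by
  funext ρ
  rw [denote_seq, denote_seq, h₁, h₂]

/-- The ideal version of a noisy gate is the noisy gate with error rate `0`. -/
theorem denote_ideal_flipNoisy {ι Var : Type} [Fintype ι] [DecidableEq ι] [Fintype Var]
    [DecidableEq Var] (p : unitInterval) (r : ι ↪ Var) (U : Matrix.unitaryGroup (ι → Fin 2) ℂ) :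
    (flipNoisy p r U).ideal.denote = (flipNoisy 0 r U).denote :=
  (denote_flipNoisy_zero r U).symm

/-- The ideal factory is the factory with error rates `0`. -/
theorem denote_ideal_qbf (c pV pU : unitInterval) :
    (qbf c pV pU).ideal.denote = (qbf c 0 0).denote :=
  denote_seq_congr rfl <| denote_seq_congr rfl <| denote_loop_congr _ _ <|
    denote_seq_congr rfl <| denote_seq_congr rfl <|
    denote_seq_congr (denote_ideal_flipNoisy _ _ _) <|
    denote_seq_congr (denote_ideal_flipNoisy _ _ _) (denote_ideal_flipNoisy _ _ _)

/-- All qubits in `Z` are reset to `|0⟩`, and nothing else happens. -/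
def Resets {Var : Type} [Fintype Var] [DecidableEq Var] (Z : Finset Var)
    (E : Op Var → Op Var) : Prop :=
  ∀ s t : Var → Fin 2, E (outer (ket s) (ket t)) =
    if ∀ z ∈ Z, s z = t z then
      outer (ket fun v => if v ∈ Z then 0 else s v) (ket fun v => if v ∈ Z then 0 else t v)
    else 0

namespace Resets

variable {Var : Type} [Fintype Var] [DecidableEq Var]

theorem empty : Resets (∅ : Finset Var) fun ρ => ρ := fun s t => by simp

variable {Z : Finset Var} {E : Op Var → Op Var}

theorem init (h : Resets Z E) (q : Var) :
    Resets (insert q Z) fun ρ => (Prog.init q).denote (E ρ) := by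
  intro s t
  change (Prog.init q).denote (E _) = _
  have hup : ∀ s : Var → Fin 2, Function.update (fun v => if v ∈ Z then 0 else s v) q 0 =
      fun v => if v ∈ insert q Z then 0 else s v := by
    intro s
    funext v
    by_cases hv : v = q
    · subst hv; simp
    · simp [hv]
  rw [h]
  by_cases hZ : ∀ z ∈ Z, s z = t z
  · rw [if_pos hZ, denote_init_outer_ket, hup, hup]
    refine if_congr ⟨fun e => ?_, fun e => ?_⟩ rfl rfl
    · rw [Finset.forall_mem_insert]
      refine ⟨?_, hZ⟩
      by_cases hq : q ∈ Z
      · exact hZ q hq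
      · simpa [hq] using e
    · rw [e q (Finset.mem_insert_self q Z)]
  · rw [if_neg hZ, if_neg fun e => hZ fun z hz => e z (Finset.mem_insert_of_mem hz)]
    simpa using (isChannel_init q).map_smul 0 0

/-- Once every qubit has been reset, the state is `|0…0⟩`. -/
theorem denote_eq (h : Resets Z E) (hZ : ∀ v, v ∈ Z) (hE : IsChannel E) (ρ : Op Var) :
    E ρ = ρ.trace • outer (ket 0) (ket 0) := by
  rw [hE.map_eq_sum_ket, Matrix.trace, Finset.sum_smul]
  refine Finset.sum_congr rfl fun s _ => ?_
  rw [Finset.sum_eq_single s, h, if_pos fun _ _ => rfl]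
  · simp only [hZ, if_true]
    rfl
  · intro t _ hts
    rw [h, if_neg fun e => hts (funext fun v => (e v (hZ v)).symm), smul_zero]
  · simp

end Resets

theorem denote_qbf (c pV pU : unitInterval) (ρ : Op (Fin 2)) :
    (qbf c pV pU).denote ρ = ρ.trace •
      (sandwich (embed (single 1) (stdMeas.op 0)) (coinState c pV pU)).trace⁻¹ •
        sandwich (embed (single 1) (stdMeas.op 0)) (coinState c pV pU) := by
  refine denote_initOne_loop_of_reset (posSemidef_coinState c pV pU) (trace_coinState c pV pU)
    (fun ρ => ?_) ρ
  change (coinGates c pV pU).denote ((Prog.init 1).denote ((Prog.init 0).denote ρ)) = _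
  have hreset := ((Resets.empty.init (0 : Fin 2)).init 1).denote_eq (by decide)
    ((isChannel_init 1).comp (isChannel_init 0)) ρ
  rw [hreset, (isChannel_coinGates c pV pU).map_smul]
  rfl

/-- The error bound of both factories: `2 (1 - w)` for the probability `w` of a loop body without
logical errors. -/
theorem two_mul_one_sub_le {q u : ℝ} (hq0 : 0 ≤ q) (hq1 : q ≤ 1) (hu0 : 0 ≤ u) (hu1 : u ≤ 1) :
    2 * (1 - (1 - q) ^ 2 * (1 - u) ^ 2) ≤ 4 * q + 2 * (2 * u - u ^ 2) := by
  have h : 0 ≤ q * (2 - q) * (u * (2 - u)) :=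
    mul_nonneg (mul_nonneg hq0 (by linarith)) (mul_nonneg hu0 (by linarith))
  linarith [sq_nonneg q]

theorem robust_qbf (c pV pU : unitInterval) :
    Robust 1 0 (qbf c pV pU) (4 * (pV : ℝ) + 2 * (2 * (pU : ℝ) - (pU : ℝ) ^ 2)) := by
  rw [Robust, denote_ideal_qbf]
  refine (qDiamond_conditioned_le (embed_measurement_complete (single 1) stdMeas)
    (denote_qbf c pV pU) (denote_qbf c 0 0)
    (trace_coinState c pV pU) (posSemidef_coinState c 0 0) (trace_coinState c 0 0)
    (trace_sandwich_coinState_zero c) (by positivity) (posSemidef_coinState_sub c pV pU)).trans ?_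
  exact ENNReal.ofReal_le_ofReal (two_mul_one_sub_le pV.2.1 pV.2.2 pU.2.1 pU.2.2)

/-- The independent flips of several qubits are at diamond distance `1 - (1 - p) ^ n` from the
identity. -/
theorem diamond_tensorPow_bitFlip {ι : Type} [Fintype ι] [DecidableEq ι] (p : unitInterval) :
    diamond ((bitFlip p).tensorPow ι).apply id =
      ENNReal.ofReal (1 - (1 - (p : ℝ)) ^ Fintype.card ι) := by
  rw [diamond_eq_qDiamond, ← flipWeight_zero]
  refine qDiamond_mixture (fun _ => True) (flipWeight_nonneg p.2.1 p.2.2) (sum_flipWeight _)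
    flipOp_isometry 0 (fun ρ _ => tensorPow_bitFlip_apply p ρ)
    (fun ρ _ => by rw [flipOp_zero, sandwich_one, id]) (ψ := ket 0) (fun _ _ => trivial)
    (f := fun e => 0 + e) (add_right_injective 0) fun e => flipOp_mulVec_ket e 0

theorem diamond_bitFlip (p : unitInterval) :
    diamond (bitFlip p).apply id = ENNReal.ofReal p := by
  have h2 : (p : ℝ) = 1 - ![1 - (p : ℝ), p] 0 := by simp
  rw [diamond_eq_qDiamond, h2]
  refine qDiamond_mixture (fun _ => True) (β := Fin 2) (fun b => ?_) (by simp)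
    (A := ![1, pauliX]) (fun b => ?_) 0 (fun ρ _ => ?_)
    (fun ρ _ => by simp [sandwich_one]) (ψ := ket 0) (fun _ _ => trivial)
    (f := id) Function.injective_id fun b => ?_
  · fin_cases b
    · exact sub_nonneg.2 p.2.2
    · exact p.2.1
  · fin_cases b <;> simp [pauliX_conjTranspose, pauliX_mul_self]
  · have h : ∀ x : ℝ, 0 ≤ x → (√x : ℂ) * star (√x : ℂ) = (x : ℂ) := fun x hx => by
      rw [Complex.star_def, Complex.conj_ofReal, ← Complex.ofReal_mul, Real.mul_self_sqrt hx]
    change ∑ i : Fin 2, sandwich ((bitFlip p).kraus i) ρ = _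
    simp only [bitFlip_kraus, smul_sandwich, Fin.sum_univ_two, zero_ne_one, if_true,
      if_false, h _ p.2.1, h _ (sub_nonneg.2 p.2.2)]
    rfl
  · rw [mulVec_ket]
    funext s
    fin_cases b <;> fin_cases s <;> simp [pauliX, ket]

/-! ### Error correction -/

/-- The basis states in which block `i` holds a codeword and clean syndrome qubits. -/
abbrev CodeState (i : Fin 2) (s : FTVar → Fin 2) : Prop :=
  s (i, 0) = s (i, 1) ∧ s (i, 1) = s (i, 2) ∧ s (i, 3) = 0 ∧ s (i, 4) = 0

theorem supportedOn_of_diagonal {n : Type} [Fintype n] [DecidableEq n] {S : n → Prop}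
    [DecidablePred S] {Q ρ : Matrix n n ℂ} (hQ : Q = Matrix.diagonal fun s => if S s then 1 else 0)
    (h : Q * ρ * Q = ρ) : SupportedOn S ρ := by
  intro s t hst
  rw [← h, hQ, Matrix.mul_diagonal, Matrix.diagonal_mul] at hst
  by_contra hS
  rcases not_and_or.1 hS with h | h <;> simp [h] at hst

theorem codeProj_mul_codeProj : codeProj 0 * codeProj 1 =
    Matrix.diagonal fun s => if CodeState 0 s ∧ CodeState 1 s then 1 else 0 := by
  rw [codeProj, codeProj, Matrix.diagonal_mul_diagonal]
  congr 1
  funext s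
  by_cases h0 : CodeState 0 s <;> by_cases h1 : CodeState 1 s <;> simp [h0, h1]

theorem SupportedOn.sandwich {n : Type} [Fintype n] {S : n → Prop} {A ρ : Matrix n n ℂ}
    (hρ : SupportedOn S ρ) (hA : ∀ s t, S t → A s t ≠ 0 → S s) :
    SupportedOn S (sandwich A ρ) := by
  intro s t hst
  rw [QWhile.sandwich, Matrix.mul_apply] at hst
  obtain ⟨v, -, hv⟩ := Finset.exists_ne_zero_of_sum_ne_zero hst
  rw [Matrix.mul_apply] at hv
  obtain ⟨u, -, hu⟩ := Finset.exists_ne_zero_of_sum_ne_zero (left_ne_zero_of_mul hv)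
  have h := hρ u v (right_ne_zero_of_mul hu)
  refine ⟨hA s u h.1 (left_ne_zero_of_mul hu), hA t v h.2 fun h0 => right_ne_zero_of_mul hv ?_⟩
  rw [Matrix.conjTranspose_apply, h0, star_zero]

theorem SupportedOn.mono {n : Type} {S T : n → Prop} {ρ : Matrix n n ℂ} (hρ : SupportedOn S ρ)
    (h : ∀ s, S s → T s) : SupportedOn T ρ :=
  fun s t hst => ⟨h s (hρ s t hst).1, h t (hρ s t hst).2⟩

/-- The majority of three bits. -/
def maj (e : Fin 3 → Fin 2) : Fin 2 := e 0 * e 1 + e 1 * e 2 + e 2 * e 0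

/-- The effect of a controlled-not on the bits. -/
def cnotBits {Var : Type} [DecidableEq Var] (a b : Var) (s : Var → Fin 2) : Var → Fin 2 :=
  Function.update s b (s b + s a)

/-- The effect of the `xy`-Toffoli gate, controlled by `a` and `b`, on the bits. -/
def toffoliBits {Var : Type} [DecidableEq Var] (x y : Fin 2) (a b j : Var) (s : Var → Fin 2) :
    Var → Fin 2 :=
  Function.update s j (if s a = x ∧ s b = y then s j + 1 else s j)

theorem denote_cnotAt_outer_ket (i : Fin 2) (a b : Fin 5) (h : a ≠ b) (s t : FTVar → Fin 2) :
    (cnotAt i a b h).denote (outer (ket s) (ket t)) =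
      outer (ket (cnotBits (i, a) (i, b) s)) (ket (cnotBits (i, a) (i, b) t)) := by
  have hne : ((i, a) : FTVar) ≠ (i, b) := fun e => h (Prod.ext_iff.1 e).2
  have e : ∀ s : FTVar → Fin 2, Function.extend (pair (i, a) (i, b) hne)
      ![s (i, a), s (i, b) + s (i, a)] s = cnotBits (i, a) (i, b) s := by
    intro s
    refine Eq.trans ?_ (eq_extend_of_agree (pair (i, a) (i, b) hne)
      (s := cnotBits (i, a) (i, b) s) (t := s) fun v hv => ?_).symm
    · congr 1
      funext k
      fin_cases k
      · exact (Function.update_of_ne hne _ _).symm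
      · exact (Function.update_self (i, b) (s (i, b) + s (i, a)) s).symm
    · rw [cnotBits, Function.update_of_ne (show v ≠ (i, b) from fun h' => hv 1 h'.symm)]
  rw [← e, ← e]
  exact denote_unitary_outer_ket _ _ _ s t

theorem denote_toffoliAt_outer_ket (i : Fin 2) (a b : Fin 2) (j : Fin 3) (s t : FTVar → Fin 2) :
    (toffoliAt i a b j).denote (outer (ket s) (ket t)) =
      outer (ket (toffoliBits a b (i, 3) (i, 4) (block i j) s))
        (ket (toffoliBits a b (i, 3) (i, 4) (block i j) t)) := by
  have e : ∀ (r : Fin 3 ↪ FTVar) (s : FTVar → Fin 2), Function.extend r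
      ![s (r 0), s (r 1), if s (r 0) = a ∧ s (r 1) = b then s (r 2) + 1 else s (r 2)] s =
        toffoliBits a b (r 0) (r 1) (r 2) s := by
    intro r s
    refine Eq.trans ?_ (eq_extend_of_agree r (s := toffoliBits a b (r 0) (r 1) (r 2) s) (t := s)
      fun v hv => ?_).symm
    · congr 1
      funext k
      fin_cases k
      · exact (Function.update_of_ne (r.injective.ne (by decide)) _ _).symm
      · exact (Function.update_of_ne (r.injective.ne (by decide)) _ _).symm
      · exact (Function.update_self (r 2) _ s).symm
    · rw [toffoliBits, Function.update_of_ne fun h' => hv 2 h'.symm]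
  refine (denote_unitary_outer_ket _ _ _ s t).trans ?_
  exact congrArg₂ (fun x y => outer (ket x) (ket y)) (e _ s) (e _ t)

/-- The effect of the gates of `CORRECT` on the bits of one block. -/
def correctBits (w : Fin 5 → Fin 2) : Fin 5 → Fin 2 :=
  toffoliBits 1 0 3 4 0 <| toffoliBits 0 1 3 4 2 <| toffoliBits 1 1 3 4 1 <|
    cnotBits 2 4 <| cnotBits 1 4 <| cnotBits 1 3 <| cnotBits 0 3 w

/-- `s` with the bits of block `i` replaced by `w`. -/
def setBlock (i : Fin 2) (s : FTVar → Fin 2) (w : Fin 5 → Fin 2) : FTVar → Fin 2 :=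
  fun v => if v.1 = i then w v.2 else s v

theorem setBlock_self (i : Fin 2) (s : FTVar → Fin 2) : setBlock i s (fun k => s (i, k)) = s := by
  funext ⟨j, k⟩
  by_cases h : j = i
  · subst h; simp [setBlock]
  · simp [setBlock, h]

theorem update_setBlock (i : Fin 2) (s : FTVar → Fin 2) (w : Fin 5 → Fin 2) (k : Fin 5)
    (b : Fin 2) : Function.update (setBlock i s w) (i, k) b =
      setBlock i s (Function.update w k b) := by
  funext ⟨j, l⟩
  by_cases hj : j = i
  · subst hj
    by_cases hl : l = k
    · subst hl; simp [setBlock]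
    · simp [setBlock, hl]
  · simp [setBlock, hj]

theorem setBlock_apply (i : Fin 2) (s : FTVar → Fin 2) (w : Fin 5 → Fin 2) (k : Fin 5) :
    setBlock i s w (i, k) = w k := if_pos rfl

theorem cnotBits_setBlock (i : Fin 2) (s : FTVar → Fin 2) (w : Fin 5 → Fin 2) (a b : Fin 5) :
    cnotBits (i, a) (i, b) (setBlock i s w) = setBlock i s (cnotBits a b w) := by
  simp only [cnotBits, update_setBlock, setBlock_apply]

theorem toffoliBits_setBlock (i : Fin 2) (s : FTVar → Fin 2) (w : Fin 5 → Fin 2) (x y : Fin 2)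
    (a b j : Fin 5) : toffoliBits x y (i, a) (i, b) (i, j) (setBlock i s w) =
      setBlock i s (toffoliBits x y a b j w) := by
  simp only [toffoliBits, update_setBlock, setBlock_apply]

/-- The reset of the syndrome qubits annihilates `|s⟩⟨t|` unless the syndromes agree. -/
theorem denote_correct_outer_ket (i : Fin 2) (s t : FTVar → Fin 2) (w x : Fin 5 → Fin 2) :
    (correct i).denote (outer (ket (setBlock i s w)) (ket (setBlock i t x))) =
      if correctBits w 3 = correctBits x 3 ∧ correctBits w 4 = correctBits x 4 then
        outer (ket (setBlock i s (Function.update (Function.update (correctBits w) 3 0) 4 0)))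
          (ket (setBlock i t (Function.update (Function.update (correctBits x) 3 0) 4 0)))
      else 0 := by
  simp only [correct, denote_seq, denote_cnotAt_outer_ket, denote_toffoliAt_outer_ket,
    cnotBits_setBlock]
  have hb : ∀ j : Fin 3, block i j = (i, Fin.castLE (by decide : 3 ≤ 5) j) := fun _ => rfl
  simp only [hb, toffoliBits_setBlock, denote_init_outer_ket, setBlock_apply, update_setBlock]
  change (Prog.init (i, 4)).denote (if correctBits w 3 = correctBits x 3 then
    outer (ket (setBlock i s (Function.update (correctBits w) 3 0)))
      (ket (setBlock i t (Function.update (correctBits x) 3 0))) else 0) = _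
  by_cases h3 : correctBits w 3 = correctBits x 3
  · rw [if_pos h3, denote_init_outer_ket, setBlock_apply, setBlock_apply, update_setBlock,
      update_setBlock, Function.update_of_ne (by decide), Function.update_of_ne (by decide)]
    simp only [h3, true_and]
  · rw [if_neg h3, if_neg fun h => h3 h.1]
    simpa using (isChannel_init ((i, 4) : FTVar)).map_smul 0 0

/-- The syndrome of a flipped codeword depends on the flips only, and correction leaves the
majority of the flips. -/
theorem correctBits_flip (x : Fin 2) (e : Fin 3 → Fin 2) :
    correctBits ![x + e 0, x + e 1, x + e 2, 0, 0] 3 = e 0 + e 1 ∧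
      correctBits ![x + e 0, x + e 1, x + e 2, 0, 0] 4 = e 1 + e 2 ∧
      Function.update (Function.update
        (correctBits ![x + e 0, x + e 1, x + e 2, 0, 0]) 3 0) 4 0 =
        ![x + maj e, x + maj e, x + maj e, 0, 0] := by
  have h : ∀ x a b c : Fin 2, correctBits ![x + a, x + b, x + c, 0, 0] 3 = a + b ∧
      correctBits ![x + a, x + b, x + c, 0, 0] 4 = b + c ∧
      ∀ k, Function.update (Function.update
        (correctBits ![x + a, x + b, x + c, 0, 0]) 3 0) 4 0 k =
        ![x + (a * b + b * c + c * a), x + (a * b + b * c + c * a),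
          x + (a * b + b * c + c * a), 0, 0] k := by decide
  exact ⟨(h x (e 0) (e 1) (e 2)).1, (h x (e 0) (e 1) (e 2)).2.1,
    funext (h x (e 0) (e 1) (e 2)).2.2⟩

theorem isChannel_cnotAt (i : Fin 2) (a b : Fin 5) (h : a ≠ b) :
    IsChannel (cnotAt i a b h).denote := isChannel_unitary _ _

theorem isChannel_toffoliAt (i : Fin 2) (a b : Fin 2) (j : Fin 3) :
    IsChannel (toffoliAt i a b j).denote := isChannel_unitary _ _

theorem isChannel_correct (i : Fin 2) : IsChannel (correct i).denote :=
  (isChannel_cnotAt _ _ _ _).seq <| (isChannel_cnotAt _ _ _ _).seq <|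
  (isChannel_cnotAt _ _ _ _).seq <| (isChannel_cnotAt _ _ _ _).seq <|
  (isChannel_toffoliAt _ _ _ _).seq <| (isChannel_toffoliAt _ _ _ _).seq <|
  (isChannel_toffoliAt _ _ _ _).seq <| (isChannel_init _).seq (isChannel_init _)

/-- The flips that remain after the correction of block `i`. -/
def correctFlips (i : Fin 2) (v : FTVar → Fin 2) : FTVar → Fin 2 :=
  setBlock i v ![maj (v ∘ block i), maj (v ∘ block i), maj (v ∘ block i), 0, 0]

/-- Correction of a flipped code state leaves a flip of the whole block, or none: the syndrome does
not depend on the codeword, so that the reset of the syndrome qubits preserves coherence. -/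
theorem denote_correct_flip (i : Fin 2) {v : FTVar → Fin 2} (h3 : v (i, 3) = 0)
    (h4 : v (i, 4) = 0) {ρ : Op FTVar} (hρ : SupportedOn (CodeState i) ρ) :
    (correct i).denote (sandwich (flipOp v) ρ) = sandwich (flipOp (correctFlips i v)) ρ := by
  refine ((isChannel_correct i).comp (IsChannel.sandwich (flipOp_isometry v))).eq_of_ket
    (IsChannel.sandwich (flipOp_isometry _)) hρ fun s t hs ht => ?_
  have e : ∀ s : FTVar → Fin 2, CodeState i s → s + v = setBlock i (s + v)
      ![s (i, 0) + (v ∘ block i) 0, s (i, 0) + (v ∘ block i) 1, s (i, 0) + (v ∘ block i) 2,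
        0, 0] := by
    intro s ⟨h1, h2, hs3, hs4⟩
    conv_lhs => rw [← setBlock_self i (s + v)]
    congr 1
    funext k
    fin_cases k
    · rfl
    · change s (i, 1) + _ = _; rw [← h1]; rfl
    · change s (i, 2) + _ = _; rw [← h2, ← h1]; rfl
    · change s (i, 3) + v (i, 3) = _; rw [hs3, h3]; rfl
    · change s (i, 4) + v (i, 4) = _; rw [hs4, h4]; rfl
  have e' : ∀ s : FTVar → Fin 2, CodeState i s → s + correctFlips i v = setBlock i (s + v)
      ![s (i, 0) + maj (v ∘ block i), s (i, 0) + maj (v ∘ block i),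
        s (i, 0) + maj (v ∘ block i), 0, 0] := by
    intro s ⟨h1, h2, hs3, hs4⟩
    funext ⟨j, k⟩
    by_cases hj : j = i
    · subst hj
      rw [Pi.add_apply, correctFlips, setBlock_apply, setBlock_apply]
      fin_cases k
      · rfl
      · change s (j, 1) + _ = _; rw [← h1]; rfl
      · change s (j, 2) + _ = _; rw [← h2, ← h1]; rfl
      · change s (j, 3) + _ = _; rw [hs3]; rfl
      · change s (j, 4) + _ = _; rw [hs4]; rfl
    · simp [setBlock, correctFlips, hj]
  have bs := correctBits_flip (s (i, 0)) (v ∘ block i)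
  have bt := correctBits_flip (t (i, 0)) (v ∘ block i)
  rw [sandwich_outer, sandwich_outer, flipOp_mulVec_ket, flipOp_mulVec_ket, flipOp_mulVec_ket,
    flipOp_mulVec_ket, e s hs, e t ht, e' s hs, e' t ht, denote_correct_outer_ket, bs.1, bs.2.1,
    bs.2.2, bt.1, bt.2.1, bt.2.2, if_pos ⟨rfl, rfl⟩]

/-! ### Majorities of independent flips -/

/-- The majority of three independent flips is a flip with probability `logicalErr p`. -/
theorem sum_flipWeight_maj_eq (p : ℝ) (b : Fin 2) :
    ∑ e : Fin 3 → Fin 2, (if maj e = b then flipWeight p e else 0) =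
      if b = 1 then logicalErr p else 1 - logicalErr p := by
  have h : (Finset.univ : Finset (Fin 3 → Fin 2)) = {![0, 0, 0], ![0, 0, 1], ![0, 1, 0],
      ![0, 1, 1], ![1, 0, 0], ![1, 0, 1], ![1, 1, 0], ![1, 1, 1]} := by decide
  rw [h]
  repeat rw [Finset.sum_insert (by decide)]
  rw [Finset.sum_singleton]
  fin_cases b <;> simp [maj, flipWeight, Fin.prod_univ_three, logicalErr] <;> ring

theorem logicalErr_mem (p : unitInterval) : logicalErr p ∈ Set.Icc (0 : ℝ) 1 := by
  have h := sum_flipWeight_maj_eq p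
  have h0 : ∀ b : Fin 2, (0 : ℝ) ≤ ∑ e : Fin 3 → Fin 2,
      (if maj e = b then flipWeight (p : ℝ) e else 0) := fun b =>
    Finset.sum_nonneg fun e _ => by
      split_ifs
      · exact flipWeight_nonneg p.2.1 p.2.2 e
      · exact le_rfl
  have h1 := h0 1
  have h2 := h0 0
  rw [h, if_pos rfl] at h1
  rw [h, if_neg (by decide)] at h2
  exact ⟨h1, by linarith⟩

theorem logicalErr_zero : logicalErr 0 = 0 := by simp [logicalErr]

theorem sum_flipWeight_smul_maj {E : Type} [AddCommGroup E] [Module ℂ E] (p : ℝ)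
    (G : Fin 2 → E) : ∑ e : Fin 3 → Fin 2, (flipWeight p e : ℂ) • G (maj e) =
      ∑ b : Fin 2, ((if b = 1 then logicalErr p else 1 - logicalErr p : ℝ) : ℂ) • G b := by
  have h : ∀ e : Fin 3 → Fin 2, (flipWeight p e : ℂ) • G (maj e) =
      ∑ b, ((if maj e = b then flipWeight p e else 0 : ℝ) : ℂ) • G b := by
    intro e
    rw [Finset.sum_eq_single (maj e) (fun b _ hb => by rw [if_neg hb.symm]; simp) (by simp),
      if_pos rfl]
  simp only [h]
  rw [Finset.sum_comm]
  refine Finset.sum_congr rfl fun b _ => ?_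
  rw [← Finset.sum_smul, ← Complex.ofReal_sum, sum_flipWeight_maj_eq]

theorem sum_flipWeight_smul_maj_blocks {κ E : Type} [Fintype κ] [DecidableEq κ] [AddCommGroup E]
    [Module ℂ E] (p : ℝ) (G : (κ → Fin 2) → E) :
    ∑ e : κ × Fin 3 → Fin 2, (flipWeight p e : ℂ) • G (fun i => maj fun j => e (i, j)) =
      ∑ b : κ → Fin 2, (flipWeight (logicalErr p) b : ℂ) • G b := by
  rw [← (Equiv.curry κ (Fin 3) (Fin 2)).symm.sum_comp]
  have h : ∀ x : κ → Fin 3 → Fin 2, (flipWeight p ((Equiv.curry κ (Fin 3) (Fin 2)).symm x) : ℂ) •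
      G (fun i => maj fun j => (Equiv.curry κ (Fin 3) (Fin 2)).symm x (i, j)) =
      ∑ b, ((∏ i, if maj (x i) = b i then flipWeight p (x i) else 0 : ℝ) : ℂ) • G b := by
    intro x
    rw [Finset.sum_eq_single (fun i => maj (x i))]
    · congr 2
      rw [flipWeight, Fintype.prod_prod_type]
      exact Finset.prod_congr rfl fun i _ => (if_pos rfl).symm
    · intro b _ hb
      obtain ⟨i, hi⟩ := Function.ne_iff.1 hb
      rw [Finset.prod_eq_zero (Finset.mem_univ i) (if_neg hi.symm), Complex.ofReal_zero, zero_smul]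
    · simp
  simp only [h]
  rw [Finset.sum_comm]
  refine Finset.sum_congr rfl fun b _ => ?_
  rw [← Finset.sum_smul, ← Complex.ofReal_sum, ← Fintype.piFinset_univ,
    ← Finset.prod_univ_sum (fun _ => Finset.univ)
      (fun i (y : Fin 3 → Fin 2) => if maj y = b i then flipWeight p y else 0)]
  simp only [sum_flipWeight_maj_eq]
  rfl

/-! ### Relabelling basis states -/

section Relabel

/-- The linear map `|x⟩ ↦ |f x⟩`. -/
def relabel {m n : Type} [DecidableEq n] (f : m → n) : Matrix n m ℂ :=
  Matrix.of fun s x => if s = f x then 1 else 0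

variable {m n : Type} [DecidableEq n]

theorem mul_relabel_apply {l : Type} [Fintype n] (A : Matrix l n ℂ) (f : m → n) (y : l) (x : m) :
    (A * relabel f) y x = A y (f x) := by
  simp [relabel, Matrix.mul_apply]

theorem relabel_isometry [DecidableEq m] [Fintype n] {f : m → n} (hf : Function.Injective f) :
    (relabel f).conjTranspose * relabel f = 1 := by
  ext x y
  rw [mul_relabel_apply, Matrix.conjTranspose_apply, Matrix.one_apply, relabel, Matrix.of_apply]
  simp [hf.eq_iff, eq_comm, apply_ite]

variable [Fintype m]

theorem relabel_mulVec_ket [DecidableEq m] (f : m → n) (x : m) :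
    (relabel f).mulVec (ket x) = ket (f x) := by
  rw [mulVec_ket]
  funext s
  simp [relabel, ket, Pi.single_apply]

/-- The operator `∑ ρ x y |f x⟩⟨f y|`. -/
def transport (f : m → n) (ρ : Matrix m m ℂ) : Matrix n n ℂ :=
  relabel f * ρ * (relabel f).conjTranspose

theorem transport_smul (f : m → n) (z : ℂ) (ρ : Matrix m m ℂ) :
    transport f (z • ρ) = z • transport f ρ := by
  simp only [transport, Matrix.mul_smul, Matrix.smul_mul]

theorem transport_sum {β : Type} [Fintype β] (f : m → n) (ρ : β → Matrix m m ℂ) :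
    transport f (∑ b, ρ b) = ∑ b, transport f (ρ b) := by
  simp only [transport, Matrix.mul_sum, Matrix.sum_mul]

theorem transport_outer_ket [DecidableEq m] (f : m → n) (x y : m) :
    transport f (outer (ket x) (ket y)) = outer (ket (f x)) (ket (f y)) := by
  rw [transport, outer, outer, Matrix.mul_vecMulVec, Matrix.vecMulVec_mul, ← Matrix.star_mulVec,
    relabel_mulVec_ket, relabel_mulVec_ket]

theorem posSemidef_transport [Fintype n] (f : m → n) {ρ : Matrix m m ℂ} (h : ρ.PosSemidef) :
    (transport f ρ).PosSemidef := h.mul_mul_conjTranspose_same _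

theorem trace_transport [DecidableEq m] [Fintype n] {f : m → n} (hf : Function.Injective f)
    (ρ : Matrix m m ℂ) :
    (transport f ρ).trace = ρ.trace := by
  rw [transport, Matrix.trace_mul_comm, ← Matrix.mul_assoc, relabel_isometry hf, Matrix.one_mul]

theorem sandwich_transport [Fintype n] {f : m → n} {A : Matrix n n ℂ} {B : Matrix m m ℂ}
    (h : A * relabel f = relabel f * B) (ρ : Matrix m m ℂ) :
    sandwich A (transport f ρ) = transport f (sandwich B ρ) := by
  have h' : (relabel f).conjTranspose * A.conjTranspose =
      B.conjTranspose * (relabel f).conjTranspose := by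
    rw [← Matrix.conjTranspose_mul, h, Matrix.conjTranspose_mul]
  calc sandwich A (transport f ρ)
      = (A * relabel f) * ρ * ((relabel f).conjTranspose * A.conjTranspose) := by
        simp only [sandwich, transport, Matrix.mul_assoc]
    _ = transport f (sandwich B ρ) := by
        rw [h, h']; simp only [sandwich, transport, Matrix.mul_assoc]

/-- If `A` acts as `B` on the relabelled states, it maps their span into itself. -/
theorem exists_eq_of_apply_ne_zero [Fintype n] {f : m → n} {A : Matrix n n ℂ} {B : Matrix m m ℂ}
    (h : A * relabel f = relabel f * B) {y : n} {x : m} (hA : A y (f x) ≠ 0) : ∃ z, y = f z := by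
  rw [← mul_relabel_apply A f y x, h, Matrix.mul_apply] at hA
  obtain ⟨z, -, hz⟩ := Finset.exists_ne_zero_of_sum_ne_zero hA
  exact ⟨z, by_contra fun hne => hz (by simp [relabel, hne])⟩

/-- An operator on a register inherits an encoded action, if the encoding of the whole system is
compatible with the encoding of the register. -/
theorem embed_mul_relabel {ι κ Var Var' : Type} [Fintype ι] [DecidableEq ι] [Fintype κ]
    [DecidableEq κ] [Fintype Var] [DecidableEq Var] [Fintype Var'] [DecidableEq Var'] (r : ι ↪ Var)
    (r' : κ ↪ Var') {f : (κ → Fin 2) → ι → Fin 2} {F : (Var' → Fin 2) → Var → Fin 2} {A : Op ι}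
    {B : Op κ} (h : A * relabel f = relabel f * B) (hF : ∀ t, F t ∘ r = f (t ∘ r'))
    (hF' : ∀ t x, F (Function.extend r' x t) = Function.extend r (f x) (F t)) :
    embed r A * relabel F = relabel F * embed r' B := by
  refine ext_mulVec_ket fun t => ?_
  rw [← Matrix.mulVec_mulVec, ← Matrix.mulVec_mulVec, relabel_mulVec_ket, embed_mulVec_ket,
    embed_mulVec_ket, hF]
  have e : ∀ x, A x (f (t ∘ r')) = ∑ a, if x = f a then B a (t ∘ r') else 0 := by
    intro x
    rw [← mul_relabel_apply A f x, h, Matrix.mul_apply]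
    simp [relabel]
  simp only [e, Finset.sum_smul, Matrix.mulVec_sum, Matrix.mulVec_smul, relabel_mulVec_ket, hF']
  rw [Finset.sum_comm]
  refine Finset.sum_congr rfl fun a _ => ?_
  rw [Finset.sum_eq_single (f a) (fun x _ hx => by rw [if_neg hx, zero_smul]) (by simp),
    if_pos rfl]

end Relabel

/-! ### The repetition code -/

/-- The codeword of the repetition code for a bit, indexed by a one-qubit register. -/
def repeat₃ (z : Fin 1 → Fin 2) : Fin 3 → Fin 2 := fun _ => z 0

/-- The codewords of two bits. -/
def repeat₆ (x : Fin 2 → Fin 2) : Fin 2 × Fin 3 → Fin 2 := fun ij => x ij.1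

theorem mul_relabel_repeat₃ {A : Matrix (Fin 3 → Fin 2) (Fin 3 → Fin 2) ℂ}
    {B : Matrix (Fin 2) (Fin 2) ℂ}
    (h : A * encIso = encIso * B) :
    A * relabel repeat₃ = relabel repeat₃ * tens fun _ => B := by
  ext y z
  have e : ∀ (y : Fin 3 → Fin 2) (a : Fin 2), encIso y a = if y = fun _ => a then 1 else 0 :=
    fun y a => if_congr funext_iff.symm rfl rfl
  have h1 := congrFun (congrFun h y) (z 0)
  simp only [Matrix.mul_apply, e, mul_ite, mul_one, mul_zero, Finset.sum_ite_eq', Finset.mem_univ,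
    if_true, ite_mul, one_mul, zero_mul] at h1
  rw [mul_relabel_apply]
  refine Eq.trans ?_ (h1.trans ?_)
  · rfl
  · refine Eq.trans ?_ (Matrix.mul_apply (M := relabel repeat₃)).symm
    rw [← (Equiv.funUnique (Fin 1) (Fin 2)).symm.sum_comp]
    refine Finset.sum_congr rfl fun a _ => ?_
    simp only [relabel, tens, Matrix.of_apply, Fintype.prod_unique, ite_mul, one_mul, zero_mul]
    rfl

theorem encIso₂_eq : encIso₂ = relabel repeat₆ := by
  ext s x
  refine if_congr ⟨fun h => ?_, fun h => ?_⟩ rfl rfl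
  · funext ij
    exact h ij.1 ij.2
  · intro i j
    rw [h]
    rfl

/-- The basis state that encodes the bits `x`, with clean syndrome qubits. -/
def encBits (x : Fin 2 → Fin 2) : FTVar → Fin 2 := fun v => if v.2 < 3 then x v.1 else 0

/-- The basis state that stores the bits `x` in the logical qubits. -/
def liftBits (x : Fin 2 → Fin 2) : FTVar → Fin 2 := fun v => if v.2 = 0 then x v.1 else 0

theorem liftBits_injective : Function.Injective liftBits := fun x y h =>
  funext fun i => by simpa [liftBits] using congrFun h (i, 0)

theorem block_apply (i : Fin 2) (j : Fin 3) :
    block i j = (i, Fin.castLE (by decide : 3 ≤ 5) j) := rfl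

theorem encBits_comp_block (i : Fin 2) (x : Fin 2 → Fin 2) :
    encBits x ∘ block i = repeat₃ (x ∘ single i) := by
  funext j
  exact if_pos j.2

theorem encBits_comp_blocks (x : Fin 2 → Fin 2) : encBits x ∘ blocks = repeat₆ x := by
  funext ⟨i, j⟩
  exact congrFun (encBits_comp_block i x) j

theorem eq_block_of_lt (i : Fin 2) {k : Fin 5} (hk : k < 3) : ∃ j, block i j = (i, k) :=
  ⟨⟨k, hk⟩, rfl⟩

theorem encBits_mul_block {i : Fin 2} {A : Matrix (Fin 3 → Fin 2) (Fin 3 → Fin 2) ℂ}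
    {B : Matrix (Fin 2) (Fin 2) ℂ}
    (h : A * encIso = encIso * B) :
    embed (block i) A * relabel encBits = relabel encBits * embed (single i) (tens fun _ => B) := by
  refine embed_mul_relabel _ _ (mul_relabel_repeat₃ h) (encBits_comp_block i) fun t z => ?_
  have e : repeat₃ z = encBits (Function.extend (single i) z t) ∘ block i := by
    rw [encBits_comp_block, extend_comp_self]
  rw [e]
  refine eq_extend_of_agree _ fun ⟨a, k⟩ hv => ?_
  by_cases hk : k < 3
  · have ha : a ≠ i := by
      rintro rfl
      obtain ⟨j, hj⟩ := eq_block_of_lt a hk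
      exact hv j hj
    simp only [encBits, hk, if_true]
    rw [extend_single, Function.update_of_ne ha]
  · simp only [encBits, hk, if_false]

theorem encBits_mul_blocks
    {A : Matrix (Fin 2 × Fin 3 → Fin 2) (Fin 2 × Fin 3 → Fin 2) ℂ}
    {B : Matrix (Fin 2 → Fin 2) (Fin 2 → Fin 2) ℂ}
    (h : A * encIso₂ = encIso₂ * B) :
    embed blocks A * relabel encBits = relabel encBits * B := by
  rw [encIso₂_eq] at h
  rw [← embed_pair_zero_one (by decide) B]
  have e : ∀ s : Fin 2 → Fin 2, s ∘ pair 0 1 (by decide) = s := fun s => by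
    funext i; fin_cases i <;> rfl
  refine embed_mul_relabel _ _ h (fun t => by rw [encBits_comp_blocks, e]) fun t x => ?_
  have e' : Function.extend (pair (0 : Fin 2) 1 (by decide)) x t = x := by
    rw [← e (Function.extend _ x t), extend_comp_self]
  rw [e', ← encBits_comp_blocks]
  refine eq_extend_of_agree _ fun ⟨a, k⟩ hv => ?_
  by_cases hk : k < 3
  · obtain ⟨j, hj⟩ := eq_block_of_lt a hk
    exact absurd hj (hv (a, j))
  · simp only [encBits, hk, if_false]

/-- An operator that acts on codewords preserves the code space of its block. -/
theorem codeState_of_embed_block {i : Fin 2} {A : Matrix (Fin 3 → Fin 2) (Fin 3 → Fin 2) ℂ}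
    {B : Matrix (Fin 2) (Fin 2) ℂ}
    (h : A * encIso = encIso * B) (s t : FTVar → Fin 2) (ht : CodeState i t)
    (hA : embed (block i) A s t ≠ 0) : CodeState i s := by
  have hag : ∀ v, (∀ j, block i j ≠ v) → s v = t v := by
    by_contra hn
    exact hA (if_neg hn)
  rw [embed_apply_of_agree _ _ hag] at hA
  have ht' : t ∘ block i = repeat₃ fun _ => t (i, 0) := by
    funext j
    fin_cases j
    · rfl
    · exact ht.1.symm
    · exact ht.2.1.symm.trans ht.1.symm
  rw [ht'] at hA
  obtain ⟨z, hz⟩ := exists_eq_of_apply_ne_zero (mul_relabel_repeat₃ h) hA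
  have h34 : ∀ k : Fin 5, ¬ k < 3 → ∀ j, block i j ≠ (i, k) := by
    intro k hk j e
    rw [block_apply, Prod.mk.injEq] at e
    exact hk (by rw [← e.2]; exact j.2)
  refine ⟨?_, ?_, ?_, ?_⟩
  · exact (congrFun hz 0).trans (congrFun hz 1).symm
  · exact (congrFun hz 1).trans (congrFun hz 2).symm
  · rw [hag _ (h34 3 (by decide))]; exact ht.2.2.1
  · rw [hag _ (h34 4 (by decide))]; exact ht.2.2.2

theorem codeState_of_embed_blocks
    {A : Matrix (Fin 2 × Fin 3 → Fin 2) (Fin 2 × Fin 3 → Fin 2) ℂ}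
    {B : Matrix (Fin 2 → Fin 2) (Fin 2 → Fin 2) ℂ}
    (h : A * encIso₂ = encIso₂ * B) (s t : FTVar → Fin 2) (ht : CodeState 0 t ∧ CodeState 1 t)
    (hA : embed blocks A s t ≠ 0) : CodeState 0 s ∧ CodeState 1 s := by
  -- the code space of both blocks is spanned by the encoded basis states
  have hc : ∀ u : FTVar → Fin 2, CodeState 0 u ∧ CodeState 1 u ↔ ∃ x, u = encBits x := by
    intro u
    constructor
    · rintro ⟨⟨h1, h2, h3, h4⟩, h5, h6, h7, h8⟩
      refine ⟨fun i => u (i, 0), ?_⟩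
      funext ⟨i, k⟩
      fin_cases i <;> fin_cases k <;> simp [encBits, *]
    · rintro ⟨x, rfl⟩
      constructor <;> exact ⟨rfl, rfl, rfl, rfl⟩
  rw [hc] at ht ⊢
  obtain ⟨x, rfl⟩ := ht
  exact exists_eq_of_apply_ne_zero (encBits_mul_blocks h) hA

/-- The adjoint of an encoded gate is an encoded version of the adjoint. -/
theorem conjTranspose_mul_of_unitary {m n : Type} [Fintype m] [DecidableEq m] [Fintype n]
    [DecidableEq n] {W : Matrix n m ℂ} (A : Matrix.unitaryGroup n ℂ) (B : Matrix.unitaryGroup m ℂ)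
    (h : A.1 * W = W * B.1) : A.1.conjTranspose * W = W * B.1.conjTranspose := by
  have hB : B.1 * B.1.conjTranspose = 1 := Matrix.mem_unitaryGroup_iff.1 B.2
  calc A.1.conjTranspose * W = A.1.conjTranspose * (W * (B.1 * B.1.conjTranspose)) := by
        rw [hB, Matrix.mul_one]
    _ = (A.1.conjTranspose * A.1) * W * B.1.conjTranspose := by
        rw [← Matrix.mul_assoc W, ← h]; simp only [Matrix.mul_assoc]
    _ = _ := by rw [unitary_isometry, Matrix.one_mul]

/-! ### Corrected encoded gates -/

theorem extend_apply_syndrome_block (i : Fin 2) (e : Fin 3 → Fin 2) {k : Fin 5} (hk : ¬ k < 3)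
    (i' : Fin 2) : Function.extend (block i) e 0 (i', k) = 0 :=
  extend_of_ne _ fun j h => hk (by
    rw [block_apply, Prod.mk.injEq] at h; rw [← h.2]; exact j.2)

theorem extend_apply_syndrome_blocks (e : Fin 2 × Fin 3 → Fin 2) {k : Fin 5} (hk : ¬ k < 3)
    (i' : Fin 2) : Function.extend blocks e 0 (i', k) = 0 :=
  extend_of_ne _ fun j h => hk (by
    rw [show blocks j = (j.1, Fin.castLE (by decide : 3 ≤ 5) j.2) from rfl, Prod.mk.injEq] at h
    rw [← h.2]; exact j.2.2)

theorem correctFlips_self (i : Fin 2) (v : FTVar → Fin 2) (k : Fin 5) :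
    correctFlips i v (i, k) = if k < 3 then maj (v ∘ block i) else 0 := by
  rw [correctFlips, setBlock_apply]
  fin_cases k <;> rfl

theorem correctFlips_of_ne {i j : Fin 2} (h : j ≠ i) (v : FTVar → Fin 2) (k : Fin 5) :
    correctFlips i v (j, k) = v (j, k) := if_neg h

theorem correctFlips_extend_block (i : Fin 2) (e : Fin 3 → Fin 2) :
    correctFlips i (Function.extend (block i) e 0) =
      Function.extend (block i) (fun _ => maj e) 0 := by
  funext ⟨j, k⟩
  by_cases hj : j = i
  · subst hj
    rw [correctFlips_self, extend_comp_self]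
    split_ifs with hk
    · obtain ⟨l, hl⟩ := eq_block_of_lt j hk
      rw [← hl, (block j).injective.extend_apply]
    · rw [extend_apply_syndrome_block j _ hk]
  · rw [correctFlips_of_ne hj, extend_of_ne, extend_of_ne] <;>
      exact fun l h => hj (Prod.ext_iff.1 h).1.symm

theorem correctFlips_extend_blocks (e : Fin 2 × Fin 3 → Fin 2) :
    correctFlips 1 (correctFlips 0 (Function.extend blocks e 0)) =
      Function.extend blocks (fun ij => maj fun j => e (ij.1, j)) 0 := by
  have h0 : ∀ i, Function.extend blocks e 0 ∘ block i = fun j => e (i, j) := fun i =>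
    funext fun j => blocks.injective.extend_apply e 0 (i, j)
  have h1 : correctFlips 0 (Function.extend blocks e 0) ∘ block 1 = fun j => e (1, j) := by
    rw [← h0]
    exact funext fun j => correctFlips_of_ne (by decide) _ _
  have h2 : ∀ (i : Fin 2) (k : Fin 5),
      Function.extend blocks (fun ij => maj fun j => e (ij.1, j)) 0 (i, k) =
        if k < 3 then maj fun j => e (i, j) else 0 := by
    intro i k
    split_ifs with hk
    · obtain ⟨l, hl⟩ := eq_block_of_lt i hk
      rw [← hl]
      exact blocks.injective.extend_apply _ 0 (i, l)
    · rw [extend_apply_syndrome_blocks _ hk]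
  funext ⟨i, k⟩
  rw [h2]
  fin_cases i
  · refine (correctFlips_of_ne (by decide) _ _).trans ?_
    refine (correctFlips_self 0 _ k).trans ?_
    rw [h0]
    rfl
  · refine (correctFlips_self 1 _ k).trans ?_
    rw [h1]
    rfl

/-- The encoded gate preserves the code space, so that the flips after it hit a code state, and
correction replaces them by their majority. -/
theorem denote_correctedV (pV : unitInterval) {V' : Matrix.unitaryGroup (Fin 3 → Fin 2) ℂ}
    {V : Matrix.unitaryGroup (Fin 2) ℂ} (hV : Encodes V' V) (i : Fin 2) {ρ : Op FTVar}
    (hρ : SupportedOn (CodeState i) ρ) :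
    (correctedV pV V' i).denote ρ =
      ∑ b : Fin 2, ((if b = 1 then logicalErr pV else 1 - logicalErr pV : ℝ) : ℂ) •
        sandwich (embed (block i) (flipOp (fun _ : Fin 3 => b) * V'.1)) ρ := by
  rw [correctedV, denote_seq, denote_flipNoisy, (isChannel_correct i).map_sum,
    ← sum_flipWeight_smul_maj pV fun b =>
      sandwich (embed (block i) (flipOp (fun _ : Fin 3 => b) * V'.1)) ρ]
  refine Finset.sum_congr rfl fun e _ => ?_
  rw [(isChannel_correct i).map_smul, embed_mul, embed_mul, sandwich_mul, sandwich_mul,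
    embed_flipOp, embed_flipOp,
    denote_correct_flip i (extend_apply_syndrome_block i e (by decide) i)
      (extend_apply_syndrome_block i e (by decide) i)
      (hρ.sandwich (codeState_of_embed_block hV)), correctFlips_extend_block]

/-- The two blocks are corrected one after the other: the flips in the other block are kept. -/
theorem denote_correctedU (pU : unitInterval)
    {U' : Matrix.unitaryGroup (Fin 2 × Fin 3 → Fin 2) ℂ}
    {U : Matrix.unitaryGroup (Fin 2 → Fin 2) ℂ} (hU : Encodes₂ U' U) {ρ : Op FTVar}
    (hρ : SupportedOn (fun s => CodeState 0 s ∧ CodeState 1 s) ρ) :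
    (correctedU pU U').denote ρ =
      ∑ b : Fin 2 → Fin 2, (flipProb (logicalErr pU) b : ℂ) •
        sandwich (embed blocks (blockX b * U'.1)) ρ := by
  have hc := (isChannel_correct 1).comp (isChannel_correct 0)
  have hρ' := hρ.sandwich (codeState_of_embed_blocks hU)
  change (correct 1).denote ((correct 0).denote ((flipNoisy pU blocks U').denote ρ)) = _
  rw [denote_flipNoisy, hc.map_sum]
  refine Eq.trans ?_ (sum_flipWeight_smul_maj_blocks pU fun b : Fin 2 → Fin 2 =>
    sandwich (embed blocks (blockX b * U'.1)) ρ)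
  refine Finset.sum_congr rfl fun e _ => ?_
  have hb : ∀ b, blockX b = flipOp fun ij : Fin 2 × Fin 3 => b ij.1 := fun _ => rfl
  rw [hc.map_smul, hb, embed_mul, embed_mul, sandwich_mul, sandwich_mul, embed_flipOp, embed_flipOp,
    denote_correct_flip 0 (extend_apply_syndrome_blocks e (by decide) 0)
      (extend_apply_syndrome_blocks e (by decide) 0) (hρ'.mono fun s h => h.1),
    denote_correct_flip 1
      ((correctFlips_of_ne (by decide) _ _).trans
        (extend_apply_syndrome_blocks e (by decide) 1))
      ((correctFlips_of_ne (by decide) _ _).trans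
        (extend_apply_syndrome_blocks e (by decide) 1)) (hρ'.mono fun s h => h.2),
    correctFlips_extend_blocks]

/-! ### Distances of the corrected gates -/

theorem flipOp_mul_isometry {ι : Type} [Fintype ι] [DecidableEq ι] (e : ι → Fin 2)
    (U : Matrix.unitaryGroup (ι → Fin 2) ℂ) :
    (flipOp e * U.1).conjTranspose * (flipOp e * U.1) = 1 := by
  rw [Matrix.conjTranspose_mul, Matrix.mul_assoc, ← Matrix.mul_assoc (flipOp e).conjTranspose,
    flipOp_isometry, Matrix.one_mul, unitary_isometry]

/-- The preimage `U† |0…0⟩` is sent to the basis state of the flip pattern. -/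
theorem flipOp_mul_mulVec {ι : Type} [Fintype ι] [DecidableEq ι] (e : ι → Fin 2)
    (U : Matrix.unitaryGroup (ι → Fin 2) ℂ) :
    (flipOp e * U.1).mulVec (U.1.conjTranspose.mulVec (ket 0)) = ket e := by
  have hU : U.1 * U.1.conjTranspose = 1 := Matrix.mem_unitaryGroup_iff.1 U.2
  rw [Matrix.mulVec_mulVec, Matrix.mul_assoc, hU, Matrix.mul_one, flipOp_mulVec_ket, zero_add]

/-- The distance between a gate that suffers flip patterns `e b` with probabilities `w b` and the
gate itself. -/
theorem diamond_flips {ι β : Type} [Fintype ι] [DecidableEq ι] [Fintype β] [DecidableEq β]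
    {w : β → ℝ} (hw : ∀ b, 0 ≤ w b) (hw1 : ∑ b, w b = 1) {e : β → ι → Fin 2}
    (he : Function.Injective e) {b₀ : β} (h0 : e b₀ = 0)
    (U : Matrix.unitaryGroup (ι → Fin 2) ℂ) :
    diamond (fun ρ => ∑ b, (w b : ℂ) • sandwich (flipOp (e b) * U.1) ρ) (sandwich U.1) =
      ENNReal.ofReal (1 - w b₀) := by
  rw [diamond_eq_qDiamond]
  exact qDiamond_mixture (fun _ => True) hw hw1 (fun b => flipOp_mul_isometry (e b) U) b₀
    (fun ρ _ => rfl) (fun ρ _ => by rw [h0, flipOp_zero, Matrix.one_mul])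
    (ψ := U.1.conjTranspose.mulVec (ket 0)) (fun _ _ => trivial) he
    fun b => flipOp_mul_mulVec (e b) U

/-- The same distance for programs that act on a register and start from certain states. -/
theorem qDiamond_flips {ι β Var : Type} [Fintype ι] [DecidableEq ι] [Fintype β] [DecidableEq β]
    [Fintype Var] [DecidableEq Var] (r : ι ↪ Var) (S : (Var → Fin 2) → Prop) [DecidablePred S]
    {w : β → ℝ} (hw : ∀ b, 0 ≤ w b) (hw1 : ∑ b, w b = 1) {e : β → ι → Fin 2}
    (he : Function.Injective e) {b₀ : β} (h0 : e b₀ = 0)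
    (U : Matrix.unitaryGroup (ι → Fin 2) ℂ)
    (hS : ∀ s, embed r U.1.conjTranspose s 0 ≠ 0 → S s) {E E' : Op Var → Op Var}
    (hE : ∀ ρ, SupportedOn S ρ →
      E ρ = ∑ b, (w b : ℂ) • sandwich (embed r (flipOp (e b) * U.1)) ρ)
    (hE' : ∀ ρ, SupportedOn S ρ → E' ρ = sandwich (embed r U.1) ρ) :
    qDiamond (Matrix.diagonal fun s => if S s then 1 else 0) 1 E E' =
      ENNReal.ofReal (1 - w b₀) := by
  have hU : U.1 * U.1.conjTranspose = 1 := Matrix.mem_unitaryGroup_iff.1 U.2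
  refine qDiamond_mixture S hw hw1 (A := fun b => embed r (flipOp (e b) * U.1))
    (fun b => embed_isometry r (flipOp_mul_isometry (e b) U)) b₀ hE
    (fun ρ hρ => by rw [hE' ρ hρ, h0, flipOp_zero, Matrix.one_mul])
    (ψ := (embed r U.1.conjTranspose).mulVec (ket 0)) (fun s hs => hS s ?_)
    (f := fun b => Function.extend r (e b) 0)
    (fun b b' h => he (Function.extend_injective r.injective 0 h)) fun b => ?_
  · rwa [mulVec_ket] at hs
  · rw [Matrix.mulVec_mulVec, ← embed_mul, Matrix.mul_assoc, hU, Matrix.mul_one, embed_flipOp,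
      flipOp_mulVec_ket, zero_add]

theorem codeState_zero (i : Fin 2) : CodeState i 0 := ⟨rfl, rfl, rfl, rfl⟩

theorem denote_ideal_correctedV (pV : unitInterval) (V' : Matrix.unitaryGroup (Fin 3 → Fin 2) ℂ)
    (i : Fin 2) : (correctedV pV V' i).ideal.denote = (correctedV 0 V' i).denote :=
  denote_seq_congr (denote_ideal_flipNoisy _ _ _) rfl

theorem denote_ideal_correctedU (pU : unitInterval)
    (U' : Matrix.unitaryGroup (Fin 2 × Fin 3 → Fin 2) ℂ) :
    (correctedU pU U').ideal.denote = (correctedU 0 U').denote :=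
  denote_seq_congr (denote_ideal_flipNoisy _ _ _) rfl

/-- The logical error probability as an error rate. -/
def logicalRate (p : unitInterval) : unitInterval := ⟨logicalErr p, logicalErr_mem p⟩

theorem logicalRate_zero : logicalRate 0 = 0 := Subtype.ext logicalErr_zero

theorem flip_nonneg (p : unitInterval) (b : Fin 2) :
    0 ≤ if b = 1 then logicalErr p else 1 - logicalErr p := by
  split_ifs
  · exact (logicalErr_mem p).1
  · exact sub_nonneg.2 (logicalErr_mem p).2

theorem sum_flip (p : ℝ) : ∑ b : Fin 2, (if b = 1 then logicalErr p else 1 - logicalErr p) = 1 := by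
  simp [Fin.sum_univ_two]

theorem const_injective : Function.Injective fun (b : Fin 2) (_ : Fin 3) => b :=
  fun _ _ h => congrFun h 0

theorem blockFlips_injective :
    Function.Injective fun (b : Fin 2 → Fin 2) (ij : Fin 2 × Fin 3) => b ij.1 :=
  fun _ _ h => funext fun i => congrFun h (i, 0)

theorem flipProb_zero (q : ℝ) : 1 - flipProb q 0 = 2 * q - q ^ 2 := by
  simp only [flipProb, Pi.zero_apply, zero_ne_one, if_false, Fin.prod_univ_two]
  ring

theorem one_sub_flip (q : ℝ) : 1 - (if (0 : Fin 2) = 1 then q else 1 - q) = q := by simp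

theorem diamond_V (pV : unitInterval) (V' : Matrix.unitaryGroup (Fin 3 → Fin 2) ℂ) :
    diamond (fun ρ => ∑ b : Fin 2, ((if b = 1 then logicalErr pV else 1 - logicalErr pV : ℝ) : ℂ) •
        sandwich (flipOp (fun _ : Fin 3 => b) * V'.1) ρ) (sandwich V'.1) =
      ENNReal.ofReal (logicalErr pV) := by
  rw [diamond_flips (flip_nonneg pV) (sum_flip pV) const_injective (b₀ := 0) rfl V', one_sub_flip]

theorem diamond_U (pU : unitInterval) (U' : Matrix.unitaryGroup (Fin 2 × Fin 3 → Fin 2) ℂ) :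
    diamond (fun ρ => ∑ b, ((flipProb (logicalErr pU) b : ℝ) : ℂ) • sandwich (blockX b * U'.1) ρ)
        (sandwich U'.1) = ENNReal.ofReal (2 * logicalErr pU - logicalErr pU ^ 2) := by
  rw [← flipProb_zero]
  exact diamond_flips (flipWeight_nonneg (logicalErr_mem pU).1 (logicalErr_mem pU).2)
    (sum_flipWeight _) blockFlips_injective (b₀ := 0) rfl U'

theorem qDiamond_correctedV (pV : unitInterval) {V' : Matrix.unitaryGroup (Fin 3 → Fin 2) ℂ}
    {V : Matrix.unitaryGroup (Fin 2) ℂ} (hV : Encodes V' V) (i : Fin 2) :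
    qDiamond (codeProj i) 1 (correctedV pV V' i).denote (correctedV pV V' i).ideal.denote =
      ENNReal.ofReal (logicalErr pV) := by
  rw [denote_ideal_correctedV, ← one_sub_flip (logicalErr pV)]
  refine qDiamond_flips (block i) (CodeState i) (flip_nonneg pV) (sum_flip pV) const_injective
    (b₀ := 0) rfl V'
    (fun s hs => codeState_of_embed_block (conjTranspose_mul_of_unitary V' V hV) s 0
      (codeState_zero i) hs) (fun ρ hρ => denote_correctedV pV hV i hρ) fun ρ hρ => ?_
  rw [denote_correctedV 0 hV i hρ, Fin.sum_univ_two, if_neg (by decide), if_pos rfl]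
  change ((1 - logicalErr 0 : ℝ) : ℂ) • sandwich (embed (block i) (flipOp 0 * V'.1)) ρ +
    ((logicalErr 0 : ℝ) : ℂ) • _ = _
  rw [logicalErr_zero, flipOp_zero, Matrix.one_mul]
  simp

theorem qDiamond_correctedU (pU : unitInterval)
    {U' : Matrix.unitaryGroup (Fin 2 × Fin 3 → Fin 2) ℂ}
    {U : Matrix.unitaryGroup (Fin 2 → Fin 2) ℂ} (hU : Encodes₂ U' U) :
    qDiamond (codeProj 0 * codeProj 1) 1 (correctedU pU U').denote (correctedU pU U').ideal.denote =
      ENNReal.ofReal (2 * logicalErr pU - logicalErr pU ^ 2) := by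
  rw [denote_ideal_correctedU, codeProj_mul_codeProj, ← flipProb_zero]
  refine qDiamond_flips blocks (fun s => CodeState 0 s ∧ CodeState 1 s)
    (flipWeight_nonneg (logicalErr_mem pU).1 (logicalErr_mem pU).2) (sum_flipWeight _)
    blockFlips_injective (b₀ := 0) rfl U'
    (fun s hs => codeState_of_embed_blocks (conjTranspose_mul_of_unitary U' U hU) s 0
      ⟨codeState_zero 0, codeState_zero 1⟩ hs)
    (fun ρ hρ => denote_correctedU pU hU hρ) fun ρ hρ => ?_
  rw [denote_correctedU 0 hU hρ, Finset.sum_eq_single 0]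
  · change ((flipWeight (logicalErr 0) 0 : ℝ) : ℂ) • sandwich (embed blocks (flipOp 0 * U'.1)) ρ = _
    rw [logicalErr_zero, flipWeight_zero_left, if_pos rfl, flipOp_zero, Matrix.one_mul,
      Complex.ofReal_one, one_smul]
  · intro b _ hb
    change ((flipWeight (logicalErr 0) b : ℝ) : ℂ) • _ = _
    rw [logicalErr_zero, flipWeight_zero_left, if_neg hb, Complex.ofReal_zero, zero_smul]
  · simp

/-! ### The fault-tolerant factory -/

theorem supportedOn_transport {m n : Type} [Fintype m] [DecidableEq n]
    (f : m → n) (ρ : Matrix m m ℂ) : SupportedOn (fun s => ∃ x, s = f x) (transport f ρ) := by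
  intro s t hst
  by_contra h
  apply hst
  simp only [transport, Matrix.mul_apply, relabel, Matrix.conjTranspose_apply, Matrix.of_apply]
  rcases not_and_or.1 h with h | h <;> push Not at h <;> simp [h]

theorem codeState_encBits (i : Fin 2) (x : Fin 2 → Fin 2) : CodeState i (encBits x) :=
  ⟨rfl, rfl, rfl, rfl⟩

theorem flipOp_mul_encIso (b : Fin 2) :
    flipOp (fun _ : Fin 3 => b) * encIso =
      encIso * (if b = 1 then pauliX else 1 : Matrix (Fin 2) (Fin 2) ℂ) := by
  have e : encIso = relabel fun (a : Fin 2) (_ : Fin 3) => a := by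
    ext y a
    exact if_congr funext_iff.symm rfl rfl
  refine ext_mulVec_ket fun a => ?_
  have h : (if b = 1 then pauliX else 1).mulVec (ket a) = ket (a + b) := by
    rw [mulVec_ket]
    funext s
    fin_cases b <;> fin_cases a <;> fin_cases s <;> simp [pauliX, ket]
  rw [← Matrix.mulVec_mulVec, ← Matrix.mulVec_mulVec, h, e, relabel_mulVec_ket, relabel_mulVec_ket,
    flipOp_mulVec_ket]
  rfl

theorem flipOp_mul_encIso₂ (b : Fin 2 → Fin 2) :
    flipOp (fun ij : Fin 2 × Fin 3 => b ij.1) * encIso₂ = encIso₂ * flipOp b := by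
  rw [encIso₂_eq]
  refine ext_mulVec_ket fun x => ?_
  rw [← Matrix.mulVec_mulVec, ← Matrix.mulVec_mulVec, flipOp_mulVec_ket, relabel_mulVec_ket,
    relabel_mulVec_ket]
  exact flipOp_mulVec_ket (fun ij : Fin 2 × Fin 3 => b ij.1) _

/-- On encoded states, the corrected noisy gate acts as the noisy gate with the logical error
rate. -/
theorem denote_correctedV_transport (pV : unitInterval)
    {V' : Matrix.unitaryGroup (Fin 3 → Fin 2) ℂ} {V : Matrix.unitaryGroup (Fin 2) ℂ}
    (hV : Encodes V' V) (i : Fin 2) (ρ : Op (Fin 2)) :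
    (correctedV pV V' i).denote (transport encBits ρ) =
      transport encBits ((flipNoisy (logicalRate pV) (single i) (gate1 V)).denote ρ) := by
  rw [denote_correctedV pV hV i ((supportedOn_transport _ _).mono (by
    rintro _ ⟨x, rfl⟩; exact codeState_encBits i x)), denote_flipNoisy, transport_sum,
    ← (Equiv.funUnique (Fin 1) (Fin 2)).symm.sum_comp]
  refine Finset.sum_congr rfl fun b _ => ?_
  have h : flipOp (fun _ : Fin 3 => b) * V'.1 * encIso =
      encIso * ((if b = 1 then pauliX else 1 : Matrix (Fin 2) (Fin 2) ℂ) * V.1) := by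
    rw [Matrix.mul_assoc, hV, ← Matrix.mul_assoc, flipOp_mul_encIso, Matrix.mul_assoc]
  have hw : flipWeight (logicalRate pV : ℝ) ((Equiv.funUnique (Fin 1) (Fin 2)).symm b) =
      if b = 1 then logicalErr pV else 1 - logicalErr pV := by
    rw [flipWeight, Fintype.prod_unique]
    rfl
  have hA : flipOp ((Equiv.funUnique (Fin 1) (Fin 2)).symm b) * (gate1 V).1 =
      tens fun _ => (if b = 1 then pauliX else 1) * V.1 :=
    tens_mul (fun _ => if b = 1 then pauliX else 1) fun _ => V.1
  rw [sandwich_transport (encBits_mul_block h), transport_smul, hw, hA]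

theorem denote_correctedU_transport (pU : unitInterval)
    {U' : Matrix.unitaryGroup (Fin 2 × Fin 3 → Fin 2) ℂ}
    {U : Matrix.unitaryGroup (Fin 2 → Fin 2) ℂ} (hU : Encodes₂ U' U) (ρ : Op (Fin 2)) :
    (correctedU pU U').denote (transport encBits ρ) =
      transport encBits ((flipNoisy (logicalRate pU) (pair 0 1 (by decide)) U).denote ρ) := by
  rw [denote_correctedU pU hU ((supportedOn_transport _ _).mono (by
    rintro _ ⟨x, rfl⟩; exact ⟨codeState_encBits 0 x, codeState_encBits 1 x⟩)), denote_flipNoisy,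
    transport_sum]
  refine Finset.sum_congr rfl fun b _ => ?_
  have h : flipOp (fun ij : Fin 2 × Fin 3 => b ij.1) * U'.1 * encIso₂ =
      encIso₂ * (flipOp b * U.1) := by
    rw [Matrix.mul_assoc, hU, ← Matrix.mul_assoc, flipOp_mul_encIso₂, Matrix.mul_assoc]
  change _ • sandwich (embed blocks (flipOp (fun ij : Fin 2 × Fin 3 => b ij.1) * U'.1)) _ = _
  rw [sandwich_transport (encBits_mul_blocks h), transport_smul, embed_pair_zero_one]
  rfl

theorem isChannel_encode (i : Fin 2) : IsChannel (encode i).denote :=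
  (isChannel_init _).seq <| (isChannel_init _).seq <| (isChannel_init _).seq <|
  (isChannel_init _).seq <| (isChannel_cnotAt _ _ _ _).seq (isChannel_cnotAt _ _ _ _)

theorem isChannel_decode (i : Fin 2) : IsChannel (decode i).denote :=
  (isChannel_init _).seq <| (isChannel_init _).seq <|
  (isChannel_cnotAt _ _ _ _).seq (isChannel_cnotAt _ _ _ _)

theorem Resets.cnotAt {Z : Finset FTVar} {E : Op FTVar → Op FTVar} (h : Resets Z E) (i : Fin 2)
    (a b : Fin 5) (hab : a ≠ b) (ha : (i, a) ∈ Z) (hb : (i, b) ∈ Z) :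
    Resets Z fun ρ => (QWhile.cnotAt i a b hab).denote (E ρ) := by
  intro s t
  change (QWhile.cnotAt i a b hab).denote (E _) = _
  have e : ∀ s : FTVar → Fin 2, cnotBits (i, a) (i, b) (fun v => if v ∈ Z then 0 else s v) =
      fun v => if v ∈ Z then 0 else s v := by
    intro s
    simp only [cnotBits, ha, hb, if_true, add_zero]
    exact Function.update_eq_self_iff.2 (if_pos hb).symm
  rw [h]
  split_ifs
  · rw [denote_cnotAt_outer_ket, e, e]
  · simpa using (isChannel_cnotAt i a b hab).map_smul 0 0

theorem Resets.encode {Z : Finset FTVar} {E : Op FTVar → Op FTVar} (h : Resets Z E) (i : Fin 2)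
    (hi : (i, 0) ∈ Z) :
    Resets (insert (i, 4) (insert (i, 3) (insert (i, 2) (insert (i, 1) Z))))
      fun ρ => (QWhile.encode i).denote (E ρ) :=
  (((((h.init (i, 1)).init (i, 2)).init (i, 3)).init (i, 4)).cnotAt i 0 1 (by decide)
    (by simp [hi]) (by simp)).cnotAt i 0 2 (by decide) (by simp [hi]) (by simp)

/-- The first part of the loop body resets all qubits; `|0…0⟩` is a codeword. -/
theorem denote_reset_encode (ρ : Op FTVar) :
    (QWhile.encode 1).denote ((QWhile.encode 0).denote
      ((Prog.init (1, 0)).denote ((Prog.init (0, 0)).denote ρ))) =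
      ρ.trace • transport encBits (outer (ket 0) (ket 0)) := by
  have h := ((((Resets.empty.init ((0, 0) : FTVar)).init (1, 0)).encode 0 (by decide)).encode 1
    (by decide)).denote_eq (by decide) ((isChannel_encode 1).comp ((isChannel_encode 0).comp
      ((isChannel_init _).comp (isChannel_init _)))) ρ
  rw [h, transport_outer_ket]
  have e : encBits 0 = 0 := by
    funext v
    simp [encBits]
  rw [e]

/-- The effect of `DECODE` on the bits of a codeword. -/
def decodeBits (i : Fin 2) (s : FTVar → Fin 2) : FTVar → Fin 2 :=
  fun v => if v.1 = i ∧ (v.2 = 1 ∨ v.2 = 2) then 0 else s v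

theorem denote_decode_outer_ket (i : Fin 2) {s t : FTVar → Fin 2} (hs : CodeState i s)
    (ht : CodeState i t) : (decode i).denote (outer (ket s) (ket t)) =
      outer (ket (decodeBits i s)) (ket (decodeBits i t)) := by
  have hinit : ∀ q : FTVar, s q = 0 → t q = 0 →
      (Prog.init q).denote (outer (ket s) (ket t)) = outer (ket s) (ket t) := by
    intro q h1 h2
    rw [denote_init_outer_ket, if_pos (h1.trans h2.symm),
      Function.update_eq_self_iff.2 h1.symm, Function.update_eq_self_iff.2 h2.symm]
  have hc : ∀ s : FTVar → Fin 2, CodeState i s →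
      cnotBits (i, 0) (i, 1) (cnotBits (i, 0) (i, 2) s) = decodeBits i s := by
    rintro s ⟨h1, h2, -, -⟩
    have h0 : ∀ a : Fin 2, a + a = 0 := by decide
    funext ⟨j, k⟩
    by_cases hj : j = i
    · subst hj
      fin_cases k <;> simp [cnotBits, decodeBits, h0, ← h1, ← h2]
    · simp [cnotBits, decodeBits, hj]
  simp only [decode, denote_seq]
  rw [hinit _ hs.2.2.1 ht.2.2.1, hinit _ hs.2.2.2 ht.2.2.2, denote_cnotAt_outer_ket,
    denote_cnotAt_outer_ket, hc s hs, hc t ht]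

/-- Decoding moves encoded bits back to the logical qubits. -/
theorem denote_decode_transport (ρ : Op (Fin 2)) :
    (decode 1).denote ((decode 0).denote (transport encBits ρ)) = transport liftBits ρ := by
  have hc := (isChannel_decode 1).comp (isChannel_decode 0)
  have e : ∀ f : (Fin 2 → Fin 2) → FTVar → Fin 2, transport f ρ =
      ∑ x, ∑ y, ρ x y • outer (ket (f x)) (ket (f y)) := by
    intro f
    conv_lhs => rw [eq_sum_outer_ket ρ]
    simp only [transport_sum, transport_smul, transport_outer_ket]
  have hd : ∀ x, CodeState 1 (decodeBits 0 (encBits x)) := fun x => ⟨rfl, rfl, rfl, rfl⟩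
  have hl : ∀ x, decodeBits 1 (decodeBits 0 (encBits x)) = liftBits x := by
    intro x
    funext ⟨i, k⟩
    fin_cases i <;> fin_cases k <;> rfl
  rw [e, e, hc.map_sum]
  refine Finset.sum_congr rfl fun x _ => ?_
  rw [hc.map_sum]
  refine Finset.sum_congr rfl fun y _ => ?_
  rw [hc.map_smul, denote_decode_outer_ket 0 (codeState_encBits 0 x) (codeState_encBits 0 y),
    denote_decode_outer_ket 1 (hd x) (hd y), hl, hl]

/-- The state after one run of the fault-tolerant loop body. -/
def ftState (c pV pU : unitInterval) : Op FTVar :=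
  transport liftBits (coinState c (logicalRate pV) (logicalRate pU))

theorem posSemidef_ftState (c pV pU : unitInterval) : (ftState c pV pU).PosSemidef :=
  posSemidef_transport _ (posSemidef_coinState _ _ _)

theorem trace_ftState (c pV pU : unitInterval) : (ftState c pV pU).trace = 1 := by
  rw [ftState, trace_transport liftBits_injective, trace_coinState]

theorem denote_ftQbf {c pV pU : unitInterval} {V' : Matrix.unitaryGroup (Fin 3 → Fin 2) ℂ}
    {U' : Matrix.unitaryGroup (Fin 2 × Fin 3 → Fin 2) ℂ} (hV : Encodes V' (coinV c))
    (hU : Encodes₂ U' bellU) (ρ : Op FTVar) :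
    (ftQbf pV pU V' U').denote ρ = ρ.trace •
      (sandwich (embed (single (1, 0)) (stdMeas.op 0)) (ftState c pV pU)).trace⁻¹ •
        sandwich (embed (single (1, 0)) (stdMeas.op 0)) (ftState c pV pU) := by
  refine denote_initOne_loop_of_reset (posSemidef_ftState c pV pU) (trace_ftState c pV pU)
    (fun ρ => ?_) ρ
  change (decode 1).denote ((decode 0).denote ((correctedU pU U').denote
    ((correctedV pV V' 1).denote ((correctedV pV V' 0).denote ((QWhile.encode 1).denote
      ((QWhile.encode 0).denote ((Prog.init (1, 0)).denote ((Prog.init (0, 0)).denote ρ)))))))) = _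
  rw [denote_reset_encode, ← transport_smul, denote_correctedV_transport pV hV,
    denote_correctedV_transport pV hV, denote_correctedU_transport pU hU, denote_decode_transport]
  change transport liftBits ((coinGates c (logicalRate pV) (logicalRate pU)).denote _) = _
  rw [(isChannel_coinGates _ _ _).map_smul, transport_smul]
  rfl

/-- The guard of the loop measures the logical qubit of the second block. -/
theorem sandwich_stdMeas_ftState (c pV pU : unitInterval) :
    sandwich (embed (single (1, 0)) (stdMeas.op 0)) (ftState c pV pU) = transport liftBits
      (sandwich (embed (single 1) (stdMeas.op 0))
        (coinState c (logicalRate pV) (logicalRate pU))) := by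
  refine sandwich_transport (ext_mulVec_ket fun x => ?_) _
  rw [← Matrix.mulVec_mulVec, ← Matrix.mulVec_mulVec, relabel_mulVec_ket, embed_stdMeas_mulVec_ket,
    embed_stdMeas_mulVec_ket]
  change (if x 1 = 0 then _ else _) = _
  split_ifs
  · rw [relabel_mulVec_ket]
  · rw [Matrix.mulVec_zero]

theorem denote_ideal_ftQbf (pV pU : unitInterval) (V' : Matrix.unitaryGroup (Fin 3 → Fin 2) ℂ)
    (U' : Matrix.unitaryGroup (Fin 2 × Fin 3 → Fin 2) ℂ) :
    (ftQbf pV pU V' U').ideal.denote = (ftQbf 0 0 V' U').denote :=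
  denote_seq_congr rfl <| denote_seq_congr rfl <| denote_loop_congr _ _ <|
    denote_seq_congr rfl <| denote_seq_congr rfl <| denote_seq_congr rfl <| denote_seq_congr rfl <|
    denote_seq_congr (denote_ideal_correctedV _ _ _) <|
    denote_seq_congr (denote_ideal_correctedV _ _ _) <|
    denote_seq_congr (denote_ideal_correctedU _ _) rfl

theorem robust_ftQbf {c : unitInterval} (pV pU : unitInterval)
    {V' : Matrix.unitaryGroup (Fin 3 → Fin 2) ℂ}
    {U' : Matrix.unitaryGroup (Fin 2 × Fin 3 → Fin 2) ℂ} (hV : Encodes V' (coinV c))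
    (hU : Encodes₂ U' bellU) :
    Robust 1 0 (ftQbf pV pU V' U')
      (4 * logicalErr pV + 2 * (2 * logicalErr pU - logicalErr pU ^ 2)) := by
  rw [Robust, denote_ideal_ftQbf]
  have hsub : (ftState c pV pU - (((1 - logicalErr pV) ^ 2 * (1 - logicalErr pU) ^ 2 : ℝ) : ℂ) •
      ftState c 0 0).PosSemidef := by
    have := posSemidef_transport liftBits
      (posSemidef_coinState_sub c (logicalRate pV) (logicalRate pU))
    rw [sub_eq_add_neg, ← neg_smul, transport, Matrix.mul_add, Matrix.add_mul] at this
    rw [sub_eq_add_neg, ← neg_smul, ftState, ftState, logicalRate_zero, ← transport_smul]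
    exact this
  have hhalf : (sandwich (embed (single (1, 0)) (stdMeas.op 0)) (ftState c 0 0)).trace = 1 / 2 := by
    rw [sandwich_stdMeas_ftState, trace_transport liftBits_injective, logicalRate_zero,
      trace_sandwich_coinState_zero]
  refine (qDiamond_conditioned_le (embed_measurement_complete (single (1, 0)) stdMeas)
    (denote_ftQbf hV hU) (denote_ftQbf hV hU) (trace_ftState c pV pU) (posSemidef_ftState c 0 0)
    (trace_ftState c 0 0) hhalf (by positivity) hsub).trans ?_
  exact ENNReal.ofReal_le_ofReal (two_mul_one_sub_le (logicalErr_mem pV).1 (logicalErr_mem pV).2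
    (logicalErr_mem pU).1 (logicalErr_mem pU).2)

theorem Robust.mono {Var : Type} [Fintype Var] [DecidableEq Var] {Q : Op Var} {lam ε ε' : ℝ}
    {P : Prog Var} (h : Robust Q lam P ε) (hε : ε ≤ ε') : Robust Q lam P ε' :=
  h.trans (ENNReal.ofReal_le_ofReal hε)

theorem logicalErr_le (p : unitInterval) : logicalErr p ≤ 3 * (p : ℝ) ^ 2 := by
  have := pow_nonneg p.2.1 3
  rw [logicalErr]
  nlinarith

theorem xxx_eq : xxx = flipOp fun _ => 1 := by simp [xxx, flipOp]

/-- The mixture of a gate with its completely flipped version, as a sum over the two patterns. -/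
theorem sum_flip_smul {E : Type} [AddCommGroup E] [Module ℂ E] (q : ℝ) (V : Op (Fin 3))
    (G : Op (Fin 3) → E) :
    ∑ b : Fin 2, ((if b = 1 then q else 1 - q : ℝ) : ℂ) • G (flipOp (fun _ : Fin 3 => b) * V) =
      ((1 - q : ℝ) : ℂ) • G V + (q : ℂ) • G (xxx * V) := by
  have h0 : flipOp (fun _ : Fin 3 => (0 : Fin 2)) = 1 := flipOp_zero
  rw [Fin.sum_univ_two, if_neg (by decide), if_pos rfl, h0, Matrix.one_mul, xxx_eq]

end

end QWhile

open QWhile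

theorem mainTheorem5 :
    (∀ (c pV pU : unitInterval) (V' : Matrix.unitaryGroup (Fin 3 → Fin 2) ℂ)
        (U' : Matrix.unitaryGroup (Fin 2 × Fin 3 → Fin 2) ℂ),
      Encodes V' (coinV c) → Encodes₂ U' bellU →
      -- semantics and robustness of the corrected noisy encoded `V`
      (∀ (i : Fin 2) (ρ : Op FTVar), codeProj i * ρ * codeProj i = ρ →
        (correctedV pV V' i).denote ρ =
          ((1 - logicalErr pV : ℝ) : ℂ) • sandwich (embed (block i) V'.1) ρ +
          ((logicalErr pV : ℝ) : ℂ) • sandwich (embed (block i) (xxx * V'.1)) ρ) ∧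
      diamond
          (fun ρ => ((1 - logicalErr pV : ℝ) : ℂ) • sandwich V'.1 ρ +
            ((logicalErr pV : ℝ) : ℂ) • sandwich (xxx * V'.1) ρ)
          (sandwich V'.1) = ENNReal.ofReal (logicalErr pV) ∧
      (∀ i : Fin 2,
        qDiamond (codeProj i) 1 (correctedV pV V' i).denote (correctedV pV V' i).ideal.denote =
          ENNReal.ofReal (logicalErr pV)) ∧
      -- semantics and robustness of the corrected noisy encoded `U`
      (∀ ρ : Op FTVar,
        (codeProj 0 * codeProj 1) * ρ * (codeProj 0 * codeProj 1) = ρ →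
        (correctedU pU U').denote ρ =
          ∑ b, ((flipProb (logicalErr pU) b : ℝ) : ℂ) •
            sandwich (embed blocks (blockX b * U'.1)) ρ) ∧
      diamond
          (fun ρ => ∑ b, ((flipProb (logicalErr pU) b : ℝ) : ℂ) • sandwich (blockX b * U'.1) ρ)
          (sandwich U'.1) = ENNReal.ofReal (2 * logicalErr pU - logicalErr pU ^ 2) ∧
      qDiamond (codeProj 0 * codeProj 1) 1 (correctedU pU U').denote
          (correctedU pU U').ideal.denote =
        ENNReal.ofReal (2 * logicalErr pU - logicalErr pU ^ 2) ∧
      -- robustness of the fault-tolerant factory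
      Robust 1 0 (ftQbf pV pU V' U')
        (4 * logicalErr pV + 2 * (2 * logicalErr pU - logicalErr pU ^ 2))) ∧
    -- the factory without error correction
    (∀ c pV pU : unitInterval,
      diamond (bitFlip pV).apply id = ENNReal.ofReal pV ∧
      diamond ((bitFlip pU).tensorPow (Fin 2)).apply id =
        ENNReal.ofReal (2 * (pU : ℝ) - (pU : ℝ) ^ 2) ∧
      Robust 1 0 (qbf c pV pU) (4 * (pV : ℝ) + 2 * (2 * (pU : ℝ) - (pU : ℝ) ^ 2))) ∧
    -- constant error rate `p`: `O(p ^ 2)` with error correction, `O(p)` without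
    (∃ C : ℝ, ∀ (c p : unitInterval) (V' : Matrix.unitaryGroup (Fin 3 → Fin 2) ℂ)
        (U' : Matrix.unitaryGroup (Fin 2 × Fin 3 → Fin 2) ℂ),
      Encodes V' (coinV c) → Encodes₂ U' bellU → Robust 1 0 (ftQbf p p V' U') (C * (p : ℝ) ^ 2)) ∧
    (∃ C : ℝ, ∀ c p : unitInterval, Robust 1 0 (qbf c p p) (C * (p : ℝ))) := by
  refine ⟨fun c pV pU V' U' hV hU => ⟨fun i ρ hρ => ?_, ?_, qDiamond_correctedV pV hV,
    fun ρ hρ => denote_correctedU pU hU (supportedOn_of_diagonal codeProj_mul_codeProj hρ),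
    diamond_U pU U', qDiamond_correctedU pU hU, robust_ftQbf pV pU hV hU⟩,
    fun c pV pU => ⟨diamond_bitFlip pV, ?_, robust_qbf c pV pU⟩, ⟨24, fun c p V' U' hV hU => ?_⟩,
    ⟨8, fun c p => ?_⟩⟩
  · rw [denote_correctedV pV hV i (supportedOn_of_diagonal rfl hρ)]
    exact sum_flip_smul _ V'.1 fun A => sandwich (embed (block i) A) ρ
  · rw [← diamond_V pV V']
    congr 1
    funext ρ
    exact (sum_flip_smul _ V'.1 fun A => sandwich A ρ).symm
  · rw [diamond_tensorPow_bitFlip, Fintype.card_fin]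
    congr 1
    ring
  · refine (robust_ftQbf p p hV hU).mono ?_
    have := logicalErr_le p
    nlinarith [sq_nonneg (logicalErr p)]
  · refine (robust_qbf c p p).mono ?_
    nlinarith [sq_nonneg (p : ℝ)]
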